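/- A \emph{flow network} is $N=\langle AP,V,E,c,\rho,s,T\rangle$, where $AP$ is a finite set of atomic propositions, $V$ is a finite set of vertices, $s\in V$ is the source, $T\subseteq V\setminus\{s\}$ is the set of targets, $E\subseteq (V\setminus T)\times(V\setminus\{s\})$ is the set of edges, $c:E\to\mathbb N$ gives the capacities, and $\rho:V\to 2^{AP}$ is a labeling; every $t\in T$ is reachable from $s$, and from every vertex some target is reachable. A \emph{flow} is a function $f:E\to\mathbb N$ with $f(e)\le c(e)$ for all $e\in E$ such that at every $v\in V\setminus(\{s\}\cup T)$ the total flow on the incoming edges equals the total flow on the outgoing edges; $f(v)$ is the total flow on the edges leaving $v$ if $v=s$, and on the edges entering $v$ otherwise. A \emph{target $v$-path} is a finite sequence $v_0,\dots,v_k$ ($k\ge 0$) with $v_0=v$, $\langle v_i,v_{i+1}\rangle\in E$ for all $i<k$, and $v_k\in T$. The \emph{state formulas} of BFL$^\star$ are $\varphi ::= p \mid {>}\gamma \mid {\ge}\gamma \mid \neg\varphi \mid \varphi\vee\varphi \mid A\psi \mid \mathcal A\varphi$ and the \emph{path formulas} are $\psi ::= \varphi \mid \neg\psi \mid \psi\vee\psi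 \mid X\psi \mid \psi U\psi$, where $p$ is an atomic proposition and $\gamma\in\mathbb N$. For a vertex $v$ and a flow $f$: $v,f\models p$ iff $p\in\rho(v)$; $v,f\models{>}\gamma$ iff $f(v)>\gamma$, and $v,f\models{\ge}\gamma$ iff $f(v)\ge\gamma$; $v,f\models A\psi$ iff $\pi,f\models\psi$ for all target $v$-paths $\pi$; $v,f\models\mathcal A\varphi$ iff $v,f'\models\varphi$ for all flows $f'$. For a path $\pi=v_0,\dots,v_k$ with suffixes $\pi^i=v_i,\dots,v_k$: $\pi,f\models\varphi$ iff $v_0,f\models\varphi$ for a state formula $\varphi$; $\pi,f\models X\psi$ iff $k>0$ and $\pi^1,f\models\psi$; $\pi,f\models\psi_1U\psi_2$ iff there is $j\le k$ with $\pi^j,f\models\psi_2$ and $\pi^i,f\models\psi_1$ for all $i<j$. Negation and disjunction are interpreted as usual. A formula is \emph{closed} if every flow proposition ${>}\gamma$, ${\ge}\gamma$ in it is in the scope of a flow quantifier $\mathcal A$; for a closed state formula satisfaction does not depend on $f$, and $N\models\varphi$ means $s\models\varphi$. BFL$^\star$ is the set of closed state formulas. \textbf{Theorem.} Let $\varphi$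 be a fixed BFL$^\star$ formula. The problem of deciding, given a flow network $N$ (described by a binary word, with the capacities written in binary), whether $N\models\varphi$ is in $\Delta_2^P=\mathrm P^{\mathrm{NP}}$ (in terms of the size of $N$). Moreover, if $k$ is the number of occurrences of subformulas of the form $\mathcal A\varphi'$ in $\varphi$, then the problem is decided by a deterministic polynomial-time Turing machine with an oracle in NP that on every flow network with $n$ vertices makes at most $k\cdot n$ oracle calls. -/

import Mathlib

/-! ## Flow networks and flows -/

/-- A finite flow network `⟨AP, V, E, c, ρ, s, T⟩`. The vertices are the elements of the finite
type `V`, and the names of atomic propositions are taken from the type `P`. -/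
structure FlowNetwork (P V : Type) [Fintype V] [DecidableEq V] where
  /-- the atomic propositions of the network -/
  AP : Finset P
  /-- the directed edges -/
  E : Finset (V × V)
  /-- the capacities of the edges -/
  c : {e // e ∈ E} → ℕ
  /-- the labeling of the vertices -/
  ρ : V → Finset P
  /-- the source -/
  s : V
  /-- the targets -/
  T : Finset V
  label_subset : ∀ v, ρ v ⊆ AP
  source_notMem : s ∉ T
  edge_fst_notMem : ∀ e ∈ E, e.1 ∉ T
  edge_snd_ne : ∀ e ∈ E, e.2 ≠ s
  target_reachable : ∀ t ∈ T, Relation.ReflTransGen (fun u w => (u, w) ∈ E) s t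
  reaches_target : ∀ v, ∃ t ∈ T, Relation.ReflTransGen (fun u w => (u, w) ∈ E) v t

namespace FlowNetwork

variable {P V : Type} [Fintype V] [DecidableEq V] (N : FlowNetwork P V)

/-- The total value of `f` on the edges that enter `v`. -/
def inflow (f : {e // e ∈ N.E} → ℕ) (v : V) : ℕ :=
  ∑ e : {e // e ∈ N.E}, if e.1.2 = v then f e else 0

/-- The total value of `f` on the edges that leave `v`. -/
def outflow (f : {e // e ∈ N.E} → ℕ) (v : V) : ℕ :=
  ∑ e : {e // e ∈ N.E}, if e.1.1 = v then f e else 0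

/-- The (integral) flow functions of the network. -/
structure Flow where
  /-- the value of the flow on an edge -/
  val : {e // e ∈ N.E} → ℕ
  le_capacity : ∀ e, val e ≤ N.c e
  conservation : ∀ v, v ≠ N.s → v ∉ N.T → N.inflow val v = N.outflow val v

/-- The flow through a vertex: what leaves it if it is the source, and what enters it otherwise
(for a vertex that is neither the source nor a target the two agree). -/
def Flow.through {N : FlowNetwork P V} (f : N.Flow) (v : V) : ℕ :=
  if v = N.s then N.outflow f.val v else N.inflow f.val v

/-- `π` is a target `v`-path: a finite nonempty sequence of vertices that starts at `v`, follows
the edges, and ends in a target. -/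
def IsTargetPath (v : V) (π : List V) : Prop :=
  π.head? = some v ∧ π.IsChain (fun u w => (u, w) ∈ N.E) ∧ ∃ t ∈ N.T, π.getLast? = some t

end FlowNetwork

/-! ## The logic BFL* -/

mutual

/-- State formulas of BFL* over the atomic propositions `P`. -/
inductive StateFormula (P : Type) : Type
  /-- an atomic proposition -/
  | atom (p : P)
  /-- the flow proposition `> γ` -/
  | flowGt (γ : ℕ)
  /-- the flow proposition `≥ γ` -/
  | flowGe (γ : ℕ)
  | neg (φ : StateFormula P)
  | disj (φ₁ φ₂ : StateFormula P)
  /-- `A ψ`: for all (target) paths -/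
  | allPaths (ψ : PathFormula P)
  /-- `𝒜 φ`: for all flow functions -/
  | allFlows (φ : StateFormula P)

/-- Path formulas of BFL* over the atomic propositions `P`. -/
inductive PathFormula (P : Type) : Type
  | state (φ : StateFormula P)
  | neg (ψ : PathFormula P)
  | disj (ψ₁ ψ₂ : PathFormula P)
  /-- `X ψ` -/
  | next (ψ : PathFormula P)
  /-- `ψ₁ U ψ₂` -/
  | until (ψ₁ ψ₂ : PathFormula P)

end

mutual

/-- A formula is closed if all its flow propositions are in the scope of a flow quantifier. -/
def StateFormula.Closed {P : Type} : StateFormula P → Prop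
  | .atom _ => True
  | .flowGt _ => False
  | .flowGe _ => False
  | .neg φ => φ.Closed
  | .disj φ₁ φ₂ => φ₁.Closed ∧ φ₂.Closed
  | .allPaths ψ => ψ.Closed
  | .allFlows _ => True

/-- A formula is closed if all its flow propositions are in the scope of a flow quantifier. -/
def PathFormula.Closed {P : Type} : PathFormula P → Prop
  | .state φ => φ.Closed
  | .neg ψ => ψ.Closed
  | .disj ψ₁ ψ₂ => ψ₁.Closed ∧ ψ₂.Closed
  | .next ψ => ψ.Closed
  | .until ψ₁ ψ₂ => ψ₁.Closed ∧ ψ₂.Closed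

end

mutual

/-- The number of (occurrences of) subformulas of the form `𝒜 φ`. -/
def StateFormula.numFlowQuantifiers {P : Type} : StateFormula P → ℕ
  | .atom _ => 0
  | .flowGt _ => 0
  | .flowGe _ => 0
  | .neg φ => φ.numFlowQuantifiers
  | .disj φ₁ φ₂ => φ₁.numFlowQuantifiers + φ₂.numFlowQuantifiers
  | .allPaths ψ => ψ.numFlowQuantifiers
  | .allFlows φ => φ.numFlowQuantifiers + 1

/-- The number of (occurrences of) subformulas of the form `𝒜 φ`. -/
def PathFormula.numFlowQuantifiers {P : Type} : PathFormula P → ℕ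
  | .state φ => φ.numFlowQuantifiers
  | .neg ψ => ψ.numFlowQuantifiers
  | .disj ψ₁ ψ₂ => ψ₁.numFlowQuantifiers + ψ₂.numFlowQuantifiers
  | .next ψ => ψ.numFlowQuantifiers
  | .until ψ₁ ψ₂ => ψ₁.numFlowQuantifiers + ψ₂.numFlowQuantifiers

end

section Semantics

variable {P V : Type} [Fintype V] [DecidableEq V]

mutual

/-- `φ.Sat N v f` is `v, f ⊨ φ` in the network `N`. -/
def StateFormula.Sat (N : FlowNetwork P V) : StateFormula P → V → N.Flow → Prop
  | .atom p, v, _ => p ∈ N.ρ v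
  | .flowGt γ, v, f => f.through v > γ
  | .flowGe γ, v, f => f.through v ≥ γ
  | .neg φ, v, f => ¬ StateFormula.Sat N φ v f
  | .disj φ₁ φ₂, v, f => StateFormula.Sat N φ₁ v f ∨ StateFormula.Sat N φ₂ v f
  | .allPaths ψ, v, f => ∀ π, N.IsTargetPath v π → PathFormula.Sat N ψ π f
  | .allFlows φ, v, _ => ∀ f' : N.Flow, StateFormula.Sat N φ v f'

/-- `ψ.Sat N π f` is `π, f ⊨ ψ` in the network `N`, for a nonempty finite path `π`; its suffix
from position `j` on is `π.drop j`. The next-time operator is the strong one. -/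
def PathFormula.Sat (N : FlowNetwork P V) : PathFormula P → List V → N.Flow → Prop
  | .state φ, π, f => ∃ v, π.head? = some v ∧ StateFormula.Sat N φ v f
  | .neg ψ, π, f => ¬ PathFormula.Sat N ψ π f
  | .disj ψ₁ ψ₂, π, f => PathFormula.Sat N ψ₁ π f ∨ PathFormula.Sat N ψ₂ π f
  | .next ψ, π, f => 1 < π.length ∧ PathFormula.Sat N ψ (π.drop 1) f
  | .until ψ₁ ψ₂, π, f => ∃ j < π.length, PathFormula.Sat N ψ₂ (π.drop j) f ∧
      ∀ i < j, PathFormula.Sat N ψ₁ (π.drop i) f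

end

/-- `N ⊨ φ`. For a closed formula, satisfaction at the source does not depend on the flow function
(and there is always one, the zero flow), so it may be quantified universally. -/
def FlowNetwork.Models (N : FlowNetwork P V) (φ : StateFormula P) : Prop :=
  ∀ f : N.Flow, φ.Sat N N.s f

end Semantics

/-! ## Networks as binary words -/

/-- Unary code of a number: `n` ones and a terminating zero. -/
def unaryCode (n : ℕ) : List Bool :=
  List.replicate n true ++ [false]

/-- Self-delimiting binary code of a number: each binary digit (least significant first) is preceded
by a one, and the code is terminated by a zero. -/
def binaryCode (k : ℕ) : List Bool :=
  k.bits.flatMap (fun b => [true, b]) ++ [false]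

/-- The word that describes a network with vertices `0, …, n - 1` and atomic propositions
`0, …, m - 1`: the numbers `n` and `m`, and then, for each vertex `v`, one bit for `v = s`, one bit
for `v ∈ T`, one bit for each atomic proposition, and the row of `v` in the adjacency matrix, where
each edge is followed by its capacity in binary. -/
def FlowNetwork.encode {n : ℕ} (N : FlowNetwork ℕ (Fin n)) (m : ℕ) : List Bool :=
  unaryCode n ++ unaryCode m ++ (List.finRange n).flatMap fun v =>
    decide (v = N.s) :: decide (v ∈ N.T) ::
      ((List.range m).map fun p => decide (p ∈ N.ρ v)) ++
      (List.finRange n).flatMap fun w =>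
        if h : (v, w) ∈ N.E then true :: binaryCode (N.c ⟨(v, w), h⟩) else [false]

/-- The model-checking problem for the fixed formula `φ`: the set of descriptions of the flow
networks that satisfy `φ`. Vertices and atomic propositions are numbered consecutively; the network
may have any finite number of atomic propositions. -/
def modelCheckingProblem (φ : StateFormula ℕ) : Set (List Bool) :=
  {x | ∃ (n m : ℕ) (N : FlowNetwork ℕ (Fin n)),
    N.AP = Finset.range m ∧ x = N.encode m ∧ N.Models φ}

/-! ## Oracle machines and complexity classes -/

/-- A deterministic oracle Turing machine, on top of Mathlib's multi-stack model `Turing.TM2`: there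
are finitely many stacks of bits, program labels and internal states. At a label `l` with
`query l = some (y, n)` the machine asks the oracle whether the word on the query stack belongs to
it, and continues at `y` or at `n` according to the answer; at the other labels it executes its
program. -/
structure OracleTM where
  /-- the stacks -/
  K : Type
  [decEqK : DecidableEq K]
  [finK : Fintype K]
  /-- the program labels -/
  Λ : Type
  [finΛ : Fintype Λ]
  /-- the internal states -/
  σ : Type
  [finσ : Fintype σ]
  inputStack : K
  queryStack : K
  outputStack : K
  /-- the label at which the computation starts -/
  main : Λ
  initialState : σ
  program : Λ → Turing.TM2.Stmt (fun _ : K => Bool) Λ σ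
  query : Λ → Option (Λ × Λ)

namespace OracleTM

variable (M : OracleTM)

instance : DecidableEq M.K := M.decEqK

/-- Configurations: the current label (`none` if the machine has halted), the internal state, and
the contents of the stacks. -/
abbrev Cfg : Type := Turing.TM2.Cfg (fun _ : M.K => Bool) M.Λ M.σ

/-- The initial configuration on input `x`. -/
def init (x : List Bool) : M.Cfg :=
  ⟨some M.main, M.initialState, fun k => if k = M.inputStack then x else []⟩

open scoped Classical in
/-- One step of the machine with oracle `A`. -/
noncomputable def step (A : Set (List Bool)) : M.Cfg → Option M.Cfg
  | ⟨none, _, _⟩ => none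
  | ⟨some l, v, S⟩ =>
    match M.query l with
    | some (y, n) => some ⟨some (if S M.queryStack ∈ A then y else n), v, S⟩
    | none => some (Turing.TM2.stepAux (M.program l) v S)

/-- The number of oracle calls (`0` or `1`) made in the step from a configuration. -/
def callsAt (C : M.Cfg) : ℕ :=
  if (C.l.bind M.query).isSome then 1 else 0

/-- `M.Run A C t q C'`: with oracle `A`, the machine gets from `C` to `C'` in exactly `t` steps and
with exactly `q` oracle calls. -/
inductive Run (A : Set (List Bool)) : M.Cfg → ℕ → ℕ → M.Cfg → Prop
  | refl (C : M.Cfg) : Run A C 0 0 C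
  | step {C C' C'' : M.Cfg} {t q : ℕ} (h : M.step A C = some C') (h' : Run A C' t q C'') :
      Run A C (t + 1) (M.callsAt C + q) C''

open scoped Classical in
/-- With oracle `A`, the machine halts on every input `x` within `p(|x|)` steps, with `true` on top
of the output stack if `x ∈ L` and with `false` on top of it if `x ∉ L`. -/
def DecidesInTime (A L : Set (List Bool)) (p : Polynomial ℕ) : Prop :=
  ∀ x : List Bool, ∃ (t q : ℕ) (C : M.Cfg), M.Run A (M.init x) t q C ∧ t ≤ p.eval x.length ∧
    C.l = none ∧ (C.stk M.outputStack).head? = some (decide (x ∈ L))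

/-- With oracle `A`, the machine makes at most `q₀` oracle calls on input `x`. -/
def CallsAtMost (A : Set (List Bool)) (x : List Bool) (q₀ : ℕ) : Prop :=
  ∀ (t q : ℕ) (C : M.Cfg), M.Run A (M.init x) t q C → q ≤ q₀

end OracleTM

/-- `P`: polynomial time without an oracle (that is, with the empty one). -/
def InP (L : Set (List Bool)) : Prop :=
  ∃ (M : OracleTM) (p : Polynomial ℕ), M.DecidesInTime ∅ L p

/-- The word that encodes a pair of words. -/
def pairCode (x w : List Bool) : List Bool :=
  x.flatMap (fun b => [true, b]) ++ false :: w

/-- `NP`: membership has certificates of polynomial length that can be verified in polynomial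
time. -/
def InNP (L : Set (List Bool)) : Prop :=
  ∃ R : Set (List Bool), InP R ∧ ∃ p : Polynomial ℕ, ∀ x : List Bool,
    x ∈ L ↔ ∃ w : List Bool, w.length ≤ p.eval x.length ∧ pairCode x w ∈ R

/-- `Δ₂ᴾ = P^NP`: polynomial time with an oracle in `NP`. -/
def InDeltaTwoP (L : Set (List Bool)) : Prop :=
  ∃ A : Set (List Bool), InNP A ∧ ∃ (M : OracleTM) (p : Polynomial ℕ), M.DecidesInTime A L p

/-! ## Structured programs over four stacks -/

/-- Structured programs over four stacks of bits. Stack `0` is the main stack, stack `2` is also the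
query stack. -/
inductive Prog
  | skip
  | push (k : Fin 4) (b : Bool)
  | seq (p q : Prog)
  /-- pop the stack `k` and branch on the result -/
  | pop (k : Fin 4) (br : Option Bool → Prog)
  /-- as long as the stack `k` is nonempty, pop it and execute the body for the popped bit -/
  | loop (k : Fin 4) (body : Bool → Prog)
  /-- branch on the answer of the oracle to the word on the stack `2` -/
  | query (br : Bool → Prog)

/-- The contents of the four stacks. -/
abbrev Store : Type := Fin 4 → List Bool

namespace Prog

open Function (update)

open scoped Classical in
/-- `Exec A p S t q S'`: with oracle `A`, the program `p` transforms the store `S` into `S'` in `t`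
steps and with `q` oracle calls. -/
inductive Exec (A : Set (List Bool)) : Prog → Store → ℕ → ℕ → Store → Prop
  | skip (S) : Exec A skip S 1 0 S
  | push (k b S) : Exec A (push k b) S 1 0 (update S k (b :: S k))
  | seq {p p' S S' S'' t t' q q'} : Exec A p S t q S' → Exec A p' S' t' q' S'' →
      Exec A (seq p p') S (t + t') (q + q') S''
  | pop {k br S S' t q} : Exec A (br (S k).head?) (update S k (S k).tail) t q S' →
      Exec A (pop k br) S (t + 1) q S'
  | loop_nil {k body S} : S k = [] → Exec A (loop k body) S 1 0 S
  | loop_cons {k body S S' S'' t t' q q' b l} : S k = b :: l →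
      Exec A (body b) (update S k l) t q S' → Exec A (loop k body) S' t' q' S'' →
      Exec A (loop k body) S (t + t' + 1) (q + q') S''
  | query {br S S' t q} : Exec A (br (decide (S 2 ∈ A))) S t q S' →
      Exec A (query br) S (t + 1) (q + 1) S'

/-- Machine instructions. -/
inductive Instr (Λ : Type)
  | jump (l : Λ)
  | push (k : Fin 4) (b : Bool) (l : Λ)
  | pop (k : Fin 4) (l : Option Bool → Λ)
  | query (l : Bool → Λ)

/-- Relabeling of an instruction. -/
def Instr.map {Λ Λ' : Type} (f : Λ → Λ') : Instr Λ → Instr Λ'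
  | jump l => jump (f l)
  | push k b l => push k b (f l)
  | pop k l => pop k (f ∘ l)
  | query l => query (f ∘ l)

theorem Instr.map_map {Λ Λ' Λ'' : Type} (f : Λ → Λ') (g : Λ' → Λ'') (i : Instr Λ) :
    (i.map f).map g = i.map (g ∘ f) := by
  cases i <;> rfl

theorem Instr.map_map_eq {Λ Λ' Λ'' : Type} {f : Λ → Λ'} {g : Λ' → Λ''} {h : Λ → Λ''}
    (e : ∀ l, g (f l) = h l) (i : Instr Λ) : (i.map f).map g = i.map h := by
  rw [Instr.map_map, show g ∘ f = h from funext e]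

/-- The labels of the compiled program. -/
def Label : Prog → Type
  | skip => Unit
  | push _ _ => Unit
  | seq p q => p.Label ⊕ q.Label
  | pop _ br => Option (Σ o, (br o).Label)
  | loop _ body => Option (Σ b, (body b).Label)
  | query br => Option (Σ b, (br b).Label)

instance finite_label : (p : Prog) → Finite p.Label
  | skip => inferInstanceAs (Finite Unit)
  | push _ _ => inferInstanceAs (Finite Unit)
  | seq p q =>
    haveI := finite_label p
    haveI := finite_label q
    inferInstanceAs (Finite (p.Label ⊕ q.Label))
  | pop _ br =>
    haveI := fun o => finite_label (br o)
    inferInstanceAs (Finite (Option (Σ o, (br o).Label)))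
  | loop _ body =>
    haveI := fun b => finite_label (body b)
    inferInstanceAs (Finite (Option (Σ b, (body b).Label)))
  | query br =>
    haveI := fun b => finite_label (br b)
    inferInstanceAs (Finite (Option (Σ b, (br b).Label)))

/-- The label at which the compiled program starts. -/
def entry : (p : Prog) → p.Label
  | skip => ()
  | push _ _ => ()
  | seq p _ => Sum.inl p.entry
  | pop _ _ => none
  | loop _ _ => none
  | query _ => none

/-- The compiled program; it exits to the label `none`. -/
def code : (p : Prog) → p.Label → Instr (Option p.Label)
  | skip, _ => .jump none
  | push k b, _ => .push k b none
  | seq p q, Sum.inl l => (p.code l).map fun o => some (o.elim (Sum.inr q.entry) Sum.inl)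
  | seq _ q, Sum.inr l => (q.code l).map (Option.map Sum.inr)
  | pop k br, none => .pop k fun o => some (some ⟨o, (br o).entry⟩)
  | pop _ br, some ⟨o, l⟩ => ((br o).code l).map (Option.map fun l => some ⟨o, l⟩)
  | loop k body, none => .pop k (Option.map fun b => some ⟨b, (body b).entry⟩)
  | loop _ body, some ⟨b, l⟩ => ((body b).code l).map fun o => some (o.map fun l => ⟨b, l⟩)
  | query br, none => .query fun b => some (some ⟨b, (br b).entry⟩)
  | query br, some ⟨b, l⟩ => ((br b).code l).map (Option.map fun l => some ⟨b, l⟩)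

/-- The statement that executes an instruction. -/
def Instr.stmt {Λ : Type} : Instr Λ → Turing.TM2.Stmt (fun _ : Fin 4 => Bool) Λ (Option Bool)
  | jump l => .goto fun _ => l
  | push k b l => .push k (fun _ => b) (.goto fun _ => l)
  | pop k l => .pop k (fun _ o => o) (.goto l)
  | query _ => .halt

/-- The targets of a query instruction. -/
def Instr.targets {Λ : Type} : Instr Λ → Option (Λ × Λ)
  | query l => some (l true, l false)
  | _ => none

/-- The oracle machine that executes a program. -/
noncomputable def machine (p : Prog) : OracleTM where
  K := Fin 4
  Λ := Option p.Label
  finΛ := Fintype.ofFinite _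
  σ := Option Bool
  inputStack := 1
  queryStack := 2
  outputStack := 0
  main := some p.entry
  initialState := none
  program l := l.elim .halt fun l => (p.code l).stmt
  query l := l.elim none fun l => (p.code l).targets

theorem _root_.OracleTM.Run.trans {M : OracleTM} {A : Set (List Bool)} {C C' C'' : M.Cfg}
    {t q t' q' : ℕ} (h : M.Run A C t q C') (h' : M.Run A C' t' q' C'') :
    M.Run A C (t + t') (q + q') C'' := by
  induction h with
  | refl => simpa using h'
  | step hs _ ih =>
    rw [Nat.add_right_comm, Nat.add_assoc (M.callsAt _)]
    exact .step hs (ih h')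

section Steps

variable {P : Prog} {A : Set (List Bool)} {l : P.Label} {v : Option Bool} {S : Store}

theorem run_jump {x} (h : P.code l = .jump x) :
    P.machine.Run A ⟨some (some l), v, S⟩ 1 0 ⟨some x, v, S⟩ := by
  have := OracleTM.Run.step (M := P.machine) (A := A) (C := ⟨some (some l), v, S⟩)
    (C' := ⟨some x, v, S⟩) (by simp [OracleTM.step, machine, h, Instr.targets, Instr.stmt]; rfl) (.refl _)
  simpa [OracleTM.callsAt, machine, h, Instr.targets] using this

theorem run_push {k b x} (h : P.code l = .push k b x) :
    P.machine.Run A ⟨some (some l), v, S⟩ 1 0 ⟨some x, v, update S k (b :: S k)⟩ := by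
  have := OracleTM.Run.step (M := P.machine) (A := A) (C := ⟨some (some l), v, S⟩)
    (C' := ⟨some x, v, update S k (b :: S k)⟩)
    (by simp [OracleTM.step, machine, h, Instr.targets, Instr.stmt]; rfl) (.refl _)
  simpa [OracleTM.callsAt, machine, h, Instr.targets] using this

theorem run_pop {k x} (h : P.code l = .pop k x) :
    P.machine.Run A ⟨some (some l), v, S⟩ 1 0
      ⟨some (x (S k).head?), (S k).head?, update S k (S k).tail⟩ := by
  have := OracleTM.Run.step (M := P.machine) (A := A) (C := ⟨some (some l), v, S⟩)
    (C' := ⟨some (x (S k).head?), (S k).head?, update S k (S k).tail⟩)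
    (by simp [OracleTM.step, machine, h, Instr.targets, Instr.stmt]; rfl) (.refl _)
  simpa [OracleTM.callsAt, machine, h, Instr.targets] using this

open scoped Classical in
theorem run_query {x} (h : P.code l = .query x) :
    P.machine.Run A ⟨some (some l), v, S⟩ 1 1 ⟨some (x (decide (S 2 ∈ A))), v, S⟩ := by
  have := OracleTM.Run.step (M := P.machine) (A := A) (C := ⟨some (some l), v, S⟩)
    (C' := ⟨some (x (decide (S 2 ∈ A))), v, S⟩)
    (by by_cases hS : S 2 ∈ A <;> simp [OracleTM.step, machine, h, Instr.targets, hS]) (.refl _)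
  simpa [OracleTM.callsAt, machine, h, Instr.targets] using this

end Steps

theorem run_code {P : Prog} {A : Set (List Bool)} {p : Prog} {S S' : Store} {t q : ℕ}
    (h : Exec A p S t q S') (ι : p.Label → P.Label) (x : Option P.Label)
    (hι : ∀ l, P.code (ι l) = (p.code l).map fun o => o.elim x (some ∘ ι)) (v : Option Bool) :
    ∃ v', P.machine.Run A ⟨some (some (ι p.entry)), v, S⟩ t q ⟨some x, v', S'⟩ := by
  induction h generalizing x v with
  | skip S => exact ⟨v, run_jump (hι ())⟩
  | push k b S => exact ⟨v, run_push (hι ())⟩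
  | @seq p p' S S' S'' t t' q q' _ _ ih ih' =>
    obtain ⟨v₁, h₁⟩ := ih (ι ∘ Sum.inl) (some (ι (Sum.inr p'.entry)))
      (fun l => (hι _).trans (Instr.map_map_eq (by rintro (_ | _) <;> rfl) _)) v
    obtain ⟨v₂, h₂⟩ := ih' (ι ∘ Sum.inr) x
      (fun l => (hι _).trans (Instr.map_map_eq (by rintro (_ | _) <;> rfl) _)) v₁
    exact ⟨v₂, h₁.trans h₂⟩
  | @pop k br S S' t q _ ih =>
    obtain ⟨v₁, h₁⟩ := ih (fun l => ι (some ⟨_, l⟩)) x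
      (fun l => (hι _).trans (Instr.map_map_eq (by rintro (_ | _) <;> rfl) _)) (S k).head?
    refine ⟨v₁, ?_⟩
    have := (run_pop (v := v) (S := S) (hι none)).trans h₁
    rwa [Nat.zero_add, Nat.add_comm 1] at this
  | @loop_nil k body S h =>
    refine ⟨none, ?_⟩
    have := run_pop (v := v) (S := S) (A := A) (hι none)
    have hu : update S k [] = S := by rw [← h]; exact Function.update_eq_self k S
    simp only [h, List.head?_nil, List.tail_nil] at this
    have this : P.machine.Run A ⟨some (some (ι none)), v, S⟩ 1 0
      ⟨some x, none, (update S k [] : Store)⟩ := this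
    rwa [hu] at this
  | @loop_cons k body S S' S'' t t' q q' b l h _ _ ih ih' =>
    obtain ⟨v₁, h₁⟩ := ih (fun l => ι (some ⟨_, l⟩)) (some (ι none))
      (fun l => (hι _).trans (Instr.map_map_eq (by rintro (_ | _) <;> rfl) _)) (some b)
    obtain ⟨v₂, h₂⟩ := ih' ι x hι v₁
    have := run_pop (v := v) (S := S) (A := A) (hι none)
    simp only [h, List.head?_cons, List.tail_cons] at this
    refine ⟨v₂, ?_⟩
    have := (this.trans h₁).trans h₂
    rwa [Nat.zero_add, show 1 + t + t' = t + t' + 1 by omega] at this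
  | @query br S S' t q _ ih =>
    obtain ⟨v₁, h₁⟩ := ih (fun l => ι (some ⟨_, l⟩)) x
      (fun l => (hι _).trans (Instr.map_map_eq (by rintro (_ | _) <;> rfl) _)) v
    refine ⟨v₁, ?_⟩
    have := (run_query (v := v) (S := S) (hι none)).trans h₁
    rwa [Nat.add_comm 1, Nat.add_comm 1] at this

/-- The machine of a program halts with the store that the program computes. -/
theorem run_machine {P : Prog} {A : Set (List Bool)} {x : List Bool} {S' : Store} {t q : ℕ}
    (h : Exec A P (fun k => if k = 1 then x else []) t q S') :
    ∃ v, P.machine.Run A (P.machine.init x) (t + 1) q ⟨none, v, S'⟩ := by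
  obtain ⟨v, h⟩ := run_code h id none (fun l => by
    have : (fun o : Option P.Label => o.elim none (some ∘ id)) = id := by
      funext o; cases o <;> rfl
    rw [this]; cases h : P.code l <;> simp [Instr.map, h]) none
  have h' := OracleTM.Run.step (M := P.machine) (A := A) (C := ⟨some none, v, S'⟩)
    (C' := ⟨none, v, S'⟩) (by simp [OracleTM.step, machine, Turing.TM2.stepAux]) (.refl _)
  exact ⟨v, h.trans h'⟩

end Prog

namespace OracleTM

variable {M : OracleTM} {A : Set (List Bool)}

/-- A run never makes more oracle calls than the run that halts. -/
theorem Run.calls_le {C C₁ C₂ : M.Cfg} {t₁ q₁ t₂ q₂ : ℕ} (h₁ : M.Run A C t₁ q₁ C₁)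
    (hl : C₁.l = none) (h₂ : M.Run A C t₂ q₂ C₂) : q₂ ≤ q₁ := by
  induction h₂ generalizing t₁ q₁ with
  | refl => exact Nat.zero_le _
  | @step C C' C'' t q hs _ ih =>
    cases h₁ with
    | refl =>
      obtain ⟨l, v, S⟩ := C₁
      change l = none at hl
      subst hl
      simp [OracleTM.step] at hs
    | step hs' h' =>
      obtain rfl := Option.some.inj (hs'.symm.trans hs)
      exact Nat.add_le_add_left (ih h') _

end OracleTM

/-! ## Binary trees and encodings of data -/

/-- Binary trees, the data on which the programs below operate. -/
inductive BinTree
  | leaf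
  | node (a b : BinTree)

namespace BinTree

/-- Serialization in preorder. -/
def ser : BinTree → List Bool
  | leaf => [false]
  | node a b => true :: (a.ser ++ b.ser)

/-- The left subtree. -/
def hd : BinTree → BinTree
  | leaf => leaf
  | node a _ => a

/-- The right subtree. -/
def tl : BinTree → BinTree
  | leaf => leaf
  | node _ b => b

/-- Whether the tree is not a leaf. -/
def isNode : BinTree → Bool
  | leaf => false
  | node _ _ => true

theorem ser_append_inj {a b : BinTree} {r r' : List Bool} (h : a.ser ++ r = b.ser ++ r') :
    a = b ∧ r = r' := by
  induction a generalizing b r r' with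
  | leaf => cases b <;> simp_all [ser]
  | node a₁ a₂ ih₁ ih₂ =>
    cases b with
    | leaf => simp [ser] at h
    | node b₁ b₂ =>
      simp only [ser, List.cons_append, List.append_assoc, List.cons.injEq, true_and] at h
      obtain ⟨h₁, h⟩ := ih₁ h
      obtain ⟨h₂, h⟩ := ih₂ h
      exact ⟨by rw [h₁, h₂], h⟩

theorem ser_injective : Function.Injective ser := fun a b h =>
  (ser_append_inj (r := []) (r' := []) (by rw [h])).1

end BinTree

open BinTree in
/-- Types whose elements are encoded by binary trees. -/
class Enc (α : Type) where
  /-- the tree that encodes an element -/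
  enc : α → BinTree
  inj : Function.Injective enc

open Enc (enc)

section Enc

variable {α β : Type} [Enc α] [Enc β]

open BinTree

instance : Enc BinTree := ⟨id, Function.injective_id⟩

instance : Enc Unit := ⟨fun _ => leaf, fun _ _ _ => rfl⟩

instance : Enc Bool :=
  ⟨fun b => bif b then node leaf leaf else leaf, by intro a b; cases a <;> cases b <;> simp⟩

/-- Unary encoding of numbers. -/
def encNat : ℕ → BinTree
  | 0 => leaf
  | n + 1 => node leaf (encNat n)

instance : Enc ℕ := ⟨encNat, fun a => by
  induction a with
  | zero => intro b; cases b <;> simp [encNat]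
  | succ a ih =>
    intro b
    cases b with
    | zero => simp [encNat]
    | succ b => simpa [encNat] using @ih b⟩

/-- Encoding of lists. -/
def encList : List α → BinTree
  | [] => leaf
  | a :: l => node (enc a) (encList l)

instance : Enc (List α) := ⟨encList, fun a => by
  induction a with
  | nil => intro b; cases b <;> simp [encList]
  | cons x a ih =>
    intro b
    cases b with
    | nil => simp [encList]
    | cons y b =>
      simp only [encList, node.injEq, List.cons.injEq, and_imp]
      exact fun h h' => ⟨Enc.inj h, ih h'⟩⟩

instance : Enc (α × β) := ⟨fun x => node (enc x.1) (enc x.2), fun x y h => by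
  simp only [node.injEq] at h
  exact Prod.ext (Enc.inj h.1) (Enc.inj h.2)⟩

instance : Enc (Option α) := ⟨fun o => o.elim leaf fun a => node (enc a) leaf, by
  intro x y
  cases x <;> cases y <;> simp
  exact fun h => Enc.inj h⟩

/-- The word that encodes an element. -/
def word (x : α) : List Bool := (enc x).ser

/-- The size of an element: the length of its code. -/
def sz (x : α) : ℕ := (word x).length

@[simp] theorem enc_tree (x : BinTree) : enc x = x := rfl
@[simp] theorem enc_unit (x : Unit) : enc x = leaf := rfl
@[simp] theorem enc_false : enc false = leaf := rfl
@[simp] theorem enc_true : enc true = node leaf leaf := rfl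
@[simp] theorem enc_zero : enc 0 = leaf := rfl
@[simp] theorem enc_succ (n : ℕ) : enc (n + 1) = node leaf (enc n) := rfl
@[simp] theorem enc_nil : enc ([] : List α) = leaf := rfl
@[simp] theorem enc_cons (a : α) (l : List α) : enc (a :: l) = node (enc a) (enc l) := rfl
@[simp] theorem enc_prod (x : α × β) : enc x = node (enc x.1) (enc x.2) := rfl
@[simp] theorem enc_none : enc (none : Option α) = leaf := rfl
@[simp] theorem enc_some (a : α) : enc (some a) = node (enc a) leaf := rfl

theorem word_prod (x : α × β) : word x = true :: (word x.1 ++ word x.2) := rfl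
theorem word_cons (a : α) (l : List α) : word (a :: l) = true :: (word a ++ word l) := rfl

@[simp] theorem sz_prod (x : α × β) : sz x = sz x.1 + sz x.2 + 1 := by simp [sz, word_prod]
@[simp] theorem sz_nil : sz ([] : List α) = 1 := rfl
@[simp] theorem sz_cons (a : α) (l : List α) : sz (a :: l) = sz a + sz l + 1 := by
  simp [sz, word_cons]
@[simp] theorem sz_zero : sz 0 = 1 := rfl
@[simp] theorem sz_none : sz (none : Option α) = 1 := rfl
@[simp] theorem sz_some (a : α) : sz (some a) = sz a + 2 := by simp [sz, word, BinTree.ser]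
@[simp] theorem sz_leaf : sz leaf = 1 := rfl
@[simp] theorem sz_node (a b : BinTree) : sz (node a b) = sz a + sz b + 1 := by
  simp [sz, word, BinTree.ser]

@[simp] theorem sz_nat (n : ℕ) : sz n = 2 * n + 1 := by
  induction n with
  | zero => rfl
  | succ n ih =>
    have : sz (n + 1) = sz n + 2 := by
      simp [sz, word, BinTree.ser]
    omega

theorem sz_bool_le (b : Bool) : sz b ≤ 3 := by cases b <;> decide

theorem length_le_sz (l : List α) : l.length ≤ sz l := by
  induction l with
  | nil => simp
  | cons a l ih => simp; omega

theorem sz_le_of_mem {a : α} {l : List α} (h : a ∈ l) : sz a ≤ sz l := by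
  induction l with
  | nil => simp at h
  | cons b l ih =>
    rcases List.mem_cons.1 h with rfl | h
    · simp; omega
    · have := ih h; simp; omega

theorem sz_append (l l' : List α) : sz (l ++ l') + 1 = sz l + sz l' := by
  induction l with
  | nil => simp; omega
  | cons a l ih => simp; omega

theorem sz_le_of_sublist {l l' : List α} (h : l.Sublist l') : sz l ≤ sz l' := by
  induction h with
  | slnil => rfl
  | cons a _ ih => simp; omega
  | cons_cons a _ ih => simp; omega

@[simp] theorem sz_reverse (l : List α) : sz l.reverse = sz l := by
  induction l with
  | nil => rfl
  | cons a l ih => have := sz_append l.reverse [a]; simp at this ⊢; omega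

theorem sz_list_bool_le (l : List Bool) : sz l ≤ 4 * l.length + 1 := by
  induction l with
  | nil => simp
  | cons b l ih => have := sz_bool_le b; simp; omega

/-! ## Polynomial bounds -/

/-- `T` is bounded by a polynomial in the size of the argument. -/
def PB (T : α → ℕ) : Prop := ∃ p : Polynomial ℕ, ∀ x, T x ≤ p.eval (sz x)

theorem eval_mono (p : Polynomial ℕ) : Monotone p.eval := by
  intro a b h
  simp only [Polynomial.eval_eq_sum]
  exact Finset.sum_le_sum fun i _ => Nat.mul_le_mul_left _ (Nat.pow_le_pow_left h i)

theorem PB.mono {T T' : α → ℕ} (h : PB T') (hT : ∀ x, T x ≤ T' x) : PB T :=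
  let ⟨p, hp⟩ := h
  ⟨p, fun x => (hT x).trans (hp x)⟩

theorem PB.const (c : ℕ) : PB fun _ : α => c := ⟨Polynomial.C c, fun x => by simp⟩

theorem PB.size : PB fun x : α => sz x := ⟨Polynomial.X, fun x => by simp⟩

theorem PB.add {T T' : α → ℕ} : PB T → PB T' → PB fun x => T x + T' x
  | ⟨p, hp⟩, ⟨p', hp'⟩ => ⟨p + p', fun x => by simpa using Nat.add_le_add (hp x) (hp' x)⟩

theorem PB.mul {T T' : α → ℕ} : PB T → PB T' → PB fun x => T x * T' x
  | ⟨p, hp⟩, ⟨p', hp'⟩ => ⟨p * p', fun x => by simpa using Nat.mul_le_mul (hp x) (hp' x)⟩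

theorem PB.exists_comp {T : β → ℕ} (h : PB T) {S : α → ℕ} (hS : PB S) :
    ∃ T' : α → ℕ, PB T' ∧ ∀ x y, sz y ≤ S x → T y ≤ T' x := by
  obtain ⟨p, hp⟩ := h
  obtain ⟨s, hs⟩ := hS
  refine ⟨fun x => p.eval (s.eval (sz x)), ⟨p.comp s, fun x => by simp⟩, fun x y hy => ?_⟩
  exact (hp y).trans (eval_mono p (hy.trans (hs x)))

theorem PB.comp {T : β → ℕ} (h : PB T) {f : α → β} (hf : PB fun x => sz (f x)) :
    PB fun x => T (f x) :=
  let ⟨_, hT, hle⟩ := h.exists_comp hf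
  hT.mono fun x => hle x (f x) le_rfl

end Enc

namespace Prog

open Function (update)

/-- With oracle `A`, the program `p` transforms the store `S` into `S'` in at most `T` steps and with
at most `Q` oracle calls. -/
def Does (A : Set (List Bool)) (p : Prog) (S : Store) (T Q : ℕ) (S' : Store) : Prop :=
  ∃ t ≤ T, ∃ q ≤ Q, Exec A p S t q S'

variable {A : Set (List Bool)} {p p' : Prog} {S S' S'' : Store} {T Q T' Q' : ℕ}

theorem Does.mono (h : Does A p S T Q S') (hT : T ≤ T') (hQ : Q ≤ Q') : Does A p S T' Q' S' :=
  let ⟨t, ht, q, hq, h⟩ := h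
  ⟨t, ht.trans hT, q, hq.trans hQ, h⟩

theorem Does.conv (h : Does A p S T Q S') (hT : T ≤ T') (hS : S' = S'') (hQ : Q ≤ Q' := by rfl) :
    Does A p S T' Q' S'' :=
  hS ▸ h.mono hT hQ

theorem does_skip : Does A skip S 1 0 S := ⟨1, le_rfl, 0, le_rfl, .skip S⟩

theorem Does.seq (h : Does A p S T Q S') (h' : Does A p' S' T' Q' S'') :
    Does A (seq p p') S (T + T') (Q + Q') S'' :=
  let ⟨t, ht, q, hq, h⟩ := h
  let ⟨t', ht', q', hq', h'⟩ := h'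
  ⟨t + t', by omega, q + q', by omega, .seq h h'⟩

theorem Does.pop {k br} (h : Does A (br (S k).head?) (update S k (S k).tail) T Q S') :
    Does A (pop k br) S (T + 1) Q S' :=
  let ⟨t, ht, q, hq, h⟩ := h
  ⟨t + 1, by omega, q, hq, .pop h⟩

theorem does_loop_nil {k body} (h : S k = []) : Does A (loop k body) S 1 0 S :=
  ⟨1, le_rfl, 0, le_rfl, .loop_nil h⟩

theorem Does.loop_cons {k body b l} (hS : S k = b :: l) (h : Does A (body b) (update S k l) T Q S')
    (h' : Does A (loop k body) S' T' Q' S'') :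
    Does A (loop k body) S (T + T' + 1) (Q + Q') S'' :=
  let ⟨t, ht, q, hq, h⟩ := h
  let ⟨t', ht', q', hq', h'⟩ := h'
  ⟨t + t' + 1, by omega, q + q', by omega, .loop_cons hS h h'⟩

open scoped Classical in
theorem Does.query {br} (h : Does A (br (decide (S 2 ∈ A))) S T Q S') :
    Does A (query br) S (T + 1) (Q + 1) S' :=
  let ⟨t, ht, q, hq, h⟩ := h
  ⟨t + 1, by omega, q + 1, by omega, .query h⟩

variable {m a b c : List Bool}

theorem update_zero (x : List Bool) : update (![m, a, b, c] : Store) 0 x = ![x, a, b, c] := by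
  funext i; fin_cases i <;> rfl

theorem update_one (x : List Bool) : update (![m, a, b, c] : Store) 1 x = ![m, x, b, c] := by
  funext i; fin_cases i <;> rfl

theorem update_two (x : List Bool) : update (![m, a, b, c] : Store) 2 x = ![m, a, x, c] := by
  funext i; fin_cases i <;> rfl

theorem update_three (x : List Bool) : update (![m, a, b, c] : Store) 3 x = ![m, a, b, x] := by
  funext i; fin_cases i <;> rfl

theorem push_zero (x : Bool) : Does A (push 0 x) ![m, a, b, c] 1 0 ![x :: m, a, b, c] :=
  ⟨1, le_rfl, 0, le_rfl, update_zero (m := m) (x :: m) ▸ .push 0 x _⟩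

theorem push_one (x : Bool) : Does A (push 1 x) ![m, a, b, c] 1 0 ![m, x :: a, b, c] :=
  ⟨1, le_rfl, 0, le_rfl, update_one (a := a) (x :: a) ▸ .push 1 x _⟩

theorem push_two (x : Bool) : Does A (push 2 x) ![m, a, b, c] 1 0 ![m, a, x :: b, c] :=
  ⟨1, le_rfl, 0, le_rfl, update_two (b := b) (x :: b) ▸ .push 2 x _⟩

theorem push_three (x : Bool) : Does A (push 3 x) ![m, a, b, c] 1 0 ![m, a, b, x :: c] :=
  ⟨1, le_rfl, 0, le_rfl, update_three (c := c) (x :: c) ▸ .push 3 x _⟩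

theorem pop_zero {br} (h : Does A (br m.head?) ![m.tail, a, b, c] T Q S') :
    Does A (pop 0 br) ![m, a, b, c] (T + 1) Q S' :=
  .pop (by rw [update_zero]; exact h)

theorem pop_two {br} (h : Does A (br b.head?) ![m, a, b.tail, c] T Q S') :
    Does A (pop 2 br) ![m, a, b, c] (T + 1) Q S' :=
  .pop (by rw [update_two]; exact h)

theorem pop_three {br} (h : Does A (br c.head?) ![m, a, b, c.tail] T Q S') :
    Does A (pop 3 br) ![m, a, b, c] (T + 1) Q S' :=
  .pop (by rw [update_three]; exact h)

theorem loop_one {body x} (h : Does A (body x) ![m, a, b, c] T Q S')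
    (h' : Does A (loop 1 body) S' T' Q' S'') :
    Does A (loop 1 body) ![m, x :: a, b, c] (T + T' + 1) (Q + Q') S'' :=
  .loop_cons rfl (by rw [update_one]; exact h) h'

theorem loop_two {body x} (h : Does A (body x) ![m, a, b, c] T Q S')
    (h' : Does A (loop 2 body) S' T' Q' S'') :
    Does A (loop 2 body) ![m, a, x :: b, c] (T + T' + 1) (Q + Q') S'' :=
  .loop_cons rfl (by rw [update_two]; exact h) h'

theorem loop_three {body x} (h : Does A (body x) ![m, a, b, c] T Q S')
    (h' : Does A (loop 3 body) S' T' Q' S'') :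
    Does A (loop 3 body) ![m, a, b, x :: c] (T + T' + 1) (Q + Q') S'' :=
  .loop_cons rfl (by rw [update_three]; exact h) h'

/-! ### Moving data between the stacks -/

/-- Push a word. -/
def pushWord : List Bool → Prog
  | [] => skip
  | x :: w => seq (pushWord w) (push 0 x)

theorem does_pushWord (w : List Bool) :
    Does A (pushWord w) ![m, a, b, c] (w.length + 1) 0 ![w ++ m, a, b, c] := by
  induction w with
  | nil => exact does_skip
  | cons x w ih => exact ih.seq (push_zero x)

/-- Move the stack `1` to the main stack. -/
def unloadOne : Prog := loop 1 fun x => push 0 x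

theorem does_unloadOne : Does A unloadOne ![m, a, b, c] (2 * a.length + 1) 0
    ![a.reverse ++ m, [], b, c] := by
  induction a generalizing m with
  | nil => exact does_loop_nil rfl
  | cons x a ih =>
    exact (loop_one (push_zero x) ih).conv (by simp; omega) (by simp)

/-- Move the stack `2` to the main stack. -/
def unloadTwo : Prog := loop 2 fun x => push 0 x

theorem does_unloadTwo : Does A unloadTwo ![m, a, b, c] (2 * b.length + 1) 0
    ![b.reverse ++ m, a, [], c] := by
  induction b generalizing m with
  | nil => exact does_loop_nil rfl
  | cons x a ih =>
    exact (loop_two (push_zero x) ih).conv (by simp; omega) (by simp)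

/-- Move the stack `1` to the stack `2`. -/
def oneToTwo : Prog := loop 1 fun x => push 2 x

theorem does_oneToTwo : Does A oneToTwo ![m, a, b, c] (2 * a.length + 1) 0
    ![m, [], a.reverse ++ b, c] := by
  induction a generalizing b with
  | nil => exact does_loop_nil rfl
  | cons x a ih =>
    exact (loop_one (push_two x) ih).conv (by simp; omega) (by simp)

/-- Move the stack `2` to the stack `1`. -/
def twoToOne : Prog := loop 2 fun x => push 1 x

theorem does_twoToOne : Does A twoToOne ![m, a, b, c] (2 * b.length + 1) 0
    ![m, b.reverse ++ a, [], c] := by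
  induction b generalizing a with
  | nil => exact does_loop_nil rfl
  | cons x a ih =>
    exact (loop_two (push_one x) ih).conv (by simp; omega) (by simp)

/-- Move the stack `1` to both the main stack and the stack `2`. -/
def forkOne : Prog := loop 1 fun x => seq (push 0 x) (push 2 x)

theorem does_forkOne : Does A forkOne ![m, a, b, c] (3 * a.length + 1) 0
    ![a.reverse ++ m, [], a.reverse ++ b, c] := by
  induction a generalizing m b with
  | nil => exact does_loop_nil rfl
  | cons x a ih =>
    exact (loop_one ((push_zero x).seq (push_two x)) ih).conv (by simp; omega) (by simp)

/-- Clear the stack `k`. -/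
def clear (k : Fin 4) : Prog := loop k fun _ => skip

theorem does_clear_one : Does A (clear 1) ![m, a, b, c] (2 * a.length + 1) 0 ![m, [], b, c] := by
  induction a with
  | nil => exact does_loop_nil rfl
  | cons x a ih => exact (loop_one does_skip ih).mono (by simp; omega) le_rfl

theorem does_clear_two : Does A (clear 2) ![m, a, b, c] (2 * b.length + 1) 0 ![m, a, [], c] := by
  induction b with
  | nil => exact does_loop_nil rfl
  | cons x a ih => exact (loop_two does_skip ih).mono (by simp; omega) le_rfl

theorem does_clear_three : Does A (clear 3) ![m, a, b, c] (2 * c.length + 1) 0 ![m, a, b, []] := by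
  induction c with
  | nil => exact does_loop_nil rfl
  | cons x a ih => exact (loop_three does_skip ih).mono (by simp; omega) le_rfl

/-- Move the topmost tree of the main stack, reversed, to the stack `k`. The stack `3` counts the
subtrees that are still to be moved. -/
def scanLoop (k : Fin 4) : Prog :=
  loop 3 fun _ => pop 0 fun o =>
    bif o = some true then seq (push k true) (seq (push 3 true) (push 3 true)) else push k false

theorem does_scanLoop_one (d : BinTree) (h : Does A (scanLoop 1)
    ![m, d.ser.reverse ++ a, b, c] T 0 S) :
    Does A (scanLoop 1) ![d.ser ++ m, a, b, true :: c] (5 * d.ser.length + T) 0 S := by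
  induction d generalizing m a c T with
  | leaf =>
    exact (loop_three (pop_zero (push_one false)) h).mono (by simp [BinTree.ser]) le_rfl
  | node x y ihx ihy =>
    have h₁ := ihx (m := y.ser ++ m) (a := true :: a) (c := true :: c)
      (ihy (T := T) (by simpa [BinTree.ser] using h))
    have := loop_three (body := fun _ => pop 0 fun o =>
      bif o = some true then seq (push 1 true) (seq (push 3 true) (push 3 true)) else push 1 false)
      (x := true) (m := (BinTree.node x y).ser ++ m) (a := a) (b := b) (c := c)
      (pop_zero ((push_one true).seq ((push_three true).seq (push_three true))))
      (by simpa [BinTree.ser, scanLoop] using h₁)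
    exact this.mono (by simp [BinTree.ser]; omega) le_rfl

theorem does_scanLoop_two (d : BinTree) (h : Does A (scanLoop 2)
    ![m, a, d.ser.reverse ++ b, c] T 0 S) :
    Does A (scanLoop 2) ![d.ser ++ m, a, b, true :: c] (5 * d.ser.length + T) 0 S := by
  induction d generalizing m b c T with
  | leaf =>
    exact (loop_three (pop_zero (push_two false)) h).mono (by simp [BinTree.ser]) le_rfl
  | node x y ihx ihy =>
    have h₁ := ihx (m := y.ser ++ m) (b := true :: b) (c := true :: c)
      (ihy (T := T) (by simpa [BinTree.ser] using h))
    have := loop_three (body := fun _ => pop 0 fun o =>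
      bif o = some true then seq (push 2 true) (seq (push 3 true) (push 3 true)) else push 2 false)
      (x := true) (m := (BinTree.node x y).ser ++ m) (a := a) (b := b) (c := c)
      (pop_zero ((push_two true).seq ((push_three true).seq (push_three true))))
      (by simpa [BinTree.ser, scanLoop] using h₁)
    exact this.mono (by simp [BinTree.ser]; omega) le_rfl

/-- Move the topmost tree of the main stack, reversed, to the stack `k`. -/
def scan (k : Fin 4) : Prog := seq (push 3 true) (scanLoop k)

theorem does_scan_one (d : BinTree) : Does A (scan 1) ![d.ser ++ m, a, b, []]
    (5 * d.ser.length + 2) 0 ![m, d.ser.reverse ++ a, b, []] :=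
  ((push_three true).seq (does_scanLoop_one d (does_loop_nil rfl))).mono (by omega) le_rfl

theorem does_scan_two (d : BinTree) : Does A (scan 2) ![d.ser ++ m, a, b, []]
    (5 * d.ser.length + 2) 0 ![m, a, d.ser.reverse ++ b, []] :=
  ((push_three true).seq (does_scanLoop_two d (does_loop_nil rfl))).mono (by omega) le_rfl

/-! ### Operations on the stack of trees -/

/-- Drop the topmost tree. -/
def drop : Prog := seq (scan 1) (clear 1)

theorem does_drop (d : BinTree) : Does A drop ![d.ser ++ m, [], [], []] (7 * d.ser.length + 3) 0
    ![m, [], [], []] :=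
  ((does_scan_one d).seq does_clear_one).mono (by simp; omega) le_rfl

/-- Duplicate the topmost tree. -/
def dup : Prog := seq (scan 1) (seq forkOne (seq twoToOne unloadOne))

theorem does_dup (d : BinTree) : Does A dup ![d.ser ++ m, [], [], []] (12 * d.ser.length + 5) 0
    ![d.ser ++ (d.ser ++ m), [], [], []] := by
  refine ((does_scan_one d).seq (does_forkOne.seq (does_twoToOne.seq does_unloadOne))).conv ?_ ?_
  · simp; omega
  · simp

/-- Exchange the two topmost trees. -/
def swap : Prog := seq (scan 1) (seq (scan 2) (seq unloadOne unloadTwo))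

theorem does_swap (d e : BinTree) : Does A swap ![d.ser ++ (e.ser ++ m), [], [], []]
    (7 * d.ser.length + 7 * e.ser.length + 6) 0 ![e.ser ++ (d.ser ++ m), [], [], []] := by
  refine ((does_scan_one d).seq ((does_scan_two e).seq (does_unloadOne.seq does_unloadTwo))).conv ?_ ?_
  · simp; omega
  · simp

/-- Replace the topmost tree by the answer of the oracle to its serialization. -/
def ask : Prog := seq (scan 1) (seq oneToTwo
  (query fun x => seq (clear 2) (pushWord (word x))))

open scoped Classical in
theorem does_ask (d : BinTree) : Does A ask ![d.ser ++ m, [], [], []] (9 * d.ser.length + 9) 1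
    ![word (decide (d.ser ∈ A)) ++ m, [], [], []] := by
  refine ((does_scan_one d).seq (does_oneToTwo.seq (.query (T := 2 * d.ser.length + 5) (Q := 0)
    (S' := ![word (decide (d.ser ∈ A)) ++ m, [], [], []]) ?_))).mono ?_ le_rfl
  · simp only [List.append_nil, List.reverse_reverse]
    refine (does_clear_two.seq (does_pushWord _)).mono ?_ le_rfl
    have := sz_bool_le (decide (d.ser ∈ A))
    unfold sz at this
    change 2 * d.ser.length + 1 + ((word (decide (d.ser ∈ A))).length + 1) ≤ _
    omega
  · simp; omega

/-- Compare the stacks `1` and `2`: push on the stack `3` if they differ. -/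
def compare : Prog := seq
  (loop 1 fun x => pop 2 fun o => bif o = some x then skip else push 3 true)
  (loop 2 fun _ => push 3 true)

theorem does_compare : ∃ c', Does A compare ![m, a, b, c] (3 * a.length + 2 * b.length + 2) 0
    ![m, [], [], c'] ∧ (c' = [] ↔ a = b ∧ c = []) ∧
      c'.length ≤ a.length + b.length + c.length := by
  have second : ∀ b c : List Bool, ∃ c', Does A (loop 2 fun _ => push 3 true) ![m, [], b, c]
      (2 * b.length + 1) 0 ![m, [], [], c'] ∧ (c' = [] ↔ b = [] ∧ c = []) ∧
      c'.length ≤ b.length + c.length := by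
    intro b
    induction b with
    | nil => exact fun c => ⟨c, does_loop_nil rfl, by simp, by simp⟩
    | cons x b ih =>
      intro c
      obtain ⟨c', h, h', hl⟩ := ih (true :: c)
      have := loop_two (body := fun _ => push 3 true) (x := x) (push_three true) h
      refine ⟨c', this.mono (by simp; omega) le_rfl, by simpa using h', ?_⟩
      simp at hl ⊢; omega
  induction a generalizing b c with
  | nil =>
    obtain ⟨c', h, h', hl⟩ := second b c
    exact ⟨c', (Does.seq (does_loop_nil rfl) h).mono (by omega) le_rfl, by rw [h', eq_comm],
      by simpa using hl⟩
  | cons x a ih =>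
    obtain ⟨y, hy⟩ : ∃ y, y = b.head? := ⟨_, rfl⟩
    have htl : b.tail.length ≤ b.length := by simp
    by_cases hxy : y = some x
    · obtain ⟨c', ⟨t, ht, q, hq, h⟩, h', hl⟩ := ih (b := b.tail) (c := c)
      cases h with
      | seq h₁ h₂ =>
        refine ⟨c', ((loop_one (pop_two (T := 1) (Q := 0) ?_) ⟨_, le_rfl, _, le_rfl, h₁⟩).seq
          ⟨_, le_rfl, _, le_rfl, h₂⟩).mono ?_ ?_, ?_, ?_⟩
        · rw [← hy, hxy]; simpa using does_skip
        · rw [List.length_cons]; omega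
        · omega
        · rw [h']
          cases b with
          | nil => simp_all
          | cons z b => simp_all
        · rw [List.length_cons]; omega
    · obtain ⟨c', ⟨t, ht, q, hq, h⟩, h', hl⟩ := ih (b := b.tail) (c := true :: c)
      cases h with
      | seq h₁ h₂ =>
        refine ⟨c', ((loop_one (pop_two (T := 1) (Q := 0) ?_) ⟨_, le_rfl, _, le_rfl, h₁⟩).seq
          ⟨_, le_rfl, _, le_rfl, h₂⟩).mono ?_ ?_, ?_, ?_⟩
        · rw [← hy]; simpa [hxy] using push_three true
        · rw [List.length_cons]; omega
        · omega
        · rw [h']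
          cases b with
          | nil => simp
          | cons z b =>
            simp only [List.head?_cons] at hy
            simp only [hy, Option.some.injEq] at hxy
            simp [Ne.symm hxy]
        · rw [List.length_cons] at hl ⊢; omega

/-- Replace the two topmost trees by the truth value of their equality. -/
def equal : Prog := seq (scan 1) (seq (scan 2) (seq compare (pop 3 fun o =>
  bif o = none then pushWord (word true) else seq (clear 3) (pushWord (word false)))))

theorem does_equal (d e : BinTree) [Decidable (d = e)] :
    Does A equal ![d.ser ++ (e.ser ++ m), [], [], []] (11 * d.ser.length + 11 * e.ser.length + 20) 0
      ![word (decide (d = e)) ++ m, [], [], []] := by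
  obtain ⟨c', h, h', hl⟩ := does_compare (A := A) (m := m) (a := d.ser.reverse ++ [])
    (b := e.ser.reverse ++ []) (c := [])
  have hde : c' = [] ↔ d = e := by
    rw [h']; simp [BinTree.ser_injective.eq_iff]
  refine ((does_scan_one d).seq ((does_scan_two e).seq (h.seq (pop_three
    (T := 2 * c'.length + 6) (Q := 0) ?_)))).conv ?_ rfl
  · by_cases hc : c' = []
    · simp only [hc, hde.1 hc]
      exact (does_pushWord (word true)).mono (by simp [word, BinTree.ser]) le_rfl
    · have : c'.head? ≠ none := by simpa using hc
      simp only [this, mt hde.2 hc]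
      refine (does_clear_three.seq (does_pushWord (word false))).conv ?_ rfl
      simp [word, BinTree.ser]; omega
  · simp at hl ⊢; omega

end Prog

/-! ## Functions computable in polynomial time -/

section FPQ

variable {α β γ σ : Type} [Enc α] [Enc β] [Enc γ] [Enc σ]

open Prog in
/-- With every oracle from `𝒪`, the function `f` is computed in polynomial time and with at most
`q x` oracle calls for the argument `x`. -/
def FPQ (𝒪 : Set (Set (List Bool))) (f : α → β) (q : α → ℕ) : Prop :=
  ∃ (P : Prog) (T : α → ℕ), PB T ∧ PB (fun x => sz (f x)) ∧ ∀ A ∈ 𝒪, ∀ x r,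
    Does A P ![word x ++ r, [], [], []] (T x) (q x) ![word (f x) ++ r, [], [], []]

/-- The function `f` is computable in polynomial time (without oracle calls). -/
@[fun_prop]
def FP (f : α → β) : Prop := FPQ Set.univ f fun _ => 0

variable {𝒪 𝒪' : Set (Set (List Bool))} {f : α → β} {q q' : α → ℕ}

theorem FPQ.mono (h : FPQ 𝒪 f q) (ho : 𝒪' ⊆ 𝒪) (hq : ∀ x, q x ≤ q' x) : FPQ 𝒪' f q' :=
  let ⟨P, T, hT, hs, h⟩ := h
  ⟨P, T, hT, hs, fun A hA x r => (h A (ho hA) x r).mono le_rfl (hq x)⟩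

theorem FP.fpq (h : FP f) : FPQ 𝒪 f q := h.mono (Set.subset_univ _) fun _ => Nat.zero_le _

theorem FPQ.pb (h : FPQ 𝒪 f q) : PB fun x => sz (f x) :=
  let ⟨_, _, _, hs, _⟩ := h
  hs

theorem FP.pb (h : FP f) : PB fun x => sz (f x) := FPQ.pb h

theorem FPQ.comp {g : β → γ} {qg : β → ℕ} (hg : FPQ 𝒪 g qg) (hf : FPQ 𝒪 f q) :
    FPQ 𝒪 (fun x => g (f x)) fun x => q x + qg (f x) := by
  obtain ⟨P, T, hT, hs, h⟩ := hf
  obtain ⟨P', T', hT', hs', h'⟩ := hg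
  exact ⟨.seq P P', fun x => T x + T' (f x), hT.add (hT'.comp hs), hs'.comp hs,
    fun A hA x r => (h A hA x r).seq (h' A hA (f x) r)⟩

@[fun_prop]
theorem FP.id : FP fun x : α => x :=
  ⟨.skip, fun _ => 1, .const 1, .size, fun _ _ _ _ => Prog.does_skip⟩

@[fun_prop]
theorem FP.comp {g : β → γ} {f : α → β} (hg : FP g) (hf : FP f) : FP fun x => g (f x) :=
  FPQ.comp hg hf

theorem FP.cast (f : α → β) (h : ∀ x, enc (f x) = enc x) : FP f := by
  have hw : ∀ x, word (f x) = word x := fun x => by rw [word, h, word]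
  refine ⟨.skip, fun _ => 1, .const 1, PB.size.mono fun x => by rw [sz, hw, sz], ?_⟩
  intro A _ x r
  rw [hw]
  exact Prog.does_skip

@[fun_prop]
theorem FP.const (c : β) : FP fun _ : α => c := by
  refine ⟨.seq Prog.drop (Prog.pushWord (word c)), fun x => 7 * sz x + 3 + (sz c + 1),
    (((PB.const 7).mul .size).add (.const 3)).add (.const _), .const _, fun A _ x r => ?_⟩
  exact (Prog.does_drop (enc x)).seq (Prog.does_pushWord (word c))

theorem FPQ.pair {g : α → γ} (hf : FPQ 𝒪 f q) (hg : FPQ 𝒪 g q') :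
    FPQ 𝒪 (fun x => (f x, g x)) fun x => q x + q' x := by
  obtain ⟨P, T, hT, hs, h⟩ := hf
  obtain ⟨P', T', hT', hs', h'⟩ := hg
  refine ⟨.seq Prog.dup (.seq P (.seq Prog.swap (.seq P' (.seq Prog.swap (.push 0 true))))),
    fun x => (12 * sz x + 5) + (T x + ((7 * sz (f x) + 7 * sz x + 6) + (T' x +
      ((7 * sz (g x) + 7 * sz (f x) + 6) + 1)))), ?_, ?_, fun A hA x r => ?_⟩
  · exact (((PB.const _).mul .size).add (.const _)).add (hT.add
      (((((PB.const _).mul hs).add ((PB.const _).mul .size)).add (.const _)).add (hT'.add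
      (((((PB.const _).mul hs').add ((PB.const _).mul hs)).add (.const _)).add (.const _)))))
  · exact (hs.add hs').add (.const 1) |>.mono fun x => by simp
  · have := (Prog.does_dup (A := A) (m := r) (enc x)).seq ((h A hA x (word x ++ r)).seq
      ((Prog.does_swap (enc (f x)) (enc x)).seq ((h' A hA x (word (f x) ++ r)).seq
      ((Prog.does_swap (enc (g x)) (enc (f x))).seq (Prog.push_zero true)))))
    exact this.conv le_rfl (by simp [word, BinTree.ser]) (by simp)

@[fun_prop]
theorem FP.prodMk {f : α → β} {g : α → γ} (hf : FP f) (hg : FP g) : FP fun x => (f x, g x) :=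
  FPQ.pair hf hg

theorem word_node_append (a b : BinTree) (r : List Bool) :
    word (BinTree.node a b) ++ r = true :: (a.ser ++ (b.ser ++ r)) := by
  simp [word, BinTree.ser]

open Prog in
theorem FP.hd : FP BinTree.hd := by
  refine ⟨.pop 0 fun o => bif o = some true then .seq Prog.swap Prog.drop else .push 0 false,
    fun x => 14 * sz x + 20, ((PB.const _).mul .size).add (.const _), ?_, fun A _ x r => ?_⟩
  · refine PB.size.mono fun x => ?_
    cases x <;> simp [BinTree.hd]; omega
  · cases x with
    | leaf => exact (pop_zero (T := 1) (Q := 0) (push_zero false)).mono (by simp) le_rfl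
    | node a b =>
      have := (does_swap (A := A) (m := r) a b).seq (does_drop b)
      rw [word_node_append]
      refine (pop_zero this).mono ?_ le_rfl
      simp [sz, word, BinTree.ser]; omega

open Prog in
theorem FP.tl : FP BinTree.tl := by
  refine ⟨.pop 0 fun o => bif o = some true then Prog.drop else .push 0 false,
    fun x => 7 * sz x + 20, ((PB.const _).mul .size).add (.const _), ?_, fun A _ x r => ?_⟩
  · refine PB.size.mono fun x => ?_
    cases x <;> simp [BinTree.tl]; omega
  · cases x with
    | leaf => exact (pop_zero (T := 1) (Q := 0) (push_zero false)).mono (by simp) le_rfl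
    | node a b =>
      have := does_drop (A := A) (m := b.ser ++ r) a
      rw [word_node_append]
      refine (pop_zero this).mono ?_ le_rfl
      simp [sz, word, BinTree.ser]; omega

theorem PB.bool (f : α → Bool) : PB fun x => sz (f x) :=
  (PB.const 3).mono fun x => sz_bool_le (f x)

open Prog in
theorem FP.isNode : FP BinTree.isNode := by
  refine ⟨.pop 0 fun o => bif o = some true then .seq Prog.drop (.seq Prog.drop (pushWord (word true)))
    else .push 0 false,
    fun x => 7 * sz x + 20, ((PB.const _).mul .size).add (.const _), .bool _, fun A _ x r => ?_⟩
  cases x with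
  | leaf => exact (pop_zero (T := 1) (Q := 0) (push_zero false)).mono (by simp) le_rfl
  | node a b =>
    have := (does_drop (A := A) (m := b.ser ++ r) a).seq ((does_drop b).seq
      (does_pushWord (word true)))
    rw [word_node_append]
    refine (pop_zero this).mono ?_ le_rfl
    simp [sz, word, BinTree.ser]; omega

theorem FP.decide_eq [DecidableEq α] : FP fun x : α × α => decide (x.1 = x.2) := by
  classical
  refine ⟨.pop 0 fun _ => Prog.equal, fun x => 11 * sz x.1 + 11 * sz x.2 + 21, ?_, .bool _,
    fun A _ x r => ?_⟩
  · refine (((PB.const 11).mul .size).add (.const 21)).mono fun x => ?_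
    simp; omega
  · have := Prog.does_equal (A := A) (m := r) (enc x.1) (enc x.2)
    rw [show word x ++ r = true :: ((enc x.1).ser ++ ((enc x.2).ser ++ r)) from
      word_node_append _ _ r]
    rw [show decide (enc x.1 = enc x.2) = decide (x.1 = x.2) by simp [Enc.inj.eq_iff]] at this
    exact Prog.pop_zero (br := fun _ => Prog.equal) this

open scoped Classical in
theorem FPQ.ask (A : Set (List Bool)) : FPQ {A} (fun x : α => decide (word x ∈ A)) fun _ => 1 := by
  refine ⟨Prog.ask, fun x => 9 * sz x + 9, ((PB.const _).mul .size).add (.const _), .bool _,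
    fun A' hA x r => ?_⟩
  obtain rfl := hA
  exact Prog.does_ask (enc x)

theorem FP.of_enc {F : BinTree → BinTree} (hF : FP F) (f : α → β) (h : ∀ x, enc (f x) = F (enc x)) :
    FP f := by
  obtain ⟨P, T, ⟨p, hp⟩, ⟨p', hp'⟩, H⟩ := hF
  have hw : ∀ x, word (f x) = word (F (enc x)) := fun x => by rw [word, h]; rfl
  refine ⟨P, fun x => T (enc x), ⟨p, fun x => hp (enc x)⟩, ⟨p', fun x => ?_⟩, fun A hA x r => ?_⟩
  · change (word (f x)).length ≤ _
    rw [hw]; exact hp' (enc x)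
  · rw [hw]; exact H A hA (enc x) r

theorem FPQ.cond {c : α → Bool} {g : α → β} {qc : α → ℕ} (hc : FPQ 𝒪 c qc) (hf : FPQ 𝒪 f q)
    (hg : FPQ 𝒪 g q') :
    FPQ 𝒪 (fun x => bif c x then f x else g x) fun x => qc x + (q x + q' x) := by
  obtain ⟨P₀, T₀, hT₀, hs₀, h₀⟩ := hc
  obtain ⟨P, T, hT, hs, h⟩ := hf
  obtain ⟨P', T', hT', hs', h'⟩ := hg
  refine ⟨.seq Prog.dup (.seq P₀ (.pop 0 fun o => bif o = some true then
      .pop 0 fun _ => .pop 0 fun _ => P else P')),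
    fun x => (12 * sz x + 5) + (T₀ x + ((T x + T' x + 2) + 1)), ?_, ?_, fun A hA x r => ?_⟩
  · exact (((PB.const _).mul .size).add (.const _)).add (hT₀.add
      (((hT.add hT').add (.const _)).add (.const _)))
  · exact (hs.add hs').mono fun x => by cases h : c x <;> simp [h]
  · refine (Prog.does_dup (enc x)).seq (((h₀ A hA x (word x ++ r)).seq (Prog.pop_zero ?_))) |>.conv
      le_rfl rfl (Nat.le_of_eq (Nat.zero_add _))
    cases hcx : c x
    · have := h' A hA x r
      simp only [hcx, cond_false]
      exact this.mono (Nat.le_add_left _ (T x) |>.trans (Nat.le_add_right _ 2)) (Nat.le_add_left _ (q x))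
    · have := Prog.pop_zero (br := fun _ => P) (m := false :: (word x ++ r)) (h A hA x r)
      have := Prog.pop_zero (br := fun _ => .pop 0 fun _ => P)
        (m := false :: false :: (word x ++ r)) this
      simp only [hcx, cond_true]
      exact this.mono (show T x + 1 + 1 ≤ _ by omega) (Nat.le_add_right _ (q' x))

@[fun_prop]
theorem FP.cond {c : α → Bool} {f g : α → β} (hc : FP c) (hf : FP f) (hg : FP g) :
    FP fun x => bif c x then f x else g x :=
  FPQ.cond hc hf hg

@[fun_prop]
theorem FP.fst {f : α → β × γ} (hf : FP f) : FP fun x => (f x).1 :=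
  FP.comp (FP.of_enc FP.hd Prod.fst fun _ => rfl) hf

@[fun_prop]
theorem FP.snd {f : α → β × γ} (hf : FP f) : FP fun x => (f x).2 :=
  FP.comp (FP.of_enc FP.tl Prod.snd fun _ => rfl) hf

@[fun_prop]
theorem FP.isEmpty {f : α → List β} (hf : FP f) : FP fun x => (f x).isEmpty := by
  have h : FP fun l : List β => l.isEmpty := by
    refine FP.of_enc (F := fun t => bif t.isNode then BinTree.leaf else .node .leaf .leaf)
      (FP.isNode.cond (.const _) (.const _)) _ fun l => ?_
    cases l <;> rfl
  exact h.comp hf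

@[fun_prop]
theorem FP.tail {f : α → List β} (hf : FP f) : FP fun x => (f x).tail :=
  FP.comp (FP.of_enc FP.tl List.tail fun l => by cases l <;> rfl) hf

@[fun_prop]
theorem FP.headD {f : α → List β} {g : α → β} (hf : FP f) (hg : FP g) :
    FP fun x => (f x).headD (g x) := by
  have h : FP fun x : List β × β => x.1.headD x.2 := by
    refine FP.of_enc (F := fun t => bif t.hd.isNode then t.hd.hd else t.tl)
      ((FP.isNode.comp FP.hd).cond (FP.hd.comp FP.hd) FP.tl) _ fun l => ?_
    obtain ⟨l, d⟩ := l
    cases l <;> rfl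
  exact h.comp (hf.prodMk hg)

@[fun_prop]
theorem FP.cons {f : α → β} {g : α → List β} (hf : FP f) (hg : FP g) :
    FP fun x => f x :: g x :=
  (FP.cast (fun x : β × List β => x.1 :: x.2) fun _ => rfl).comp (hf.prodMk hg)

section Fold

open Prog

/-- The test of `foldProg`: whether the list in the first component of the topmost tree is
nonempty. -/
def foldTest : Prog := .pop 0 fun _ => .pop 0 fun o => bif o = some true then
  .seq (.push 0 true) (.seq (.push 0 true) (.push 3 true)) else .seq (.push 0 false) (.push 0 true)

/-- Repeat `P` until the list in the first component of the topmost tree is empty. -/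
def foldProg (P : Prog) : Prog := .seq foldTest (.loop 3 fun _ => .seq P foldTest)

theorem does_foldTest {A : Set (List Bool)} (l : List β) (s : σ) (r : List Bool) :
    Does A foldTest ![word (l, s) ++ r, [], [], []] 5 0
      ![word (l, s) ++ r, [], [], if l = [] then [] else [true]] := by
  cases l with
  | nil => exact (pop_zero (pop_zero ((push_zero false).seq (push_zero true)))).mono (by simp) le_rfl
  | cons b l =>
    exact (pop_zero (pop_zero ((push_zero true).seq ((push_zero true).seq (push_three true))))).mono
      (by simp) le_rfl

theorem does_fold_loop {A : Set (List Bool)} {P : Prog} {h : σ → β → σ} {T : List β × σ → ℕ}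
    {c M : ℕ} (hP : ∀ b l s r, Does A P ![word (b :: l, s) ++ r, [], [], []] (T (b :: l, s)) c
      ![word (l, h s b) ++ r, [], [], []]) (l : List β) (s : σ) (r : List Bool)
    (hM : ∀ l₁ l₂, l = l₁ ++ l₂ → T (l₂, l₁.foldl h s) ≤ M) :
    Does A (.loop 3 fun _ => .seq P foldTest)
      ![word (l, s) ++ r, [], [], if l = [] then [] else [true]] (l.length * (M + 6) + 1)
      (l.length * c) ![word (([] : List β), l.foldl h s) ++ r, [], [], []] := by
  induction l generalizing s with
  | nil => exact (does_loop_nil rfl).mono (by simp) (by simp)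
  | cons b l ih =>
    have h₁ := ih (h s b) fun l₁ l₂ hl => hM (b :: l₁) l₂ (by rw [hl]; rfl)
    have h₂ := hM [] (b :: l) rfl
    refine (loop_three (body := fun _ => .seq P foldTest) (x := true) (c := [])
      ((hP b l s r).seq (does_foldTest l (h s b) r)) h₁).mono ?_ ?_
    · simp only [List.foldl_nil] at h₂
      simp only [List.length_cons, Nat.add_mul]; omega
    · simp only [List.length_cons, Nat.add_mul]; omega

theorem FPQ.foldl_aux [Inhabited β] {h : σ → β → σ} {c : ℕ}
    (hh : FPQ 𝒪 (fun z : σ × β => h z.1 z.2) fun _ => c) {l : α → List β} {g : α → σ}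
    (hl : FP l) (hg : FP g) {B : α → ℕ} (hB : PB B)
    (hb : ∀ x l₁, l₁ <+: l x → sz (l₁.foldl h (g x)) ≤ B x) :
    FPQ 𝒪 (fun x => (l x).foldl h (g x)) fun x => (l x).length * c := by
  have hG : FPQ 𝒪 (fun z : List β × σ => (z.1.tail, h z.2 (z.1.headD default))) fun _ => c := by
    refine (FPQ.pair (q := fun _ => 0) (FP.fpq (by fun_prop))
      (hh.comp (f := fun z : List β × σ => (z.2, z.1.headD default)) (q := fun _ => 0)
        (FP.fpq (by fun_prop)))).mono subset_rfl fun x => by simp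
  obtain ⟨P, T, hT, _, hP⟩ := hG
  have hlg : FP fun x => (l x, g x) := hl.prodMk hg
  obtain ⟨Q, T₁, hT₁, _, hQ⟩ := hlg
  obtain ⟨M, hM, hTM⟩ := hT.exists_comp (hl.pb.add (hB.add (.const 1)))
  refine ⟨.seq Q (.seq (foldProg P) (.pop 0 fun _ => drop)), fun x =>
    T₁ x + (5 + (sz (l x) * (M x + 6) + 1) + (10 + 1)), ?_, hB.mono fun x => hb x _ (List.prefix_refl _),
    fun A hA x r => ?_⟩
  · exact hT₁.add (((PB.const 5).add ((hl.pb.mul (hM.add (.const _))).add (.const _))).add (.const _))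
  · have h₁ := does_fold_loop (A := A) (h := h) (T := T) (c := c) (M := M x)
      (fun b l s r => hP A hA (b :: l, s) r) (l x) (g x) r fun l₁ l₂ hl' => by
        refine hTM x (l₂, l₁.foldl h (g x)) ?_
        have h₁ := hb x l₁ ⟨l₂, hl'.symm⟩
        have h₂ : sz l₂ ≤ sz (l x) := sz_le_of_sublist (hl' ▸ List.sublist_append_right _ _)
        simp; omega
    have h₂ := (hQ A trivial x r).seq (((does_foldTest (l x) (g x) r).seq h₁).seq
      (pop_zero (br := fun _ => drop) (T := 10) (Q := 0) (b := []) (c := []) (a := [])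
      (S' := ![word ((l x).foldl h (g x)) ++ r, [], [], []])
      (m := word (([] : List β), (l x).foldl h (g x)) ++ r)
      ((does_drop BinTree.leaf).conv (by simp [BinTree.ser]) rfl)))
    refine h₂.mono ?_ (by simp)
    have := Nat.mul_le_mul_right (M x + 6) (length_le_sz (l x))
    simp only; omega

theorem FPQ.foldl [Inhabited β] {h : α → σ → β → σ} {c : ℕ}
    (hh : FPQ 𝒪 (fun z : α × σ × β => h z.1 z.2.1 z.2.2) fun _ => c) {l : α → List β} {g : α → σ}
    (hl : FP l) (hg : FP g) {B : α → ℕ} (hB : PB B)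
    (hb : ∀ x l₁, l₁ <+: l x → sz (l₁.foldl (h x) (g x)) ≤ B x) :
    FPQ 𝒪 (fun x => (l x).foldl (h x) (g x)) fun x => (l x).length * c := by
  have key : ∀ x l₁, List.foldl (fun (z : α × σ) b => (z.1, h z.1 z.2 b)) (x, g x) l₁ =
      (x, l₁.foldl (h x) (g x)) := fun x l₁ => by
    generalize g x = s
    induction l₁ generalizing s with
    | nil => rfl
    | cons b l₁ ih => exact ih _
  have h₁ : FPQ 𝒪 (fun z : (α × σ) × β => (z.1.1, h z.1.1 z.1.2 z.2)) fun _ => c := by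
    refine (FPQ.pair (q := fun _ => 0) (FP.fpq (by fun_prop))
      (hh.comp (f := fun z : (α × σ) × β => (z.1.1, z.1.2, z.2)) (q := fun _ => 0)
        (FP.fpq (by fun_prop)))).mono subset_rfl fun x => by simp
  have h₂ := FPQ.foldl_aux (h := fun (z : α × σ) b => (z.1, h z.1 z.2 b)) h₁ (g := fun x => (x, g x))
    hl (by fun_prop) (B := fun x => sz x + B x + 1) ((PB.size.add hB).add (.const 1)) fun x l₁ hl₁ => by
      rw [key]
      have := hb x l₁ hl₁
      simpa using this
  have h₃ : FP (fun z : α × σ => z.2) := by fun_prop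
  have h₄ := (h₃.fpq (q := fun _ => 0)).comp h₂
  simp only [key] at h₄
  exact h₄.mono subset_rfl fun x => by simp

end Fold

end FPQ

section Library

variable {α β γ σ : Type} [Enc α] [Enc β] [Enc γ] [Enc σ]

@[fun_prop]
theorem FP.not {f : α → Bool} (hf : FP f) : FP fun x => !f x := by
  have : FP fun x => bif f x then false else true := by fun_prop
  convert this using 2 with x
  cases f x <;> rfl

@[fun_prop]
theorem FP.and {f g : α → Bool} (hf : FP f) (hg : FP g) : FP fun x => f x && g x := by
  have : FP fun x => bif f x then g x else false := by fun_prop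
  convert this using 2 with x
  cases f x <;> rfl

@[fun_prop]
theorem FP.or {f g : α → Bool} (hf : FP f) (hg : FP g) : FP fun x => f x || g x := by
  have : FP fun x => bif f x then true else g x := by fun_prop
  convert this using 2 with x
  cases f x <;> rfl

@[fun_prop]
theorem FP.xor {f g : α → Bool} (hf : FP f) (hg : FP g) : FP fun x => xor (f x) (g x) := by
  have : FP fun x => bif f x then !g x else g x := by fun_prop
  convert this using 2 with x
  cases f x <;> simp

@[fun_prop]
theorem FP.eq [DecidableEq β] {f g : α → β} (hf : FP f) (hg : FP g) :
    FP fun x => decide (f x = g x) :=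
  FP.decide_eq.comp (hf.prodMk hg)

@[fun_prop]
theorem FP.some {f : α → β} (hf : FP f) : FP fun x => some (f x) :=
  (FP.of_enc (F := fun t => t.node .leaf)
    (FP.of_enc (F := fun t => t) FP.id (fun x : BinTree × BinTree => x.1.node x.2) (fun _ => rfl)
      |>.comp (FP.id.prodMk (.const _))) Option.some fun _ => rfl).comp hf

@[fun_prop]
theorem FP.isSome {f : α → Option β} (hf : FP f) : FP fun x => (f x).isSome := by
  have h : FP fun o : Option β => o.isSome :=
    FP.of_enc (F := fun t => bif t.isNode then .node .leaf .leaf else .leaf)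
      (FP.isNode.cond (.const _) (.const _)) _ fun o => by cases o <;> rfl
  exact h.comp hf

@[fun_prop]
theorem FP.optionGetD {f : α → Option β} {g : α → β} (hf : FP f) (hg : FP g) :
    FP fun x => (f x).getD (g x) := by
  have h : FP fun x : Option β × β => x.1.getD x.2 := by
    refine FP.of_enc (F := fun t => bif t.hd.isNode then t.hd.hd else t.tl)
      ((FP.isNode.comp FP.hd).cond (FP.hd.comp FP.hd) FP.tl) _ fun l => ?_
    obtain ⟨l, d⟩ := l
    cases l <;> rfl
  exact h.comp (hf.prodMk hg)

@[fun_prop]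
theorem FP.succ {f : α → ℕ} (hf : FP f) : FP fun x => f x + 1 :=
  (FP.cast (fun x : Unit × ℕ => x.2 + 1) fun _ => rfl).comp ((FP.const ()).prodMk hf)

attribute [fun_prop] FP.hd FP.tl FP.isNode

@[fun_prop]
theorem FP.node {f g : α → BinTree} (hf : FP f) (hg : FP g) :
    FP fun x => BinTree.node (f x) (g x) :=
  (FP.cast (fun x : BinTree × BinTree => x.1.node x.2) fun _ => rfl).comp (hf.prodMk hg)

theorem FP.encode : FP (enc : α → BinTree) := FP.cast _ fun _ => rfl

theorem FP.replicate {n : α → ℕ} (hn : FP n) : FP fun x => List.replicate (n x) () :=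
  FP.comp (FP.cast (fun n : ℕ => List.replicate n ()) fun n => by
    induction n with
    | zero => rfl
    | succ n ih => simp [List.replicate_succ, ih]) hn

theorem FP.exists_bound {f : α → β → γ} (hf : FP fun z : α × β => f z.1 z.2) {l : α → List β}
    (hl : FP l) : ∃ B : α → ℕ, PB B ∧ ∀ x, ∀ b ∈ l x, sz (f x b) ≤ B x := by
  obtain ⟨B, hB, h⟩ := hf.pb.exists_comp ((PB.size (α := α)).add (hl.pb.add (.const 1)))
  refine ⟨B, hB, fun x b hb => h x (x, b) ?_⟩
  have := sz_le_of_mem hb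
  simp; omega

section Fold

variable {𝒪 : Set (Set (List Bool))} [Inhabited β] {l : α → List β} {g : α → σ} {h : α → σ → β → σ}
  {B : α → ℕ} {c : ℕ}

theorem FPQ.foldl_of_le_add (hh : FPQ 𝒪 (fun z : α × σ × β => h z.1 z.2.1 z.2.2) fun _ => c)
    (hl : FP l) (hg : FP g) (hB : PB B) (hb : ∀ x s, ∀ b ∈ l x, sz (h x s b) ≤ sz s + B x) :
    FPQ 𝒪 (fun x => (l x).foldl (h x) (g x)) fun x => (l x).length * c := by
  refine FPQ.foldl hh hl hg (B := fun x => sz (g x) + sz (l x) * B x) (hg.pb.add (hl.pb.mul hB))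
    fun x l₁ hl₁ => ?_
  suffices ∀ (l₁ : List β) s, (∀ b ∈ l₁, b ∈ l x) →
      sz (l₁.foldl (h x) s) ≤ sz s + l₁.length * B x by
    refine (this l₁ (g x) fun b hb' => hl₁.subset hb').trans ?_
    gcongr
    exact (hl₁.length_le).trans (length_le_sz _)
  intro l₁
  induction l₁ with
  | nil => simp
  | cons b l₁ ih =>
    intro s hs
    refine (ih (h x s b) fun b hb' => hs b (List.mem_cons_of_mem _ hb')).trans ?_
    have := hb x s b (hs b List.mem_cons_self)
    rw [List.length_cons, Nat.add_mul]
    omega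

theorem FP.foldl_of_le_add (hh : FP fun z : α × σ × β => h z.1 z.2.1 z.2.2)
    (hl : FP l) (hg : FP g) (hB : PB B) (hb : ∀ x s, ∀ b ∈ l x, sz (h x s b) ≤ sz s + B x) :
    FP fun x => (l x).foldl (h x) (g x) :=
  (FPQ.foldl_of_le_add (c := 0) hh hl hg hB hb).mono subset_rfl fun _ => by simp

end Fold

@[fun_prop]
theorem FP.reverse {l : α → List β} [Inhabited β] (hl : FP l) : FP fun x => (l x).reverse := by
  have := FP.foldl_of_le_add (h := fun (_ : List β) (s : List β) b => b :: s) (l := fun x => x)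
    (g := fun _ => []) (B := fun x => sz x + 1) (by fun_prop) (by fun_prop) (by fun_prop)
    (PB.size.add (.const 1)) fun x s b hb => by
      have := sz_le_of_mem hb
      simp; omega
  have key : ∀ x s : List β, x.foldl (fun s b => b :: s) s = x.reverse ++ s := by
    intro x
    induction x with
    | nil => simp
    | cons b x ih => simp [ih]
  simp only [key, List.append_nil] at this
  exact this.comp hl

theorem FP.iterate {n : α → ℕ} {g : α → σ} {h : α → σ → σ} {B : α → ℕ} (hn : FP n) (hg : FP g)
    (hh : FP fun z : α × σ => h z.1 z.2) (hB : PB B)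
    (hb : ∀ x, ∀ k ≤ n x, sz ((h x)^[k] (g x)) ≤ B x) : FP fun x => (h x)^[n x] (g x) := by
  have key : ∀ x (l : List Unit) s, l.foldl (fun s _ => h x s) s = (h x)^[l.length] s := by
    intro x l
    induction l with
    | nil => exact fun s => rfl
    | cons a l ih => exact fun s => ih _
  have := FPQ.foldl (c := 0) (𝒪 := Set.univ) (h := fun x s (_ : Unit) => h x s)
    (FP.comp (f := fun z : α × σ × Unit => (z.1, z.2.1)) hh (by fun_prop)) hn.replicate hg hB
    fun x l₁ hl₁ => by
      rw [key]
      exact hb x _ (by simpa using hl₁.length_le)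
  simp only [key, List.length_replicate, mul_zero] at this
  exact this

theorem FP.iterate_of_le_add {n : α → ℕ} {g : α → σ} {h : α → σ → σ} {B : α → ℕ} (hn : FP n)
    (hg : FP g) (hh : FP fun z : α × σ => h z.1 z.2) (hB : PB B)
    (hb : ∀ x s, sz (h x s) ≤ sz s + B x) : FP fun x => (h x)^[n x] (g x) := by
  refine FP.iterate (B := fun x => sz (g x) + sz (n x) * B x) hn hg hh
    (hg.pb.add (hn.pb.mul hB)) fun x k hk => ?_
  have : sz ((h x)^[k] (g x)) ≤ sz (g x) + k * B x := by
    clear hk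
    induction k with
    | zero => simp
    | succ k ih =>
      rw [Function.iterate_succ_apply', Nat.add_mul]
      have := hb x ((h x)^[k] (g x))
      omega
  refine this.trans ?_
  gcongr
  simp; omega

@[fun_prop]
theorem FP.length {l : α → List β} [Inhabited β] (hl : FP l) : FP fun x => (l x).length := by
  have h := FP.foldl_of_le_add (h := fun _ s (_ : β) => s + 1) (g := fun _ => 0)
    (B := fun _ => 2) (by fun_prop) hl (by fun_prop) (.const 2) fun x s b hb => by simp; omega
  have key : ∀ (x : List β) s, x.foldl (fun s _ => s + 1) s = s + x.length := by
    intro x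
    induction x with
    | nil => simp
    | cons b x ih => intro s; simp [ih]; omega
  simpa only [key, zero_add] using h

@[fun_prop]
theorem FP.append {l l' : α → List β} [Inhabited β] (hl : FP l) (hl' : FP l') :
    FP fun x => l x ++ l' x := by
  have h := FP.foldl_of_le_add (h := fun _ s (b : β) => b :: s) (l := fun x => (l x).reverse)
    (B := fun x => sz (l x) + 1) (by fun_prop) (by fun_prop) hl'
    (hl.pb.add (.const 1)) fun x s b hb => by
      have := sz_le_of_mem hb
      simp at this ⊢; omega
  have key : ∀ (x : List β) s, x.foldl (fun s b => b :: s) s = x.reverse ++ s := by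
    intro x
    induction x with
    | nil => simp
    | cons b x ih => simp [ih]
  simpa only [key, List.reverse_reverse] using h

@[fun_prop]
theorem FP.add {f g : α → ℕ} (hf : FP f) (hg : FP g) : FP fun x => f x + g x := by
  have h : FP fun x => (List.replicate (g x) () ++ List.replicate (f x) ()).length :=
    ((FP.replicate hg).append (FP.replicate hf)).length
  simpa [Nat.add_comm] using h

theorem FPQ.map {𝒪 : Set (Set (List Bool))} {c : ℕ} [Inhabited β] [Inhabited γ] {f : α → β → γ}
    {l : α → List β} (hf : FPQ 𝒪 (fun z : α × β => f z.1 z.2) fun _ => c) (hl : FP l) :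
    FPQ 𝒪 (fun x => (l x).map (f x)) fun x => (l x).length * c := by
  obtain ⟨B, hB, hfB⟩ := hf.pb.exists_comp ((PB.size (α := α)).add (hl.pb.add (.const 1)))
  have hh : FPQ 𝒪 (fun z : α × List γ × β => f z.1 z.2.2 :: z.2.1) fun _ => c := by
    have h₁ := FPQ.pair (hf.comp (f := fun z : α × List γ × β => (z.1, z.2.2)) (q := fun _ => 0)
      (FP.fpq (by fun_prop))) (FP.fpq (q := fun _ => 0) (f := fun z : α × List γ × β => z.2.1)
      (by fun_prop))
    have h₂ : FP fun z : γ × List γ => z.1 :: z.2 := by fun_prop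
    exact ((h₂.fpq (q := fun _ => 0)).comp h₁).mono subset_rfl fun x => by simp
  have h := FPQ.foldl_of_le_add (h := fun x s b => f x b :: s) (g := fun _ => [])
    (B := fun x => B x + 1) hh hl (by fun_prop) (hB.add (.const 1)) fun x s b hb => by
      have := hfB x (x, b) (by have := sz_le_of_mem hb; simp; omega)
      simp at this ⊢; omega
  have hr : FP fun l : List γ => l.reverse := by fun_prop
  have h' := (hr.fpq (q := fun _ => 0)).comp h
  have key : ∀ x (l : List β) (s : List γ),
      (l.foldl (fun s b => f x b :: s) s).reverse = s.reverse ++ l.map (f x) := by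
    intro x l
    induction l with
    | nil => simp
    | cons b x ih => simp
  simpa only [key, List.reverse_nil, List.nil_append, add_zero] using h'

@[fun_prop]
theorem FP.map [Inhabited β] [Inhabited γ] {f : α → β → γ} {l : α → List β}
    (hf : FP fun z : α × β => f z.1 z.2) (hl : FP l) : FP fun x => (l x).map (f x) :=
  (FPQ.map (c := 0) hf hl).mono subset_rfl fun _ => by simp

@[fun_prop]
theorem FP.filter [Inhabited β] {f : α → β → Bool} {l : α → List β}
    (hf : FP fun z : α × β => f z.1 z.2) (hl : FP l) : FP fun x => (l x).filter (f x) := by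
  have h := FP.foldl_of_le_add (h := fun x s b => bif f x b then b :: s else s)
    (g := fun _ => []) (B := fun x => sz (l x) + 1)
    (((FP.comp (f := fun z : α × List β × β => (z.1, z.2.2)) hf (by fun_prop))).cond
      (by fun_prop) (by fun_prop)) hl (by fun_prop)
    (hl.pb.add (.const 1)) fun x s b hb => by
      have := sz_le_of_mem hb
      cases h : f x b <;> simp; omega
  have key : ∀ x (l : List β) (s : List β),
      (l.foldl (fun s b => bif f x b then b :: s else s) s).reverse =
        s.reverse ++ l.filter (f x) := by
    intro x l
    induction l with
    | nil => simp
    | cons b l ih => intro s; cases h : f x b <;> simp [ih, h]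
  have h' := h.reverse
  simpa only [key, List.reverse_nil, List.nil_append] using h'

@[fun_prop]
theorem FP.any [Inhabited β] {f : α → β → Bool} {l : α → List β}
    (hf : FP fun z : α × β => f z.1 z.2) (hl : FP l) : FP fun x => (l x).any (f x) := by
  have h : FP fun x => !((l x).filter (f x)).isEmpty := by fun_prop
  convert h using 2 with x
  rw [Bool.eq_iff_iff]
  simp

@[fun_prop]
theorem FP.all [Inhabited β] {f : α → β → Bool} {l : α → List β}
    (hf : FP fun z : α × β => f z.1 z.2) (hl : FP l) : FP fun x => (l x).all (f x) := by
  have h : FP fun x => !((l x).any fun b => !f x b) := by fun_prop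
  convert h using 2 with x
  simp [List.all_eq_not_any_not]

@[fun_prop]
theorem FP.flatMap [Inhabited β] [Inhabited γ] {f : α → β → List γ} {l : α → List β}
    (hf : FP fun z : α × β => f z.1 z.2) (hl : FP l) : FP fun x => (l x).flatMap (f x) := by
  obtain ⟨B, hB, hfB⟩ := hf.exists_bound hl
  have hf' : FP fun z : α × List γ × β => f z.1 z.2.2 :=
    FP.comp (f := fun z : α × List γ × β => (z.1, z.2.2)) hf (by fun_prop)
  have h := FP.foldl_of_le_add (h := fun x s b => s ++ f x b)
    (g := fun _ => []) (B := B) (by fun_prop) hl (by fun_prop) hB fun x s b hb => by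
      have := sz_append s (f x b)
      have := hfB x b hb
      omega
  have key : ∀ x (l : List β) (s : List γ),
      l.foldl (fun s b => s ++ f x b) s = s ++ l.flatMap (f x) := by
    intro x l
    induction l with
    | nil => simp
    | cons b l ih => intro s; simp [ih]
  simpa only [key, List.nil_append] using h

theorem sz_range_le (n : ℕ) : sz (List.range n) ≤ n * (2 * n + 2) + 1 := by
  suffices ∀ l : List ℕ, (∀ i ∈ l, i < n) → sz l ≤ l.length * (2 * n + 2) + 1 by
    simpa using this (List.range n) (by simp)
  intro l
  induction l with
  | nil => simp
  | cons i l ih =>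
    intro h
    have := ih fun j hj => h j (List.mem_cons_of_mem _ hj)
    have := h i List.mem_cons_self
    simp [Nat.add_mul]; omega

@[fun_prop]
theorem FP.range {n : α → ℕ} (hn : FP n) : FP fun x => List.range (n x) := by
  have key : ∀ k : ℕ, (fun z : ℕ × List ℕ => (z.1 + 1, z.1 :: z.2))^[k] (0, []) =
      (k, (List.range k).reverse) := by
    intro k
    induction k with
    | zero => rfl
    | succ k ih => simp [Function.iterate_succ_apply', ih, List.range_succ]
  have h := FP.iterate (h := fun _ (z : ℕ × List ℕ) => (z.1 + 1, z.1 :: z.2)) (g := fun _ => (0, []))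
    (B := fun x => (2 * sz (n x) + 1) + (sz (n x) * (2 * sz (n x) + 2) + 1) + 1) hn (by fun_prop)
    (by fun_prop) ?_ fun x k hk => ?_
  · simp only [key] at h
    simpa only [List.reverse_reverse] using h.snd.reverse
  · have h1 : PB fun x => 2 * sz (n x) := (PB.const 2).mul hn.pb
    exact ((h1.add (.const 1)).add ((hn.pb.mul (h1.add (.const 2))).add (.const 1))).add (.const 1)
  · have hk' : k ≤ sz (n x) := by simp; omega
    rw [key, sz_prod, sz_reverse]
    have := sz_range_le k
    have : k * (2 * k + 2) ≤ sz (n x) * (2 * sz (n x) + 2) := by gcongr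
    simp only [sz_nat k]
    omega

@[fun_prop]
theorem FP.getD {l : α → List β} {i : α → ℕ} {d : α → β} (hl : FP l) (hi : FP i) (hd : FP d) :
    FP fun x => (l x).getD (i x) (d x) := by
  have h := FP.iterate (h := fun _ (z : List β) => z.tail) (B := fun x => sz (l x)) hi hl
    (by fun_prop) hl.pb fun x k hk => by
      refine sz_le_of_sublist ?_
      clear hk
      induction k with
      | zero => simp
      | succ k ih =>
        rw [Function.iterate_succ_apply']
        exact (List.tail_sublist _).trans ih
  have h' := h.headD hd
  have key : ∀ (k : ℕ) (l : List β) d, (List.tail^[k] l).headD d = l.getD k d := by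
    intro k
    induction k with
    | zero => intro l d; cases l <;> rfl
    | succ k ih =>
      intro l d
      rw [Function.iterate_succ_apply, ih]
      cases l <;> simp
  simpa only [key] using h'

end Library

/-! ## Reachability -/

section Reach

variable {α β : Type}

/-- One round of the computation of the reachable nodes. -/
def reachStep (nodes : List β) (init : β → Bool) (edge : β → β → Bool) (R : List β) : List β :=
  nodes.filter fun b => init b || R.any fun a => edge a b

/-- The nodes that are reachable from an initial node. -/
def reach (nodes : List β) (init : β → Bool) (edge : β → β → Bool) : List β :=
  (reachStep nodes init edge)^[nodes.length] []

variable {nodes : List β} {init : β → Bool} {edge : β → β → Bool}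

theorem reach_induction {p : β → Prop} (h₁ : ∀ b ∈ nodes, init b → p b)
    (h₂ : ∀ a, ∀ b ∈ nodes, p a → edge a b → p b) : ∀ b ∈ reach nodes init edge, p b := by
  unfold reach
  generalize nodes.length = k
  induction k with
  | zero => simp
  | succ k ih =>
    intro b hb
    rw [Function.iterate_succ_apply', reachStep, List.mem_filter] at hb
    obtain ⟨hb, h⟩ := hb
    simp only [Bool.or_eq_true, List.any_eq_true] at h
    rcases h with h | ⟨a, ha, h⟩
    · exact h₁ b hb h
    · exact h₂ a b hb (ih a ha) h

theorem reachStep_mono {R R' : List β} (h : R ⊆ R') :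
    reachStep nodes init edge R ⊆ reachStep nodes init edge R' := by
  intro b
  simp only [reachStep, List.mem_filter, Bool.or_eq_true, List.any_eq_true]
  exact fun ⟨hb, h'⟩ => ⟨hb, h'.imp_right fun ⟨a, ha, h'⟩ => ⟨a, h ha, h'⟩⟩

theorem reachStep_reach : reachStep nodes init edge (reach nodes init edge) =
    reach nodes init edge := by
  set F := reachStep nodes init edge with hF
  have hmono : ∀ k, F^[k] [] ⊆ F^[k + 1] [] := by
    intro k
    induction k with
    | zero => simp
    | succ k ih =>
      rw [Function.iterate_succ_apply', Function.iterate_succ_apply' F (k + 1)]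
      exact reachStep_mono ih
  have hsub : ∀ k, F^[k] [] = F^[k + 1] [] ∨ (F^[k] []).length < (F^[k + 1] []).length := by
    intro k
    cases k with
    | zero =>
      cases h : F^[0 + 1] [] with
      | nil => simp
      | cons => simp
    | succ k =>
      have h := hmono (k + 1)
      rw [Function.iterate_succ_apply', Function.iterate_succ_apply' F (k + 1)] at h ⊢
      have hs : (F (F^[k] [])).Sublist (F (F^[k + 1] [])) := by
        refine List.monotone_filter_right _ fun b hb => ?_
        simp only [Bool.or_eq_true, List.any_eq_true] at hb ⊢
        exact hb.imp_right fun ⟨a, ha, h'⟩ => ⟨a, hmono k ha, h'⟩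
      rcases hs.length_le.lt_or_eq with h' | h'
      · exact .inr h'
      · exact .inl (hs.eq_of_length h')
  have hlen : ∀ k, F^[k] [] = F^[k + 1] [] ∨ k < (F^[k + 1] []).length := by
    intro k
    induction k with
    | zero => simpa using hsub 0
    | succ k ih =>
      rcases ih with ih | ih
      · left
        rw [Function.iterate_succ_apply', ih, ← Function.iterate_succ_apply' F]
      · rcases hsub (k + 1) with h | h
        · exact .inl h
        · exact .inr (by omega)
  rcases hlen nodes.length with h | h
  · rw [Function.iterate_succ_apply'] at h
    exact h.symm
  · rw [Function.iterate_succ_apply'] at h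
    exact absurd (List.length_filter_le _ nodes) (by simpa [hF, reachStep] using h)

theorem mem_reach {b : β} : b ∈ reach nodes init edge ↔
    b ∈ nodes ∧ (init b ∨ ∃ a ∈ reach nodes init edge, edge a b) := by
  conv_lhs => rw [← reachStep_reach]
  simp [reachStep]

@[fun_prop]
theorem FP.reach [Enc α] [Enc β] [Inhabited β] {nodes : α → List β} {init : α → β → Bool} {edge : α → β → β → Bool}
    (hn : FP nodes) (hi : FP fun z : α × β => init z.1 z.2)
    (he : FP fun z : α × β × β => edge z.1 z.2.1 z.2.2) :
    FP fun x => reach (nodes x) (init x) (edge x) := by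
  have hs : FP fun z : α × List β => reachStep (nodes z.1) (init z.1) (edge z.1) z.2 := by
    unfold reachStep
    have hi' : FP fun z : (α × List β) × β => init z.1.1 z.2 :=
      FP.comp (f := fun z : (α × List β) × β => (z.1.1, z.2)) hi (by fun_prop)
    have he' : FP fun z : ((α × List β) × β) × β => edge z.1.1.1 z.2 z.1.2 :=
      FP.comp (f := fun z : ((α × List β) × β) × β => (z.1.1.1, z.2, z.1.2)) he (by fun_prop)
    fun_prop
  refine FP.iterate (hn := hn.length) (FP.const []) hs (hn.pb.add (.const 1)) fun x k _ => ?_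
  cases k with
  | zero => simp
  | succ k =>
    rw [Function.iterate_succ_apply']
    exact (sz_le_of_sublist List.filter_sublist).trans (Nat.le_succ _)

end Reach

/-! ## Parsing -/

section Parsing

variable {α β γ σ : Type} [Enc α] [Enc β] [Enc σ]

/-- Parse the unary code of a number. -/
def parseUnary (l : List Bool) : ℕ × List Bool :=
  let z := (fun z : ℕ × List Bool => bif z.2.headD false then (z.1 + 1, z.2.tail) else z)^[l.length]
    (0, l)
  (z.1, z.2.tail)

/-- Parse the code of a pair of words. -/
def parsePair (l : List Bool) : List Bool × List Bool :=
  let z := (fun z : List Bool × List Bool =>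
    bif z.2.headD false then (z.2.tail.headD false :: z.1, z.2.tail.tail) else z)^[l.length] ([], l)
  (z.1.reverse, z.2.tail)

/-- Apply a parser `k` times. -/
def parseMany {σ : Type} (p : σ → γ × σ) (k : ℕ) (l : σ) : List γ × σ :=
  let z := (fun z : List γ × σ => ((p z.2).1 :: z.1, (p z.2).2))^[k] ([], l)
  (z.1.reverse, z.2)

theorem parseUnary_code (n : ℕ) (r : List Bool) : parseUnary (unaryCode n ++ r) = (n, r) := by
  have key : ∀ k n a, n ≤ k → (fun z : ℕ × List Bool =>
      bif z.2.headD false then (z.1 + 1, z.2.tail) else z)^[k] (a, unaryCode n ++ r) =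
      (a + n, false :: r) := by
    intro k
    induction k with
    | zero => intro n a h; obtain rfl : n = 0 := by omega
              rfl
    | succ k ih =>
      intro n a h
      rw [Function.iterate_succ_apply]
      cases n with
      | zero => exact ih 0 a (by omega)
      | succ n =>
        refine (ih n (a + 1) (by omega)).trans ?_
        rw [Nat.add_right_comm, Nat.add_assoc]
  unfold parseUnary
  rw [key _ n 0 (by simp [unaryCode])]
  simp

theorem parsePair_code (x r : List Bool) : parsePair (pairCode x r) = (x, r) := by
  have key : ∀ k x a, x.length ≤ k → (fun z : List Bool × List Bool =>
      bif z.2.headD false then (z.2.tail.headD false :: z.1, z.2.tail.tail) else z)^[k]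
        (a, pairCode x r) = (x.reverse ++ a, false :: r) := by
    intro k
    induction k with
    | zero => intro x a h; obtain rfl : x = [] := by simpa using h
              rfl
    | succ k ih =>
      intro x a h
      rw [Function.iterate_succ_apply]
      cases x with
      | nil => exact ih [] a (by simp)
      | cons b x =>
        refine (ih x (b :: a) (by simpa using h)).trans ?_
        simp
  unfold parsePair
  rw [key _ x [] (by simp [pairCode]; omega)]
  simp

theorem parseMany_succ {σ : Type} (p : σ → γ × σ) (k : ℕ) (l : σ) :
    parseMany p (k + 1) l = ((p l).1 :: (parseMany p k (p l).2).1, (parseMany p k (p l).2).2) := by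
  have key : ∀ k (a : List γ) l, (fun z : List γ × σ => ((p z.2).1 :: z.1, (p z.2).2))^[k]
      (a, l) = ((parseMany p k l).1.reverse ++ a, (parseMany p k l).2) := by
    intro k
    induction k with
    | zero => intro a l; simp [parseMany]
    | succ k ih =>
      intro a l
      simp only [parseMany] at ih ⊢
      rw [Function.iterate_succ_apply, ih, Function.iterate_succ_apply, ih [_]]
      simp
  rw [parseMany, Function.iterate_succ_apply, key]
  simp

theorem parseMany_code {p : List Bool → γ × List Bool} {code : γ → List Bool} (l : List γ)
    (h : ∀ b ∈ l, ∀ r, p (code b ++ r) = (b, r)) (r : List Bool) :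
    parseMany p l.length (l.flatMap code ++ r) = (l, r) := by
  induction l with
  | nil => rfl
  | cons b l ih =>
    rw [List.length_cons, parseMany_succ, List.flatMap_cons, List.append_assoc,
      h b List.mem_cons_self, ih fun b hb => h b (List.mem_cons_of_mem _ hb)]

theorem length_parseMany {σ : Type} (p : σ → γ × σ) (k : ℕ) (l : σ) :
    (parseMany p k l).1.length = k := by
  induction k generalizing l with
  | zero => rfl
  | succ k ih => simp [parseMany_succ, ih]

theorem forall_mem_parseMany {p : List Bool → γ × List Bool} {P : γ → Prop} (h : ∀ l, P (p l).1)
    (k : ℕ) (l : List Bool) : ∀ b ∈ (parseMany p k l).1, P b := by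
  induction k generalizing l with
  | zero => simp [parseMany]
  | succ k ih => simpa [parseMany_succ] using ⟨h l, ih _⟩

@[fun_prop]
theorem FP.parseUnary : FP parseUnary := by
  have h := FP.iterate_of_le_add (n := fun l : List Bool => l.length) (g := fun l => (0, l))
    (h := fun _ (z : ℕ × List Bool) => bif z.2.headD false then (z.1 + 1, z.2.tail) else z)
    (B := fun _ => 2) (by fun_prop) (by fun_prop) (by fun_prop) (.const 2) fun x s => by
      have := sz_le_of_sublist (List.tail_sublist s.2)
      cases h : s.2.headD false <;> (simp; try omega)
  exact h.fst.prodMk h.snd.tail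

theorem parsePair_step_le (s : List Bool × List Bool) :
    sz (bif s.2.headD false then (s.2.tail.headD false :: s.1, s.2.tail.tail) else s) ≤ sz s := by
  obtain ⟨a, l⟩ := s
  match l with
  | [] => simp
  | [false] => simp
  | [true] => simp [show sz false = 1 from rfl, show sz true = 3 from rfl]; omega
  | b :: b' :: l => cases b <;> simp; omega

@[fun_prop]
theorem FP.parsePair : FP parsePair := by
  have h := FP.iterate_of_le_add (n := fun l : List Bool => l.length) (g := fun l => ([], l))
    (h := fun _ (z : List Bool × List Bool) =>
      bif z.2.headD false then (z.2.tail.headD false :: z.1, z.2.tail.tail) else z)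
    (B := fun _ => 0) (by fun_prop) (by fun_prop) (by fun_prop) (.const 0)
    fun x s => parsePair_step_le s
  exact h.fst.reverse.prodMk h.snd.tail

theorem parsePair_le (l : List Bool) : sz (parsePair l).1 + sz (parsePair l).2 ≤ sz l + 1 := by
  have key : ∀ k (z : List Bool × List Bool), sz ((fun z : List Bool × List Bool =>
      bif z.2.headD false then (z.2.tail.headD false :: z.1, z.2.tail.tail) else z)^[k] z) ≤ sz z := by
    intro k
    induction k with
    | zero => simp
    | succ k ih =>
      intro z
      rw [Function.iterate_succ_apply']
      exact (parsePair_step_le _).trans (ih z)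
  have h := key l.length ([], l)
  simp only [sz_prod, sz_nil] at h
  simp only [parsePair, sz_reverse]
  refine le_trans (Nat.add_le_add_left (sz_le_of_sublist (List.tail_sublist _)) _) ?_
  omega

theorem FP.parseMany [Inhabited β] {p : α → σ → β × σ} {k : α → ℕ} {l : α → σ}
    (hp : FP fun z : α × σ => p z.1 z.2) (hk : FP k) (hl : FP l) {B : α → ℕ} (hB : PB B)
    (hb : ∀ x l, sz (p x l).1 + sz (p x l).2 ≤ sz l + B x) :
    FP fun x => parseMany (p x) (k x) (l x) := by
  have hp' : FP fun z : α × List β × σ => p z.1 z.2.2 :=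
    FP.comp (f := fun z : α × List β × σ => (z.1, z.2.2)) hp (by fun_prop)
  have h := FP.iterate_of_le_add (n := k) (g := fun x => ([], l x))
    (h := fun x (z : List β × σ) => ((p x z.2).1 :: z.1, (p x z.2).2))
    (B := fun x => B x + 1) hk (by fun_prop) (by fun_prop) (hB.add (.const 1)) fun x s => by
      have := hb x s.2
      simp; omega
  exact h.fst.reverse.prodMk h.snd

theorem parseMany_le {p : List Bool → β × List Bool} {B : ℕ}
    (hb : ∀ l, sz (p l).1 + sz (p l).2 ≤ sz l + B) (k : ℕ) (l : List Bool) :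
    sz (parseMany p k l).1 + sz (parseMany p k l).2 ≤ sz l + (k * (B + 1) + 1) := by
  induction k generalizing l with
  | zero => simp [parseMany]; omega
  | succ k ih =>
    have := ih (p l).2
    have := hb l
    simp only [parseMany_succ, sz_cons, Nat.add_mul]
    omega

end Parsing

/-! ## Descriptions of networks -/

/-- The description of a vertex: whether it is the source, whether it is a target, its labels, and
the capacities of the edges to the vertices. -/
abbrev Row : Type := Bool × Bool × List Bool × List (Option (List Bool))

/-- The description of a network: the number of vertices, the number of atomic propositions, and the
descriptions of the vertices. -/
abbrev NetCode : Type := ℕ × ℕ × List Row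

/-- The value of a word of binary digits, least significant first. -/
def bitsVal : List Bool → ℕ
  | [] => 0
  | b :: l => b.toNat + 2 * bitsVal l

theorem bitsVal_bits (n : ℕ) : bitsVal n.bits = n := by
  induction n using Nat.binaryRec' with
  | zero => rfl
  | bit b n h ih =>
    rw [Nat.bits_append_bit _ _ h, bitsVal, ih, Nat.bit_val]
    omega

theorem bits_bitsVal {l : List Bool} (h : l.reverse.headD true = true) : (bitsVal l).bits = l := by
  induction l with
  | nil => simp [bitsVal]
  | cons b l ih =>
    have hb : (bitsVal (b :: l)) = Nat.bit b (bitsVal l) := by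
      rw [Nat.bit_val, bitsVal]; omega
    have hl : l.reverse.headD true = true := by
      cases h' : l.reverse with
      | nil => rfl
      | cons c t => simpa [h'] using h
    rw [hb, Nat.bits_append_bit, ih hl]
    intro h0
    rw [← ih hl, h0] at h
    simpa using h

theorem bits_reverse_headD (n : ℕ) : n.bits.reverse.headD true = true := by
  induction n using Nat.binaryRec' with
  | zero => simp
  | bit b n h ih =>
    rw [Nat.bits_append_bit _ _ h, List.reverse_cons]
    cases h' : n.bits.reverse with
    | nil =>
      have : n.bits = [] := by simpa using h'
      have : n = 0 := by rw [← bitsVal_bits n, this]; rfl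
      simpa using h this
    | cons c t => simpa [h'] using ih

namespace NetCode

/-- The description of the vertex `u`. -/
def row (r : NetCode) (u : ℕ) : Row := r.2.2.getD u default

/-- Whether `u` is the source. -/
def isSource (r : NetCode) (u : ℕ) : Bool := (r.row u).1

/-- Whether `u` is a target. -/
def isTarget (r : NetCode) (u : ℕ) : Bool := (r.row u).2.1

/-- Whether `u` is labeled by `p`. -/
def label (r : NetCode) (u p : ℕ) : Bool := (r.row u).2.2.1.getD p false

/-- The capacity of the edge from `u` to `w`. -/
def cell (r : NetCode) (u w : ℕ) : Option (List Bool) := (r.row u).2.2.2.getD w none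

/-- Whether there is an edge from `u` to `w`. -/
def edge (r : NetCode) (u w : ℕ) : Bool := (r.cell u w).isSome

/-- The capacity of the edge from `u` to `w`, or `[]` if there is none. -/
def cap (r : NetCode) (u w : ℕ) : List Bool := (r.cell u w).getD []

@[fun_prop]
theorem _root_.FP.row {α : Type} [Enc α] {r : α → NetCode} {u : α → ℕ} (hr : FP r)
    (hu : FP u) : FP fun x => (r x).row (u x) := by
  unfold NetCode.row
  fun_prop

@[fun_prop]
theorem _root_.FP.isSource {α : Type} [Enc α] {r : α → NetCode} {u : α → ℕ} (hr : FP r)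
    (hu : FP u) : FP fun x => (r x).isSource (u x) := by
  unfold NetCode.isSource
  fun_prop

@[fun_prop]
theorem _root_.FP.isTarget {α : Type} [Enc α] {r : α → NetCode} {u : α → ℕ} (hr : FP r)
    (hu : FP u) : FP fun x => (r x).isTarget (u x) := by
  unfold NetCode.isTarget
  fun_prop

@[fun_prop]
theorem _root_.FP.label {α : Type} [Enc α] {r : α → NetCode} {u w : α → ℕ} (hr : FP r)
    (hu : FP u) (hw : FP w) : FP fun x => (r x).label (u x) (w x) := by
  unfold NetCode.label
  fun_prop

@[fun_prop]
theorem _root_.FP.cell {α : Type} [Enc α] {r : α → NetCode} {u w : α → ℕ} (hr : FP r)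
    (hu : FP u) (hw : FP w) : FP fun x => (r x).cell (u x) (w x) := by
  unfold NetCode.cell
  fun_prop

@[fun_prop]
theorem _root_.FP.edge {α : Type} [Enc α] {r : α → NetCode} {u w : α → ℕ} (hr : FP r)
    (hu : FP u) (hw : FP w) : FP fun x => (r x).edge (u x) (w x) := by
  unfold NetCode.edge
  fun_prop

@[fun_prop]
theorem _root_.FP.cap {α : Type} [Enc α] {r : α → NetCode} {u w : α → ℕ} (hr : FP r)
    (hu : FP u) (hw : FP w) : FP fun x => (r x).cap (u x) (w x) := by
  unfold NetCode.cap
  fun_prop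

/-- The code of an entry of the adjacency matrix. -/
def cellCode (o : Option (List Bool)) : List Bool :=
  bif o.isSome then true :: (o.getD []).flatMap (fun b => [true, b]) ++ [false] else [false]

/-- The code of the description of a vertex. -/
def rowCode (a : Row) : List Bool :=
  a.1 :: a.2.1 :: a.2.2.1 ++ a.2.2.2.flatMap cellCode

/-- The code of the description of a network. -/
def code (r : NetCode) : List Bool :=
  unaryCode r.1 ++ unaryCode r.2.1 ++ r.2.2.flatMap rowCode

/-- The lists in a description have the right lengths. -/
def WellFormed (r : NetCode) : Prop :=
  r.2.2.length = r.1 ∧ ∀ a ∈ r.2.2, a.2.2.1.length = r.2.1 ∧ a.2.2.2.length = r.1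

end NetCode

open NetCode

/-- Parse a bit. -/
def parseBit (l : List Bool) : Bool × List Bool := (l.headD false, l.tail)

/-- Parse an entry of the adjacency matrix. -/
def parseCell (l : List Bool) : Option (List Bool) × List Bool :=
  bif l.headD false then (some (parsePair l.tail).1, (parsePair l.tail).2) else (none, l.tail)

/-- Parse the description of a vertex. -/
def parseRow (n m : ℕ) (l : List Bool) : Row × List Bool :=
  let a := parseMany parseBit m l.tail.tail
  let b := parseMany parseCell n a.2
  ((l.headD false, l.tail.headD false, a.1, b.1), b.2)

/-- Parse the description of a network. -/
def parse (l : List Bool) : NetCode :=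
  let a := parseUnary l
  let b := parseUnary a.2
  (a.1, b.1, (parseMany (parseRow a.1 b.1) a.1 b.2).1)

theorem parseBit_code (b : Bool) (r : List Bool) : parseBit ([b] ++ r) = (b, r) := rfl

theorem parseCell_code (o : Option (List Bool)) (r : List Bool) :
    parseCell (cellCode o ++ r) = (o, r) := by
  cases o with
  | none => rfl
  | some x =>
    have := parsePair_code x r
    simp only [pairCode] at this
    simp [cellCode, parseCell, this]

theorem parseRow_code {n m : ℕ} {a : Row} (hm : a.2.2.1.length = m) (hn : a.2.2.2.length = n)
    (r : List Bool) : parseRow n m (rowCode a ++ r) = (a, r) := by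
  obtain ⟨s, t, l, c⟩ := a
  subst hm hn
  have h₁ := parseMany_code (p := parseBit) (code := fun b => [b]) l
    (fun b _ r => parseBit_code b r) (c.flatMap cellCode ++ r)
  have h₂ := parseMany_code (p := parseCell) (code := cellCode) c
    (fun b _ r => parseCell_code b r) r
  have hl : l.flatMap (fun b => [b]) = l := by simp
  rw [hl] at h₁
  simp [parseRow, rowCode, h₁, h₂]

theorem parse_code {r : NetCode} (h : r.WellFormed) : parse r.code = r := by
  obtain ⟨n, m, l⟩ := r
  obtain ⟨h₁, h₂⟩ := h
  simp only at h₁ h₂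
  have h₃ := parseMany_code (p := parseRow n m) (code := rowCode) l
    (fun a ha r => parseRow_code (h₂ a ha).1 (h₂ a ha).2 r) []
  rw [h₁, List.append_nil] at h₃
  simp only [parse, code, List.append_assoc, parseUnary_code, h₃]

theorem wellFormed_parse (x : List Bool) : (parse x).WellFormed := by
  refine ⟨length_parseMany _ _ _, forall_mem_parseMany (fun l => ?_) _ _⟩
  exact ⟨length_parseMany _ _ _, length_parseMany _ _ _⟩

@[fun_prop]
theorem FP.parseBit : FP parseBit := by unfold _root_.parseBit; fun_prop

@[fun_prop]
theorem FP.parseCell : FP parseCell := by unfold _root_.parseCell; fun_prop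

theorem sz_tail_le {α : Type} [Enc α] (l : List α) : sz l.tail ≤ sz l :=
  sz_le_of_sublist (List.tail_sublist _)

theorem parseBit_le (l : List Bool) : sz (parseBit l).1 + sz (parseBit l).2 ≤ sz l + 3 := by
  have := sz_tail_le l
  have := sz_bool_le (l.headD false)
  simp only [parseBit]; omega

theorem parseCell_le (l : List Bool) : sz (parseCell l).1 + sz (parseCell l).2 ≤ sz l + 3 := by
  have := sz_tail_le l
  have := parsePair_le l.tail
  cases h : l.headD false <;> simp only [parseCell, h, cond_true, cond_false, sz_none, sz_some] <;>
    omega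

theorem parseRow_le (n m : ℕ) (l : List Bool) : sz (parseRow n m l).1 + sz (parseRow n m l).2 ≤
    sz l + ((m * 4 + 1) + (n * 4 + 1) + 9) := by
  have h₁ := parseMany_le parseBit_le m l.tail.tail
  have h₂ := parseMany_le parseCell_le n (parseMany parseBit m l.tail.tail).2
  have := sz_tail_le l
  have := sz_tail_le l.tail
  have := sz_bool_le (l.headD false)
  have := sz_bool_le (l.tail.headD false)
  simp only [parseRow, sz_prod]
  omega

@[fun_prop]
theorem FP.parseRow {α : Type} [Enc α] {n m : α → ℕ} {l : α → List Bool} (hn : FP n) (hm : FP m)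
    (hl : FP l) : FP fun x => parseRow (n x) (m x) (l x) := by
  have h₁ : FP fun x => _root_.parseMany _root_.parseBit (m x) (l x).tail.tail :=
    _root_.FP.parseMany (by fun_prop) hm (by fun_prop) (.const 3) fun _ => parseBit_le
  have h₂ : FP fun x => _root_.parseMany _root_.parseCell (n x)
      (_root_.parseMany _root_.parseBit (m x) (l x).tail.tail).2 :=
    _root_.FP.parseMany (by fun_prop) hn h₁.snd (.const 3) fun _ => parseCell_le
  exact (FP.prodMk (hl.headD (.const false)) (FP.prodMk (hl.tail.headD (.const false))
    (h₁.fst.prodMk h₂.fst))).prodMk h₂.snd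

@[fun_prop]
theorem FP.parse : FP parse := by
  have h : FP fun x => _root_.parseMany
      (_root_.parseRow (_root_.parseUnary x).1 (_root_.parseUnary (_root_.parseUnary x).2).1)
      (_root_.parseUnary x).1 (_root_.parseUnary (_root_.parseUnary x).2).2 := by
    have h₁ : FP fun x => (_root_.parseUnary x).1 := by fun_prop
    have h₂ : FP fun x => (_root_.parseUnary (_root_.parseUnary x).2).1 := by fun_prop
    refine FP.parseMany (by fun_prop) h₁ (by fun_prop)
      (B := fun x => 2 * sz (_root_.parseUnary (_root_.parseUnary x).2).1 +
        2 * sz (_root_.parseUnary x).1 + 11)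
      ((((PB.const 2).mul h₂.pb).add ((PB.const 2).mul h₁.pb)).add (.const 11)) fun x l => ?_
    refine (parseRow_le _ _ l).trans ?_
    simp only [sz_nat]
    omega
  exact FP.prodMk (by fun_prop) (FP.prodMk (by fun_prop) h.fst)

@[fun_prop]
theorem FP.unaryCode : FP unaryCode := by
  have h : FP fun n : ℕ => (List.range n).map (fun _ => true) ++ [false] := by fun_prop
  convert h using 2 with n
  simp [_root_.unaryCode, List.map_const']

@[fun_prop]
theorem FP.code : FP NetCode.code := by
  have h : FP cellCode := by unfold cellCode; fun_prop
  have h' : FP rowCode := by unfold rowCode; fun_prop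
  unfold NetCode.code
  fun_prop

/-! ## Descriptions of networks and networks -/

theorem list_eq_map_getD {α : Type} (l : List α) (d : α) :
    l = (List.range l.length).map fun i => l.getD i d := by
  refine List.ext_getElem (by simp) fun i h₁ h₂ => ?_
  simp [List.getD_eq_getElem?_getD, h₁]

theorem map_finRange {α : Type} (n : ℕ) (f : ℕ → α) :
    (List.finRange n).map (fun v : Fin n => f v) = (List.range n).map f := by
  rw [← List.map_coe_finRange_eq_range, List.map_map]
  rfl

theorem getD_map_finRange {α : Type} {n : ℕ} (f : Fin n → α) (v : Fin n) (d : α) :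
    ((List.finRange n).map f).getD v d = f v := by
  simp [List.getD_eq_getElem?_getD]

namespace FlowNetwork

variable {n : ℕ} (N : FlowNetwork ℕ (Fin n)) (m : ℕ)

/-- The description of a network. -/
def netCode : NetCode :=
  (n, m, (List.finRange n).map fun v => (decide (v = N.s), decide (v ∈ N.T),
    (List.range m).map fun p => decide (p ∈ N.ρ v),
    (List.finRange n).map fun w => if h : (v, w) ∈ N.E then some (N.c ⟨(v, w), h⟩).bits else none))

theorem code_netCode : (N.netCode m).code = N.encode m := by
  simp only [NetCode.code, netCode, encode, List.flatMap_map, NetCode.rowCode]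
  congr 2
  funext v
  simp only [List.cons_append]
  congr 5
  funext w
  split
  · simp [NetCode.cellCode, binaryCode]
  · rfl

theorem wellFormed_netCode : (N.netCode m).WellFormed :=
  ⟨by simp [netCode], by simp [netCode]⟩

theorem parse_encode : parse (N.encode m) = N.netCode m := by
  rw [← code_netCode, parse_code (N.wellFormed_netCode m)]

variable (u v : Fin n)

theorem isSource_netCode : (N.netCode m).isSource v = decide (v = N.s) := by
  rw [NetCode.isSource, NetCode.row, netCode, getD_map_finRange]

theorem isTarget_netCode : (N.netCode m).isTarget v = decide (v ∈ N.T) := by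
  rw [NetCode.isTarget, NetCode.row, netCode, getD_map_finRange]

theorem label_netCode {m : ℕ} (hm : N.AP = Finset.range m) (p : ℕ) :
    (N.netCode m).label v p = decide (p ∈ N.ρ v) := by
  rw [NetCode.label, NetCode.row, netCode, getD_map_finRange]
  by_cases hp : p < m
  · simp [List.getD_eq_getElem?_getD, hp]
  · have : p ∉ N.ρ v := fun h => hp (Finset.mem_range.1 (hm ▸ N.label_subset v h))
    simp [List.getD_eq_getElem?_getD, hp, this]

theorem cell_netCode : (N.netCode m).cell u v =
    if h : (u, v) ∈ N.E then some (N.c ⟨(u, v), h⟩).bits else none := by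
  rw [NetCode.cell, NetCode.row, netCode, getD_map_finRange, getD_map_finRange]

theorem edge_netCode : (N.netCode m).edge u v = decide ((u, v) ∈ N.E) := by
  rw [NetCode.edge, cell_netCode]
  split <;> simp [*]

theorem cap_netCode (h : (u, v) ∈ N.E) : (N.netCode m).cap u v = (N.c ⟨(u, v), h⟩).bits := by
  rw [NetCode.cap, cell_netCode, dif_pos h]
  rfl

end FlowNetwork

namespace NetCode

/-- The description of a network has the properties required of flow networks. -/
def valid (r : NetCode) : Bool :=
  ((List.range r.1).any fun s => (List.range r.1).all fun u => decide (r.isSource u = decide (u = s))) &&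
  ((List.range r.1).all fun u => !(r.isSource u && r.isTarget u)) &&
  ((List.range r.1).all fun u => (List.range r.1).all fun w => !r.edge u w ||
    (!r.isTarget u && !r.isSource w && (r.cap u w).reverse.headD true)) &&
  ((List.range r.1).all fun u => !r.isTarget u ||
    (reach (List.range r.1) r.isSource r.edge).any fun w => decide (w = u)) &&
  ((List.range r.1).all fun u =>
    (reach (List.range r.1) r.isTarget fun w w' => r.edge w' w).any fun w => decide (w = u))

@[fun_prop]
theorem _root_.FP.valid : FP valid := by
  unfold NetCode.valid
  fun_prop

variable {r : NetCode}

theorem WellFormed.eq (h : r.WellFormed) : r = (r.1, r.2.1, (List.range r.1).map fun u =>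
    (r.isSource u, r.isTarget u, (List.range r.2.1).map (r.label u),
      (List.range r.1).map (r.cell u))) := by
  obtain ⟨h₁, h₂⟩ := h
  refine Prod.ext rfl (Prod.ext rfl ?_)
  simp only
  rw [← h₁]
  conv_lhs => rw [list_eq_map_getD r.2.2 default]
  refine List.map_congr_left fun u hu => ?_
  have hu : u < r.2.2.length := by simpa using hu
  have hmem : r.row u ∈ r.2.2 := by
    rw [row, List.getD_eq_getElem _ _ hu]
    exact List.getElem_mem _
  obtain ⟨h₃, h₄⟩ := h₂ _ hmem
  change r.row u = _
  refine Prod.ext rfl (Prod.ext rfl (Prod.ext ?_ ?_))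
  · simp only
    rw [← h₃]
    exact list_eq_map_getD _ _
  · simp only
    rw [h₁, ← h₄]
    exact list_eq_map_getD _ _

theorem valid_iff : r.valid = true ↔
    (∃ s < r.1, ∀ u < r.1, r.isSource u = decide (u = s)) ∧
    (∀ u < r.1, r.isSource u = true → r.isTarget u = false) ∧
    (∀ u < r.1, ∀ w < r.1, r.edge u w = true → r.isTarget u = false ∧ r.isSource w = false ∧
      (r.cap u w).reverse.headD true = true) ∧
    (∀ u < r.1, r.isTarget u = true → u ∈ reach (List.range r.1) r.isSource r.edge) ∧
    ∀ u < r.1, u ∈ reach (List.range r.1) r.isTarget fun w w' => r.edge w' w := by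
  have h : ∀ a b : Bool, (!(a && b)) = true ↔ (a = true → b = false) := by decide
  have h' : ∀ a b : Bool, (!a || b) = true ↔ (a = true → b = true) := by decide
  unfold valid
  simp only [h, h', Bool.and_eq_true, List.any_eq_true, List.all_eq_true, List.mem_range,
    decide_eq_true_eq, exists_eq_right, Bool.not_eq_true', and_assoc]

theorem exists_netCode (h : r.WellFormed) (hv : r.valid = true) :
    ∃ N : FlowNetwork ℕ (Fin r.1), N.AP = Finset.range r.2.1 ∧ N.netCode r.2.1 = r := by
  obtain ⟨⟨s, hs, hsrc⟩, hst, hedge, hreach, hreach'⟩ := valid_iff.1 hv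
  have hE : ∀ e : Fin r.1 × Fin r.1, e ∈ Finset.univ.filter
      (fun e : Fin r.1 × Fin r.1 => r.edge e.1 e.2 = true) ↔ r.edge e.1 e.2 = true := by simp
  have hsource : ∀ u : Fin r.1, r.isSource u = decide (u = ⟨s, hs⟩) := fun u => by
    rw [hsrc u u.2]; simp [Fin.ext_iff]
  have sourceTrue : r.isSource s = true := by rw [hsrc s hs]; simp
  let N : FlowNetwork ℕ (Fin r.1) :=
    { AP := Finset.range r.2.1
      E := Finset.univ.filter fun e => r.edge e.1 e.2 = true
      c := fun e => bitsVal (r.cap e.1.1 e.1.2)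
      ρ := fun v => (Finset.range r.2.1).filter fun p => r.label v p = true
      s := ⟨s, hs⟩
      T := Finset.univ.filter fun v => r.isTarget v = true
      label_subset := fun v => Finset.filter_subset _ _
      source_notMem := by simp [hst s hs sourceTrue]
      edge_fst_notMem := fun e he => by
        simp [(hedge _ e.1.2 _ e.2.2 ((hE e).1 he)).1]
      edge_snd_ne := fun e he h => by
        have := (hedge _ e.1.2 _ e.2.2 ((hE e).1 he)).2.1
        rw [h, sourceTrue] at this
        exact absurd this (by simp)
      target_reachable := fun t ht => by
        have := reach_induction (nodes := List.range r.1) (init := r.isSource) (edge := r.edge)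
          (p := fun b => ∃ hb : b < r.1, Relation.ReflTransGen (fun u w : Fin r.1 => (u, w) ∈
            Finset.univ.filter (fun e : Fin r.1 × Fin r.1 => r.edge e.1 e.2 = true))
            ⟨s, hs⟩ ⟨b, hb⟩)
          (fun b hb hi => ⟨List.mem_range.1 hb, by
            rw [hsrc b (List.mem_range.1 hb), decide_eq_true_eq] at hi
            subst hi
            exact .refl⟩)
          (fun a b hb ⟨ha, h⟩ he => ⟨List.mem_range.1 hb, h.tail ((hE (⟨a, ha⟩, _)).2 he)⟩)
          t (hreach t t.2 (by simpa using ht))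
        exact this.2
      reaches_target := fun v => by
        have := reach_induction (nodes := List.range r.1) (init := r.isTarget)
          (edge := fun w w' => r.edge w' w)
          (p := fun b => ∃ hb : b < r.1, ∃ t ∈ Finset.univ.filter
            (fun v : Fin r.1 => r.isTarget v = true),
            Relation.ReflTransGen (fun u w : Fin r.1 => (u, w) ∈
            Finset.univ.filter (fun e : Fin r.1 × Fin r.1 => r.edge e.1 e.2 = true)) ⟨b, hb⟩ t)
          (fun b hb hi => ⟨List.mem_range.1 hb, ⟨b, List.mem_range.1 hb⟩, by simpa using hi, .refl⟩)
          (fun a b hb ⟨ha, t, ht, h⟩ he => ⟨List.mem_range.1 hb, t, ht,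
            .head ((hE (_, ⟨a, ha⟩)).2 he) h⟩)
          v (hreach' v v.2)
        exact this.2 }
  refine ⟨N, rfl, ?_⟩
  conv_rhs => rw [h.eq]
  refine Prod.ext rfl (Prod.ext rfl ?_)
  simp only [FlowNetwork.netCode]
  rw [← map_finRange]
  refine List.map_congr_left fun v _ => ?_
  refine Prod.ext ?_ (Prod.ext ?_ (Prod.ext ?_ ?_))
  · exact (hsource v).symm
  · simp [N]
  · refine List.map_congr_left fun p hp => ?_
    have hp := List.mem_range.1 hp
    simp [N, hp]
  · simp only
    rw [← map_finRange]
    refine List.map_congr_left fun w _ => ?_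
    by_cases he : r.edge v w = true
    · have he' := (hE (v, w)).2 he
      have hc := (hedge v v.2 w w.2 he).2.2
      rw [dif_pos he']
      change some (bitsVal (r.cap v w)).bits = _
      rw [bits_bitsVal hc, cap]
      rw [edge, Option.isSome_iff_exists] at he
      obtain ⟨x, hx⟩ := he
      rw [hx]
      rfl
    · rw [dif_neg (mt (hE (v, w)).1 he)]
      simpa [edge] using (Option.not_isSome_iff_eq_none.1 he).symm

end NetCode

theorem FlowNetwork.valid_netCode {n m : ℕ} (N : FlowNetwork ℕ (Fin n)) :
    (N.netCode m).valid = true := by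
  refine NetCode.valid_iff.2 ⟨⟨N.s, N.s.2, fun u hu => ?_⟩, fun u hu h => ?_, fun u hu w hw h => ?_,
    fun u hu h => ?_, fun u hu => ?_⟩
  all_goals lift u to Fin n using hu
  · rw [N.isSource_netCode]; simp [Fin.ext_iff]
  · rw [N.isSource_netCode, decide_eq_true_eq] at h
    rw [N.isTarget_netCode, h]
    simpa using N.source_notMem
  · lift w to Fin n using hw
    rw [N.edge_netCode, decide_eq_true_eq] at h
    rw [N.isTarget_netCode, N.isSource_netCode, N.cap_netCode _ _ _ h]
    exact ⟨by simpa using N.edge_fst_notMem _ h, by simpa using N.edge_snd_ne _ h,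
      bits_reverse_headD _⟩
  · rw [N.isTarget_netCode, decide_eq_true_eq] at h
    have h' := N.target_reachable u h
    clear h
    induction h' with
    | refl => exact mem_reach.2 ⟨by simp [netCode], .inl (by rw [N.isSource_netCode]; simp)⟩
    | @tail b c _ h' ih => exact mem_reach.2 ⟨by simp [netCode], .inr ⟨b, ih, by
        rw [N.edge_netCode]; simpa using h'⟩⟩
  · obtain ⟨t, ht, h⟩ := N.reaches_target u
    induction h using Relation.ReflTransGen.head_induction_on with
    | refl => exact mem_reach.2 ⟨by simp [netCode], .inl (by rw [N.isTarget_netCode]; simpa using ht)⟩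
    | @head b c h' _ ih => exact mem_reach.2 ⟨by simp [netCode], .inr ⟨c, ih, by
        rw [N.edge_netCode]; simpa using h'⟩⟩

/-- The word describes a flow network. -/
def isNetwork (x : List Bool) : Bool := decide ((parse x).code = x) && (parse x).valid

@[fun_prop]
theorem FP.isNetwork : FP isNetwork := by unfold _root_.isNetwork; fun_prop

theorem isNetwork_iff {x : List Bool} : isNetwork x = true ↔
    ∃ (n m : ℕ) (N : FlowNetwork ℕ (Fin n)), N.AP = Finset.range m ∧ x = N.encode m := by
  simp only [isNetwork, Bool.and_eq_true, decide_eq_true_eq]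
  constructor
  · rintro ⟨h₁, h₂⟩
    obtain ⟨N, hN, h⟩ := NetCode.exists_netCode (wellFormed_parse x) h₂
    exact ⟨_, _, N, hN, by rw [← N.code_netCode, h, h₁]⟩
  · rintro ⟨n, m, N, hN, rfl⟩
    rw [N.parse_encode]
    exact ⟨N.code_netCode m, N.valid_netCode⟩

/-! ## Binary arithmetic -/

theorem bitsVal_headD_tail (l : List Bool) :
    bitsVal l = (l.headD false).toNat + 2 * bitsVal l.tail := by
  cases l <;> rfl

/-- One step of the addition of binary numbers: the digit, the remaining digits, and the carry. -/
def addStep (z : List Bool × List Bool × Bool) : Bool × List Bool × List Bool × Bool :=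
  let a := z.1.headD false
  let b := z.2.1.headD false
  (xor (xor a b) z.2.2, z.1.tail, z.2.1.tail, (a && b) || (a && z.2.2) || (b && z.2.2))

theorem addStep_le (z : List Bool × List Bool × Bool) :
    sz (addStep z).1 + sz (addStep z).2 ≤ sz z + 6 := by
  have h := fun b : Bool => sz_bool_le b
  have h₁ := sz_tail_le z.1
  have h₂ := sz_tail_le z.2.1
  simp only [addStep, sz_prod]
  have h₃ := h (xor (xor (z.1.headD false) (z.2.1.headD false)) z.2.2)
  have h₄ := h ((z.1.headD false && z.2.1.headD false) || (z.1.headD false && z.2.2) ||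
    (z.2.1.headD false && z.2.2))
  omega

/-- Addition of binary numbers. -/
def addBits (x y : List Bool) : List Bool :=
  (parseMany addStep (x.length + y.length + 1) (x, y, false)).1

theorem bitsVal_addBits (x y : List Bool) : bitsVal (addBits x y) = bitsVal x + bitsVal y := by
  have key : ∀ k (x y : List Bool) c, x.length < k → y.length < k →
      bitsVal (parseMany addStep k (x, y, c)).1 = bitsVal x + bitsVal y + c.toNat := by
    intro k
    induction k with
    | zero => simp
    | succ k ih =>
      intro x y c hx hy
      rw [parseMany_succ, bitsVal]
      cases k with
      | zero =>
        obtain rfl : x = [] := List.length_eq_zero_iff.1 (by omega)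
        obtain rfl : y = [] := List.length_eq_zero_iff.1 (by omega)
        cases c <;> rfl
      | succ k =>
        simp only [addStep]
        rw [ih _ _ _ (by simp; omega) (by simp; omega), bitsVal_headD_tail x, bitsVal_headD_tail y]
        cases x.headD false <;> cases y.headD false <;> cases c <;> simp <;> omega
  rw [addBits, key _ x y false (by omega) (by omega)]
  rfl

@[fun_prop]
theorem FP.addBits {α : Type} [Enc α] {x y : α → List Bool} (hx : FP x) (hy : FP y) :
    FP fun a => addBits (x a) (y a) := by
  have h : FP addStep := by unfold addStep; fun_prop
  have h' : FP fun a => _root_.parseMany addStep ((x a).length + (y a).length + 1)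
      (x a, y a, false) :=
    FP.parseMany (by fun_prop) (by fun_prop) (by fun_prop) (.const 6) fun _ => addStep_le
  exact h'.fst

/-- Comparison of binary numbers. -/
def leBits (x y : List Bool) : Bool :=
  ((fun z : List Bool × List Bool × Bool => (z.1.tail, z.2.1.tail,
    (!z.1.headD false && z.2.1.headD false) ||
      (!(xor (z.1.headD false) (z.2.1.headD false)) && z.2.2)))^[x.length + y.length]
    (x, y, true)).2.2

theorem leBits_eq (x y : List Bool) : leBits x y = decide (bitsVal x ≤ bitsVal y) := by
  have key : ∀ k (x y : List Bool) c, x.length ≤ k → y.length ≤ k →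
      ((fun z : List Bool × List Bool × Bool => (z.1.tail, z.2.1.tail,
        (!z.1.headD false && z.2.1.headD false) ||
          (!(xor (z.1.headD false) (z.2.1.headD false)) && z.2.2)))^[k] (x, y, c)).2.2 =
      decide (bitsVal x < bitsVal y ∨ bitsVal x = bitsVal y ∧ c = true) := by
    intro k
    induction k with
    | zero =>
      intro x y c hx hy
      obtain rfl : x = [] := List.length_eq_zero_iff.1 (by omega)
      obtain rfl : y = [] := List.length_eq_zero_iff.1 (by omega)
      simp
    | succ k ih =>
      intro x y c hx hy
      rw [Function.iterate_succ_apply, ih _ _ _ (by simp; omega) (by simp; omega),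
        bitsVal_headD_tail x, bitsVal_headD_tail y, decide_eq_decide]
      cases x.headD false <;> cases y.headD false <;> cases c <;>
        simp only [Bool.toNat_false, Bool.toNat_true, Bool.not_false, Bool.not_true, Bool.and_false,
          Bool.and_true, Bool.or_false, Bool.or_true, Bool.xor_false, Bool.xor_true,
          Bool.false_eq_true, and_true, and_false, or_false] <;> omega
  rw [leBits, key _ x y true (by omega) (by omega)]
  simp only [and_true, decide_eq_decide]
  omega

/-- The sum of a list of binary numbers. -/
def sumBits (l : List (List Bool)) : List Bool := l.foldl addBits []

theorem bitsVal_sumBits (l : List (List Bool)) : bitsVal (sumBits l) = (l.map bitsVal).sum := by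
  have key : ∀ s, bitsVal (l.foldl addBits s) = bitsVal s + (l.map bitsVal).sum := by
    induction l with
    | nil => simp
    | cons x l ih => intro s; simp [ih, bitsVal_addBits, Nat.add_assoc]
  rw [sumBits, key, bitsVal, Nat.zero_add]

theorem length_addBits (x y : List Bool) : (addBits x y).length = x.length + y.length + 1 :=
  length_parseMany _ _ _

@[fun_prop]
theorem FP.leBits {α : Type} [Enc α] {x y : α → List Bool} (hx : FP x) (hy : FP y) :
    FP fun a => leBits (x a) (y a) := by
  have h := FP.iterate_of_le_add (n := fun a => (x a).length + (y a).length)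
    (g := fun a => (x a, y a, true))
    (h := fun _ (z : List Bool × List Bool × Bool) => (z.1.tail, z.2.1.tail,
      (!z.1.headD false && z.2.1.headD false) ||
        (!(Bool.xor (z.1.headD false) (z.2.1.headD false)) && z.2.2)))
    (B := fun _ => 3) (by fun_prop) (by fun_prop) (by fun_prop) (.const 3) fun _ z => by
      have := sz_tail_le z.1
      have := sz_tail_le z.2.1
      simp only [sz_prod]
      have := sz_bool_le ((!z.1.headD false && z.2.1.headD false) ||
        (!(Bool.xor (z.1.headD false) (z.2.1.headD false)) && z.2.2))
      omega
  exact h.snd.snd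

@[fun_prop]
theorem FP.sumBits : FP sumBits := by
  have key : ∀ (L : ℕ) (l : List (List Bool)) s, (∀ b ∈ l, b.length ≤ L) →
      (l.foldl _root_.addBits s).length ≤ s.length + l.length * (L + 1) := by
    intro L l
    induction l with
    | nil => simp
    | cons b l ih =>
      intro s h
      have := ih (_root_.addBits s b) fun b hb => h b (List.mem_cons_of_mem _ hb)
      have := h b List.mem_cons_self
      rw [List.foldl_cons, List.length_cons, Nat.add_mul]
      rw [length_addBits] at *
      omega
  have h := FPQ.foldl (c := 0) (𝒪 := Set.univ) (l := fun l : List (List Bool) => l)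
    (h := fun _ s b => _root_.addBits s b) (g := fun _ => [])
    (B := fun l => 4 * (sz l * (sz l + 1)) + 1)
    (show FP fun z : List (List Bool) × List Bool × List Bool => _root_.addBits z.2.1 z.2.2 by fun_prop)
    (by fun_prop) (by fun_prop)
    (((PB.const 4).mul (PB.size.mul (PB.size.add (.const 1)))).add (.const 1)) fun l l₁ hl => by
      refine (sz_list_bool_le _).trans ?_
      have h₁ := key (sz l) l₁ [] fun b hb =>
        (length_le_sz b).trans (sz_le_of_mem (hl.subset hb))
      have h₂ : l₁.length * (sz l + 1) ≤ sz l * (sz l + 1) :=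
        Nat.mul_le_mul_right _ (hl.length_le.trans (length_le_sz l))
      rw [List.length_nil] at h₁
      change 4 * (l₁.foldl _root_.addBits []).length + 1 ≤ _
      omega
  simp only [mul_zero] at h
  exact h

/-! ## Evaluation of formulas -/

instance : DecidableEq BinTree := fun a b =>
  decidable_of_iff (a.ser = b.ser) BinTree.ser_injective.eq_iff

instance : Inhabited BinTree := ⟨.leaf⟩

/-- The data for the evaluation of a formula: the description of the network, the description of a
network whose capacities are the values of a flow, and, for each flow quantifier, the list of the
truth values at the vertices. -/
abbrev Env : Type := NetCode × NetCode × List (List Bool)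

namespace Env

/-- The value of the flow on the edge from `u` to `w`. -/
def flowVal (e : Env) (u w : ℕ) : List Bool := bif e.1.edge u w then e.2.1.cap u w else []

/-- The total flow on the edges that enter `u`. -/
def inflow (e : Env) (u : ℕ) : List Bool := sumBits ((List.range e.1.1).map fun w => e.flowVal w u)

/-- The total flow on the edges that leave `u`. -/
def outflow (e : Env) (u : ℕ) : List Bool := sumBits ((List.range e.1.1).map fun w => e.flowVal u w)

/-- The flow through `u`. -/
def through (e : Env) (u : ℕ) : List Bool := bif e.1.isSource u then e.outflow u else e.inflow u

/-- The values on the edges form a flow. -/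
def isFlow (e : Env) : Bool :=
  ((List.range e.1.1).all fun u => (List.range e.1.1).all fun w =>
    leBits (e.flowVal u w) (e.1.cap u w)) &&
  ((List.range e.1.1).all fun u => e.1.isSource u || e.1.isTarget u ||
    (leBits (e.inflow u) (e.outflow u) && leBits (e.outflow u) (e.inflow u)))

section

variable {α : Type} [Enc α] {e : α → Env} {u w : α → ℕ}

@[fun_prop]
theorem _root_.FP.flowVal (he : FP e) (hu : FP u) (hw : FP w) :
    FP fun x => (e x).flowVal (u x) (w x) := by
  unfold Env.flowVal
  fun_prop

@[fun_prop]
theorem _root_.FP.inflow (he : FP e) (hu : FP u) : FP fun x => (e x).inflow (u x) := by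
  unfold Env.inflow
  fun_prop

@[fun_prop]
theorem _root_.FP.outflow (he : FP e) (hu : FP u) : FP fun x => (e x).outflow (u x) := by
  unfold Env.outflow
  fun_prop

@[fun_prop]
theorem _root_.FP.through (he : FP e) (hu : FP u) : FP fun x => (e x).through (u x) := by
  unfold Env.through
  fun_prop

@[fun_prop]
theorem _root_.FP.isFlow : FP isFlow := by
  unfold Env.isFlow
  fun_prop

end

end Env

/-- The memory that a path formula may need about the suffixes of a path. -/
def PathFormula.memories : PathFormula ℕ → List BinTree
  | .state _ => [.leaf]
  | .neg ψ => ψ.memories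
  | .disj ψ₁ ψ₂ => ψ₁.memories.flatMap fun m => ψ₂.memories.map fun m' => .node m m'
  | .next ψ => ψ.memories.flatMap fun m => [.node (enc false) m, .node (enc true) m]
  | .until ψ₁ ψ₂ => ψ₁.memories.flatMap fun m => ψ₂.memories.flatMap fun m' =>
      [.node (enc false) (.node m m'), .node (enc true) (.node m m')]

/-- All pairs of a vertex, a truth value and a memory. -/
def pathNodes (ψ : PathFormula ℕ) (n : ℕ) : List (ℕ × Bool × BinTree) :=
  (List.range n).flatMap fun u =>
    (ψ.memories.flatMap fun m => [(false, m), (true, m)]).map fun t => (u, t)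

/-- The vertices with the truth values and the memories of the paths to the targets, if `ev`
computes them along a path. -/
def pathTypes (ψ : PathFormula ℕ) (ev : Env × ℕ × BinTree → Bool × BinTree) (e : Env) :
    List (ℕ × Bool × BinTree) :=
  reach (pathNodes ψ e.1.1) (fun b => e.1.isTarget b.1 && decide (b.2 = ev (e, b.1, .leaf)))
    fun a b => e.1.edge b.1 a.1 && decide (b.2 = ev (e, b.1, a.2.2))

mutual

/-- The truth value of a state formula at a vertex. The flow quantifiers in it are numbered from
`k` on. -/
def StateFormula.eval : StateFormula ℕ → ℕ → Env × ℕ → Bool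
  | .atom p, _ => fun z => z.1.1.label z.2 p
  | .flowGt γ, _ => fun z => leBits (γ + 1).bits (z.1.through z.2)
  | .flowGe γ, _ => fun z => leBits γ.bits (z.1.through z.2)
  | .neg φ, k => fun z => !φ.eval k z
  | .disj φ₁ φ₂, k => fun z => φ₁.eval k z || φ₂.eval (k + φ₁.numFlowQuantifiers) z
  | .allPaths ψ, k => fun z => (pathTypes ψ (ψ.eval k) z.1).all fun t => !decide (t.1 = z.2) || t.2.1
  | .allFlows φ, k => fun z => (z.1.2.2.getD (k + φ.numFlowQuantifiers) []).getD z.2 false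

/-- The truth value and the memory of a path, computed from its first vertex and the memory of the
rest. -/
def PathFormula.eval : PathFormula ℕ → ℕ → Env × ℕ × BinTree → Bool × BinTree
  | .state φ, k => fun z => (φ.eval k (z.1, z.2.1), .leaf)
  | .neg ψ, k => fun z => (!(ψ.eval k z).1, (ψ.eval k z).2)
  | .disj ψ₁ ψ₂, k => fun z =>
    ((ψ₁.eval k (z.1, z.2.1, z.2.2.hd)).1 ||
      (ψ₂.eval (k + ψ₁.numFlowQuantifiers) (z.1, z.2.1, z.2.2.tl)).1,
     .node (ψ₁.eval k (z.1, z.2.1, z.2.2.hd)).2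
      (ψ₂.eval (k + ψ₁.numFlowQuantifiers) (z.1, z.2.1, z.2.2.tl)).2)
  | .next ψ, k => fun z => (z.2.2.hd.isNode,
      .node (enc (ψ.eval k (z.1, z.2.1, z.2.2.tl)).1) (ψ.eval k (z.1, z.2.1, z.2.2.tl)).2)
  | .until ψ₁ ψ₂, k => fun z =>
    ((ψ₂.eval (k + ψ₁.numFlowQuantifiers) (z.1, z.2.1, z.2.2.tl.tl)).1 ||
      ((ψ₁.eval k (z.1, z.2.1, z.2.2.tl.hd)).1 && z.2.2.hd.isNode),
     .node (enc ((ψ₂.eval (k + ψ₁.numFlowQuantifiers) (z.1, z.2.1, z.2.2.tl.tl)).1 ||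
      ((ψ₁.eval k (z.1, z.2.1, z.2.2.tl.hd)).1 && z.2.2.hd.isNode)))
      (.node (ψ₁.eval k (z.1, z.2.1, z.2.2.tl.hd)).2
        (ψ₂.eval (k + ψ₁.numFlowQuantifiers) (z.1, z.2.1, z.2.2.tl.tl)).2))

end

theorem FP.pathTypes (ψ : PathFormula ℕ) {ev : Env × ℕ × BinTree → Bool × BinTree} (h : FP ev) :
    FP (pathTypes ψ ev) := by
  have h' : FP fun e : Env => pathNodes ψ e.1.1 := by unfold pathNodes; fun_prop
  unfold _root_.pathTypes
  fun_prop

attribute [fun_prop] FP.encode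

mutual

@[fun_prop]
theorem StateFormula.fp_eval : (φ : StateFormula ℕ) → (k : ℕ) → FP (φ.eval k)
  | .atom p, _ => by unfold StateFormula.eval; fun_prop
  | .flowGt γ, _ => by unfold StateFormula.eval; fun_prop
  | .flowGe γ, _ => by unfold StateFormula.eval; fun_prop
  | .neg φ, k => by
    have := φ.fp_eval k
    unfold StateFormula.eval; fun_prop
  | .disj φ₁ φ₂, k => by
    have := φ₁.fp_eval k
    have := φ₂.fp_eval (k + φ₁.numFlowQuantifiers)
    unfold StateFormula.eval; fun_prop
  | .allPaths ψ, k => by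
    have h := FP.pathTypes ψ (ψ.fp_eval k)
    have h' : FP fun z : Env × ℕ => pathTypes ψ (ψ.eval k) z.1 := h.comp (by fun_prop)
    unfold StateFormula.eval; fun_prop
  | .allFlows φ, k => by unfold StateFormula.eval; fun_prop

@[fun_prop]
theorem PathFormula.fp_eval : (ψ : PathFormula ℕ) → (k : ℕ) → FP (ψ.eval k)
  | .state φ, k => by
    have := φ.fp_eval k
    unfold PathFormula.eval; fun_prop
  | .neg ψ, k => by
    have := ψ.fp_eval k
    unfold PathFormula.eval; fun_prop
  | .disj ψ₁ ψ₂, k => by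
    have := ψ₁.fp_eval k
    have := ψ₂.fp_eval (k + ψ₁.numFlowQuantifiers)
    unfold PathFormula.eval; fun_prop
  | .next ψ, k => by
    have := ψ.fp_eval k
    unfold PathFormula.eval; fun_prop
  | .until ψ₁ ψ₂, k => by
    have := ψ₁.fp_eval k
    have := ψ₂.fp_eval (k + ψ₁.numFlowQuantifiers)
    unfold PathFormula.eval; fun_prop

end

/-! ## Correctness of the evaluation -/

mutual

/-- The formulas in the scope of a flow quantifier, innermost first. -/
def StateFormula.bodies : StateFormula ℕ → List (StateFormula ℕ)
  | .atom _ => []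
  | .flowGt _ => []
  | .flowGe _ => []
  | .neg φ => φ.bodies
  | .disj φ₁ φ₂ => φ₁.bodies ++ φ₂.bodies
  | .allPaths ψ => ψ.bodies
  | .allFlows φ => φ.bodies ++ [φ]

/-- The formulas in the scope of a flow quantifier, innermost first. -/
def PathFormula.bodies : PathFormula ℕ → List (StateFormula ℕ)
  | .state φ => φ.bodies
  | .neg ψ => ψ.bodies
  | .disj ψ₁ ψ₂ => ψ₁.bodies ++ ψ₂.bodies
  | .next ψ => ψ.bodies
  | .until ψ₁ ψ₂ => ψ₁.bodies ++ ψ₂.bodies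

end

mutual

theorem StateFormula.length_bodies : (φ : StateFormula ℕ) → φ.bodies.length = φ.numFlowQuantifiers
  | .atom _ => rfl
  | .flowGt _ => rfl
  | .flowGe _ => rfl
  | .neg φ => φ.length_bodies
  | .disj φ₁ φ₂ => by
    simp [StateFormula.bodies, StateFormula.numFlowQuantifiers, φ₁.length_bodies, φ₂.length_bodies]
  | .allPaths ψ => ψ.length_bodies
  | .allFlows φ => by
    simp [StateFormula.bodies, StateFormula.numFlowQuantifiers, φ.length_bodies]

theorem PathFormula.length_bodies : (ψ : PathFormula ℕ) → ψ.bodies.length = ψ.numFlowQuantifiers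
  | .state φ => φ.length_bodies
  | .neg ψ => ψ.length_bodies
  | .disj ψ₁ ψ₂ => by
    simp [PathFormula.bodies, PathFormula.numFlowQuantifiers, ψ₁.length_bodies, ψ₂.length_bodies]
  | .next ψ => ψ.length_bodies
  | .until ψ₁ ψ₂ => by
    simp [PathFormula.bodies, PathFormula.numFlowQuantifiers, ψ₁.length_bodies, ψ₂.length_bodies]

end

/-- If `b` occurs in a list of bodies, then it is preceded by its own bodies. -/
def BodiesClosed (L : List (StateFormula ℕ)) : Prop :=
  ∀ l b l', L = l ++ b :: l' → ∃ l₁, l = l₁ ++ b.bodies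

theorem BodiesClosed.append {L L' : List (StateFormula ℕ)} (h : BodiesClosed L)
    (h' : BodiesClosed L') : BodiesClosed (L ++ L') := by
  intro l b l' hl
  rcases List.append_eq_append_iff.1 hl with ⟨a, rfl, ha⟩ | ⟨a, rfl, ha⟩
  · obtain ⟨l₁, rfl⟩ := h' a b l' ha
    exact ⟨L ++ l₁, by simp⟩
  · cases a with
    | nil =>
      obtain ⟨l₁, h₁⟩ := h' [] b l' (by simpa using ha.symm)
      have : b.bodies = [] := (List.append_eq_nil_iff.1 h₁.symm).2
      exact ⟨l, by simp [this]⟩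
    | cons c a =>
      obtain ⟨rfl, _⟩ := List.cons.inj ha
      exact h l b a rfl

theorem bodiesClosed_nil : BodiesClosed [] := fun l b l' h => by simp at h

mutual

theorem StateFormula.bodiesClosed : (φ : StateFormula ℕ) → BodiesClosed φ.bodies
  | .atom _ => bodiesClosed_nil
  | .flowGt _ => bodiesClosed_nil
  | .flowGe _ => bodiesClosed_nil
  | .neg φ => φ.bodiesClosed
  | .disj φ₁ φ₂ => φ₁.bodiesClosed.append φ₂.bodiesClosed
  | .allPaths ψ => ψ.bodiesClosed
  | .allFlows φ => by
    intro l b l' h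
    rw [StateFormula.bodies] at h
    rcases List.eq_nil_or_concat l' with rfl | ⟨l', c, rfl⟩
    · obtain ⟨h₁, h₂⟩ := List.append_inj' h rfl
      obtain rfl : φ = b := by simpa using h₂
      exact ⟨[], by simp [h₁]⟩
    · rw [List.concat_eq_append, ← List.cons_append, ← List.append_assoc] at h
      exact φ.bodiesClosed l b l' (List.append_inj' h rfl).1

theorem PathFormula.bodiesClosed : (ψ : PathFormula ℕ) → BodiesClosed ψ.bodies
  | .state φ => φ.bodiesClosed
  | .neg ψ => ψ.bodiesClosed
  | .disj ψ₁ ψ₂ => ψ₁.bodiesClosed.append ψ₂.bodiesClosed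
  | .next ψ => ψ.bodiesClosed
  | .until ψ₁ ψ₂ => ψ₁.bodiesClosed.append ψ₂.bodiesClosed

end

section Closed

variable {n : ℕ} (N : FlowNetwork ℕ (Fin n))

mutual

theorem StateFormula.sat_of_closed : (φ : StateFormula ℕ) → φ.Closed → ∀ v f f',
    φ.Sat N v f ↔ φ.Sat N v f'
  | .atom _, _ => by simp [StateFormula.Sat]
  | .flowGt _, h => h.elim
  | .flowGe _, h => h.elim
  | .neg φ, h => fun v f f' => by
    simp only [StateFormula.Sat]
    rw [φ.sat_of_closed h v f f']
  | .disj φ₁ φ₂, h => fun v f f' => by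
    simp only [StateFormula.Sat]
    rw [φ₁.sat_of_closed h.1 v f f', φ₂.sat_of_closed h.2 v f f']
  | .allPaths ψ, h => fun v f f' => by
    simp only [StateFormula.Sat]
    simp only [fun π => ψ.sat_of_closed h π f f']
  | .allFlows _, _ => by simp [StateFormula.Sat]

theorem PathFormula.sat_of_closed : (ψ : PathFormula ℕ) → ψ.Closed → ∀ π f f',
    ψ.Sat N π f ↔ ψ.Sat N π f'
  | .state φ, h => fun π f f' => by
    simp only [PathFormula.Sat]
    simp only [fun v => φ.sat_of_closed h v f f']
  | .neg ψ, h => fun π f f' => by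
    simp only [PathFormula.Sat]
    rw [ψ.sat_of_closed h π f f']
  | .disj ψ₁ ψ₂, h => fun π f f' => by
    simp only [PathFormula.Sat]
    rw [ψ₁.sat_of_closed h.1 π f f', ψ₂.sat_of_closed h.2 π f f']
  | .next ψ, h => fun π f f' => by
    simp only [PathFormula.Sat]
    rw [ψ.sat_of_closed h _ f f']
  | .until ψ₁ ψ₂, h => fun π f f' => by
    simp only [PathFormula.Sat]
    simp only [fun π => ψ₁.sat_of_closed h.1 π f f', fun π => ψ₂.sat_of_closed h.2 π f f']

end

end Closed

section Flow

variable {n : ℕ} {N : FlowNetwork ℕ (Fin n)} {m : ℕ}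

/-- The sum of a function on the edges that satisfy a condition, as a sum over all pairs. -/
theorem sum_edges (N : FlowNetwork ℕ (Fin n)) (f : {e // e ∈ N.E} → ℕ) (p : Fin n × Fin n → Prop)
    [DecidablePred p] : (∑ e : {e // e ∈ N.E}, if p e.1 then f e else 0) =
      ∑ u, ∑ w, if p (u, w) then (if h : (u, w) ∈ N.E then f ⟨(u, w), h⟩ else 0) else 0 := by
  rw [← Fintype.sum_prod_type' (f := fun u w =>
    if p (u, w) then (if h : (u, w) ∈ N.E then f ⟨(u, w), h⟩ else 0) else 0),
    ← Finset.sum_subset (Finset.subset_univ N.E), ← Finset.sum_coe_sort N.E]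
  · exact Finset.sum_congr rfl fun e _ => by simp
  · intro e _ he
    simp [he]

/-- The values of `e` represent the values `f`. -/
def Represents (N : FlowNetwork ℕ (Fin n)) (f : {e // e ∈ N.E} → ℕ) (r : NetCode) : Prop :=
  ∀ u w (h : (u, w) ∈ N.E), bitsVal (r.cap u w) = f ⟨(u, w), h⟩

variable {f : {e // e ∈ N.E} → ℕ} {r : NetCode} {t : List (List Bool)}

theorem Represents.flowVal (h : Represents N f r) (u w : Fin n) :
    bitsVal (Env.flowVal (N.netCode m, r, t) u w) =
      if h : (u, w) ∈ N.E then f ⟨(u, w), h⟩ else 0 := by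
  rw [Env.flowVal, N.edge_netCode]
  split
  · simpa [*] using h u w _
  · simp [*, bitsVal]

theorem sum_map_range (n : ℕ) (g : ℕ → ℕ) : ((List.range n).map g).sum = ∑ w : Fin n, g w := by
  rw [← map_finRange, Fin.sum_univ_def]

theorem Represents.inflow (h : Represents N f r) (v : Fin n) :
    bitsVal (Env.inflow (N.netCode m, r, t) v) = N.inflow f v := by
  rw [Env.inflow, bitsVal_sumBits, List.map_map, FlowNetwork.inflow,
    sum_edges N f fun e => e.2 = v]
  refine (sum_map_range n _).trans (Finset.sum_congr rfl fun u _ => ?_)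
  simp [h.flowVal]

theorem Represents.outflow (h : Represents N f r) (v : Fin n) :
    bitsVal (Env.outflow (N.netCode m, r, t) v) = N.outflow f v := by
  rw [Env.outflow, bitsVal_sumBits, List.map_map, FlowNetwork.outflow,
    sum_edges N f fun e => e.1 = v, Finset.sum_comm]
  refine (sum_map_range n _).trans (Finset.sum_congr rfl fun u _ => ?_)
  simp [h.flowVal]

theorem Represents.through {f : N.Flow} (h : Represents N f.val r) (v : Fin n) :
    bitsVal (Env.through (N.netCode m, r, t) v) = f.through v := by
  rw [Env.through, N.isSource_netCode, FlowNetwork.Flow.through]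
  split <;> simp [*, h.inflow, h.outflow]

theorem Represents.isFlow (f : N.Flow) (h : Represents N f.val r) :
    Env.isFlow (N.netCode m, r, t) = true := by
  simp only [Env.isFlow, Bool.and_eq_true, List.all_eq_true, List.mem_range, leBits_eq,
    decide_eq_true_eq, Bool.or_eq_true]
  refine ⟨fun u hu w hw => ?_, fun u hu => ?_⟩
  · lift u to Fin n using hu
    lift w to Fin n using hw
    rw [h.flowVal]
    split
    · rw [N.cap_netCode _ _ _ ‹_›, bitsVal_bits]
      exact f.le_capacity _
    · exact Nat.zero_le _
  · lift u to Fin n using hu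
    rw [h.inflow, h.outflow, N.isSource_netCode, N.isTarget_netCode, decide_eq_true_eq,
      decide_eq_true_eq]
    by_cases h₁ : u = N.s
    · exact .inl (.inl h₁)
    by_cases h₂ : u ∈ N.T
    · exact .inl (.inr h₂)
    have := f.conservation u h₁ h₂
    exact .inr ⟨this.le, this.ge⟩

theorem exists_represents (h : Env.isFlow (N.netCode m, r, t) = true) :
    ∃ f : N.Flow, Represents N f.val r := by
  have hr : Represents N (fun e => bitsVal (r.cap e.1.1 e.1.2)) r := fun u w h => rfl
  simp only [Env.isFlow, Bool.and_eq_true, List.all_eq_true, List.mem_range, leBits_eq,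
    decide_eq_true_eq, Bool.or_eq_true] at h
  refine ⟨⟨fun e => bitsVal (r.cap e.1.1 e.1.2), fun e => ?_, fun v hs hT => ?_⟩, hr⟩
  · have := h.1 e.1.1 e.1.1.2 e.1.2 e.1.2.2
    rwa [hr.flowVal, dif_pos e.2, N.cap_netCode _ _ _ e.2, bitsVal_bits] at this
  · have := h.2 v v.2
    rw [hr.inflow, hr.outflow, N.isSource_netCode, N.isTarget_netCode] at this
    simp only [hs, hT, decide_false, Bool.false_eq_true, false_or] at this
    exact le_antisymm this.1 this.2

end Flow

section Eval

variable {n : ℕ} (N : FlowNetwork ℕ (Fin n))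

/-- The truth value and the memory of a path. -/
def PathFormula.evalPath (ψ : PathFormula ℕ) (k : ℕ) (e : Env) (π : List (Fin n)) : Bool × BinTree :=
  π.foldr (fun u t => ψ.eval k (e, u, t.2)) (false, .leaf)

variable {N}

theorem mem_pathNodes {ψ : PathFormula ℕ} {u : ℕ} {t : Bool × BinTree} :
    (u, t) ∈ pathNodes ψ n ↔ u < n ∧ t.2 ∈ ψ.memories := by
  obtain ⟨b, m⟩ := t
  cases b <;> simp [pathNodes]

theorem PathFormula.eval_mem (ψ : PathFormula ℕ) (k : ℕ) (z : Env × ℕ × BinTree) :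
    (ψ.eval k z).2 ∈ ψ.memories := by
  match ψ with
  | .state φ => simp [PathFormula.eval, PathFormula.memories]
  | .neg ψ => simpa [PathFormula.eval, PathFormula.memories] using ψ.eval_mem k z
  | .disj ψ₁ ψ₂ =>
    simp only [PathFormula.eval, PathFormula.memories, List.mem_flatMap, List.mem_map]
    exact ⟨_, ψ₁.eval_mem _ _, _, ψ₂.eval_mem _ _, rfl⟩
  | .next ψ =>
    simp only [PathFormula.eval, PathFormula.memories, List.mem_flatMap]
    refine ⟨_, ψ.eval_mem k (z.1, z.2.1, z.2.2.tl), ?_⟩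
    cases (ψ.eval k (z.1, z.2.1, z.2.2.tl)).1 <;> simp
  | .until ψ₁ ψ₂ =>
    simp only [PathFormula.eval, PathFormula.memories, List.mem_flatMap]
    refine ⟨_, ψ₁.eval_mem k (z.1, z.2.1, z.2.2.tl.hd), _,
      ψ₂.eval_mem (k + ψ₁.numFlowQuantifiers) (z.1, z.2.1, z.2.2.tl.tl), ?_⟩
    generalize ((ψ₂.eval (k + ψ₁.numFlowQuantifiers) (z.1, z.2.1, z.2.2.tl.tl)).1 ||
      ((ψ₁.eval k (z.1, z.2.1, z.2.2.tl.hd)).1 && z.2.2.hd.isNode)) = b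
    cases b <;> simp

theorem mem_pathTypes (ψ : PathFormula ℕ) (k : ℕ) {m : ℕ} {r : NetCode} {t : List (List Bool)}
    (v : Fin n) (b : Bool × BinTree) :
    ((v : ℕ), b) ∈ pathTypes ψ (ψ.eval k) (N.netCode m, r, t) ↔
      ∃ π, N.IsTargetPath v π ∧ ψ.evalPath k (N.netCode m, r, t) π = b := by
  constructor
  · intro h
    have := reach_induction (nodes := pathNodes ψ n)
      (p := fun c : ℕ × Bool × BinTree => ∃ hc : c.1 < n, ∃ π, N.IsTargetPath ⟨c.1, hc⟩ π ∧
        ψ.evalPath k (N.netCode m, r, t) π = c.2) (fun c hc h => ?_) (fun c d hd h he => ?_) _ h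
    · exact this.2
    · have hc := (mem_pathNodes.1 hc).1
      obtain ⟨c, c'⟩ := c
      lift c to Fin n using hc
      simp only [N.isTarget_netCode, Bool.and_eq_true, decide_eq_true_eq] at h
      exact ⟨c.2, [c], ⟨rfl, by simp, c, h.1, rfl⟩, h.2.symm⟩
    · have hd := (mem_pathNodes.1 hd).1
      obtain ⟨hc, π, ⟨hπ₁, hπ₂, hπ₃⟩, hπ⟩ := h
      obtain ⟨d, d'⟩ := d
      obtain ⟨c, c'⟩ := c
      simp only at hc hd hπ₁ hπ
      lift d to Fin n using hd
      lift c to Fin n using hc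
      simp only [N.edge_netCode, Bool.and_eq_true, decide_eq_true_eq] at he
      obtain ⟨a, π, rfl⟩ : ∃ a π', π = a :: π' := by
        cases π with
        | nil => simp at hπ₁
        | cons a π' => exact ⟨a, π', rfl⟩
      obtain rfl : a = c := by simpa using hπ₁
      refine ⟨d.2, d :: a :: π, ⟨rfl, ?_, ?_⟩, ?_⟩
      · exact List.isChain_cons_cons.2 ⟨he.1, hπ₂⟩
      · simpa using hπ₃
      · rw [he.2, ← hπ]; rfl
  · rintro ⟨π, ⟨h₁, h₂, h₃⟩, rfl⟩
    induction π generalizing v with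
    | nil => simp at h₁
    | cons u π ih =>
      obtain rfl : u = v := by simpa using h₁
      refine mem_reach.2 ⟨mem_pathNodes.2 ⟨u.2, ψ.eval_mem k _⟩, ?_⟩
      cases π with
      | nil =>
        left
        have h₃ : u ∈ N.T := by simpa using h₃
        simp [N.isTarget_netCode, h₃, PathFormula.evalPath]
      | cons w π =>
        right
        obtain ⟨he, h₂⟩ := List.isChain_cons_cons.1 h₂
        refine ⟨_, ih w rfl h₂ (by simpa using h₃), ?_⟩
        simp [N.edge_netCode, he, PathFormula.evalPath]

variable (N) in
/-- From position `k` on, the table contains the truth values of the formulas `𝒜 b` for the bodies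
`b` in the list. -/
def TableFor (t : List (List Bool)) (L : List (StateFormula ℕ)) (k : ℕ) : Prop :=
  ∀ i b, L[i]? = some b → ∀ v : Fin n,
    (t.getD (k + i) []).getD v false = true ↔ ∀ f, b.Sat N v f

theorem TableFor.left {t L L' k} (h : TableFor N t (L ++ L') k) : TableFor N t L k :=
  fun i b hb => h i b (by
    rw [List.getElem?_append_left (List.getElem?_eq_some_iff.1 hb).1, hb])

theorem TableFor.right {t L L' k} (h : TableFor N t (L ++ L') k) : TableFor N t L' (k + L.length) :=
  fun i b hb => by
    rw [Nat.add_assoc]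
    exact h (L.length + i) b (by
      rw [List.getElem?_append_right (Nat.le_add_right ..), Nat.add_sub_cancel_left, hb])

namespace PathFormula

variable (ψ ψ₁ ψ₂ : PathFormula ℕ) (k : ℕ) (e : Env)

theorem evalPath_cons (u : Fin n) (π : List (Fin n)) :
    ψ.evalPath k e (u :: π) = ψ.eval k (e, u, (ψ.evalPath k e π).2) := rfl

theorem evalPath_neg (π : List (Fin n)) :
    ((neg ψ).evalPath k e π).2 = (ψ.evalPath k e π).2 := by
  induction π with
  | nil => rfl
  | cons u π ih => rw [evalPath_cons, evalPath_cons, eval, ih]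

theorem _root_.BinTree.hd_node (a b : BinTree) : (a.node b).hd = a := rfl

theorem _root_.BinTree.tl_node (a b : BinTree) : (a.node b).tl = b := rfl

theorem evalPath_disj (π : List (Fin n)) :
    ((disj ψ₁ ψ₂).evalPath k e π).2.hd = (ψ₁.evalPath k e π).2 ∧
    ((disj ψ₁ ψ₂).evalPath k e π).2.tl = (ψ₂.evalPath (k + ψ₁.numFlowQuantifiers) e π).2 := by
  induction π with
  | nil => exact ⟨rfl, rfl⟩
  | cons u π ih =>
    simp only [evalPath_cons, eval, ih, BinTree.hd_node, BinTree.tl_node, and_self]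

theorem _root_.BinTree.isNode_enc (b : Bool) : (enc b).isNode = b := by cases b <;> rfl

theorem evalPath_next (π : List (Fin n)) :
    ((next ψ).evalPath k e π).2.hd.isNode = (ψ.evalPath k e π).1 ∧
    ((next ψ).evalPath k e π).2.tl = (ψ.evalPath k e π).2 := by
  induction π with
  | nil => exact ⟨rfl, rfl⟩
  | cons u π ih =>
    simp only [evalPath_cons, eval, ih, BinTree.hd_node, BinTree.tl_node, BinTree.isNode_enc, and_self]

theorem evalPath_until (π : List (Fin n)) :
    ((PathFormula.until ψ₁ ψ₂).evalPath k e π).2.hd.isNode =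
      ((PathFormula.until ψ₁ ψ₂).evalPath k e π).1 ∧
    ((PathFormula.until ψ₁ ψ₂).evalPath k e π).2.tl.hd = (ψ₁.evalPath k e π).2 ∧
    ((PathFormula.until ψ₁ ψ₂).evalPath k e π).2.tl.tl =
      (ψ₂.evalPath (k + ψ₁.numFlowQuantifiers) e π).2 := by
  induction π with
  | nil => exact ⟨rfl, rfl, rfl⟩
  | cons u π ih =>
    simp only [evalPath_cons, eval, ih, BinTree.hd_node, BinTree.tl_node, BinTree.isNode_enc, and_self]

theorem sat_until_cons (f : N.Flow) (u : Fin n) (π : List (Fin n)) :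
    (PathFormula.until ψ₁ ψ₂).Sat N (u :: π) f ↔
      ψ₂.Sat N (u :: π) f ∨ ψ₁.Sat N (u :: π) f ∧ (PathFormula.until ψ₁ ψ₂).Sat N π f := by
  simp only [Sat]
  constructor
  · rintro ⟨j, hj, h₂, h₁⟩
    cases j with
    | zero => exact .inl h₂
    | succ j =>
      exact .inr ⟨h₁ 0 (Nat.succ_pos j), j, by simpa using hj, h₂, fun i hi =>
        h₁ (i + 1) (by omega)⟩
  · rintro (h | ⟨h, j, hj, h₂, h₁⟩)
    · exact ⟨0, by simp, h, by simp⟩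
    · refine ⟨j + 1, by simpa using hj, h₂, fun i hi => ?_⟩
      cases i with
      | zero => exact h
      | succ i => exact h₁ i (by omega)

end PathFormula

mutual

theorem StateFormula.eval_iff {m : ℕ} (hm : N.AP = Finset.range m) {f : N.Flow} {r : NetCode}
    (hr : Represents N f.val r) {t : List (List Bool)} : (φ : StateFormula ℕ) → (k : ℕ) →
    TableFor N t φ.bodies k → (v : Fin n) →
    (φ.eval k ((N.netCode m, r, t), v) = true ↔ φ.Sat N v f)
  | .atom p, k, _, v => by
    simp [StateFormula.eval, StateFormula.Sat, N.label_netCode v hm]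
  | .flowGt γ, k, _, v => by
    simp [StateFormula.eval, StateFormula.Sat, leBits_eq, hr.through, bitsVal_bits]
  | .flowGe γ, k, _, v => by
    simp [StateFormula.eval, StateFormula.Sat, leBits_eq, hr.through, bitsVal_bits]
  | .neg φ, k, h, v => by
    rw [StateFormula.eval, StateFormula.Sat, ← φ.eval_iff hm hr k h v]
    simp
  | .disj φ₁ φ₂, k, h, v => by
    rw [StateFormula.eval, StateFormula.Sat, ← φ₁.eval_iff hm hr k h.left v,
      ← φ₂.eval_iff hm hr _ (φ₁.length_bodies ▸ h.right) v, Bool.or_eq_true]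
  | .allPaths ψ, k, h, v => by
    have hψ := fun π hπ => ψ.eval_iff hm hr k h π hπ
    simp only [StateFormula.eval, StateFormula.Sat, List.all_eq_true, Bool.or_eq_true,
      Bool.not_eq_true', decide_eq_false_iff_not]
    constructor
    · intro H π hπ
      have := H (v, _) ((mem_pathTypes ψ k v _).2 ⟨π, hπ, rfl⟩)
      refine (hψ π ?_).1 (by simpa using this)
      rintro rfl
      simpa using hπ.1
    · rintro H ⟨u, b⟩ hb
      by_cases hu : u = v
      · subst hu
        obtain ⟨π, hπ, rfl⟩ := (mem_pathTypes ψ k v _).1 hb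
        refine .inr ((hψ π ?_).2 (H π hπ))
        rintro rfl
        simpa using hπ.1
      · exact .inl hu
  | .allFlows φ, k, h, v => by
    rw [StateFormula.eval, StateFormula.Sat, ← φ.length_bodies]
    exact h _ φ (by simp [StateFormula.bodies]) v

theorem PathFormula.eval_iff {m : ℕ} (hm : N.AP = Finset.range m) {f : N.Flow} {r : NetCode}
    (hr : Represents N f.val r) {t : List (List Bool)} : (ψ : PathFormula ℕ) → (k : ℕ) →
    TableFor N t ψ.bodies k → (π : List (Fin n)) → π ≠ [] →
    ((ψ.evalPath k (N.netCode m, r, t) π).1 = true ↔ ψ.Sat N π f)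
  | .state φ, k, h, u :: π, _ => by
    rw [PathFormula.evalPath_cons, PathFormula.eval, PathFormula.Sat, φ.eval_iff hm hr k h u]
    simp
  | .neg ψ, k, h, u :: π, hπ => by
    rw [PathFormula.evalPath_cons, PathFormula.eval, PathFormula.evalPath_neg, PathFormula.Sat,
      ← ψ.eval_iff hm hr k h _ hπ, PathFormula.evalPath_cons]
    simp
  | .disj ψ₁ ψ₂, k, h, u :: π, hπ => by
    have := PathFormula.evalPath_disj ψ₁ ψ₂ k (N.netCode m, r, t) π
    rw [PathFormula.evalPath_cons, PathFormula.eval, PathFormula.Sat,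
      ← ψ₁.eval_iff hm hr k h.left _ hπ,
      ← ψ₂.eval_iff hm hr _ (ψ₁.length_bodies ▸ h.right) _ hπ, PathFormula.evalPath_cons,
      PathFormula.evalPath_cons]
    simp only [this, Bool.or_eq_true]
  | .next ψ, k, h, u :: π, _ => by
    rw [PathFormula.evalPath_cons, PathFormula.eval, PathFormula.Sat]
    simp only [(PathFormula.evalPath_next ψ k (N.netCode m, r, t) π).1]
    by_cases hπ : π = []
    · subst hπ
      simp [PathFormula.evalPath]
    · rw [ψ.eval_iff hm hr k h π hπ]
      simp [List.length_pos_iff, hπ]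
  | .until ψ₁ ψ₂, k, h, π, _ => by
    have h₁ := fun π hπ => ψ₁.eval_iff hm hr k h.left π hπ
    have h₂ := fun π hπ => ψ₂.eval_iff hm hr _ (ψ₁.length_bodies ▸ h.right) π hπ
    have key : ∀ π, ((PathFormula.until ψ₁ ψ₂).evalPath k (N.netCode m, r, t) π).1 = true ↔
        (PathFormula.until ψ₁ ψ₂).Sat N π f := by
      intro π
      induction π with
      | nil => simp [PathFormula.evalPath, PathFormula.Sat]
      | cons u π ih =>
        have := PathFormula.evalPath_until ψ₁ ψ₂ k (N.netCode m, r, t) π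
        rw [PathFormula.sat_until_cons, ← h₁ _ (List.cons_ne_nil _ _),
          ← h₂ _ (List.cons_ne_nil _ _), ← ih, PathFormula.evalPath_cons, PathFormula.eval,
          PathFormula.evalPath_cons, PathFormula.evalPath_cons]
        simp only [this, Bool.or_eq_true, Bool.and_eq_true]
    exact key π

end

end Eval

/-! ## Polynomial-time functions and complexity classes -/

section Machines

open Prog

/-- Replace the word on the input stack by its code on the main stack. -/
def load : Prog := .seq (.push 0 false) (.seq oneToTwo
  (.loop 2 fun b => .seq (pushWord (word b)) (.push 0 true)))

theorem does_loadLoop {A : Set (List Bool)} {m a b c : List Bool} (l : List Bool) :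
    Does A (.loop 2 fun b => .seq (pushWord (word b)) (.push 0 true)) ![word l ++ m, a, b, c]
      (6 * b.length + 1) 0 ![word (b.reverse ++ l) ++ m, a, [], c] := by
  induction b generalizing l with
  | nil => exact does_loop_nil rfl
  | cons x b ih =>
    have h := (does_pushWord (A := A) (m := word l ++ m) (a := a) (b := b) (c := c) (word x)).seq
      (push_zero true)
    have h' := ih (x :: l)
    rw [word_cons, List.cons_append, List.append_assoc] at h'
    refine (loop_two (body := fun b => .seq (pushWord (word b)) (.push 0 true)) h h').conv ?_
      (by simp)
    have := sz_bool_le x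
    rw [sz] at this
    simp only [List.length_cons]
    omega

theorem does_load {A : Set (List Bool)} (x : List Bool) :
    Does A load ![[], x, [], []] (8 * x.length + 3) 0 ![word x, [], [], []] := by
  have h := (push_zero (A := A) (m := []) (a := x) (b := []) (c := []) false).seq
    ((does_oneToTwo (A := A)).seq (does_loadLoop (A := A) (m := []) (c := [])
      (b := x.reverse ++ []) ([] : List Bool)))
  exact h.conv (by simp; omega) (by simp)

open scoped Classical in
/-- A predicate that can be decided in polynomial time with `q x` oracle calls for `x` is decided by
a machine. -/
theorem FPQ.exists_machine {A : Set (List Bool)} {f : List Bool → Bool} {q : List Bool → ℕ}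
    (h : FPQ {A} f q) : ∃ (M : OracleTM) (p : Polynomial ℕ),
      M.DecidesInTime A {x | f x = true} p ∧ ∀ x, M.CallsAtMost A x (q x) := by
  obtain ⟨P, T, ⟨p, hp⟩, -, hP⟩ := h
  have key : ∀ x, ∃ (t k : ℕ) (C : (Prog.seq load P).machine.Cfg),
      (Prog.seq load P).machine.Run A ((Prog.seq load P).machine.init x) t k C ∧
      t ≤ 8 * x.length + 4 + T x ∧ k ≤ q x ∧ C.l = none ∧ C.stk (0 : Fin 4) = word (f x) := by
    intro x
    have h₂ := hP A rfl x []
    rw [List.append_nil, List.append_nil] at h₂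
    obtain ⟨t, ht, k, hk, h⟩ := (does_load x).seq h₂
    have hx : (![[], x, [], []] : Store) = fun k => if k = 1 then x else [] := by
      funext k
      fin_cases k <;> rfl
    rw [hx] at h
    obtain ⟨v, h⟩ := run_machine h
    exact ⟨_, _, _, h, by omega, by omega, rfl, rfl⟩
  refine ⟨(Prog.seq load P).machine,
    8 * Polynomial.X + 4 + p.comp (4 * Polynomial.X + 1), fun x => ?_, fun x t k C hC => ?_⟩
  · obtain ⟨t, k, C, h, ht, -, hl, hs⟩ := key x
    refine ⟨t, k, C, h, ht.trans ?_, hl, ?_⟩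
    · have := (hp x).trans (eval_mono p (sz_list_bool_le x))
      simpa using this
    · change (C.stk (0 : Fin 4)).head? = _
      rw [hs]
      cases h : f x <;> simp [h, word, BinTree.ser]
  · obtain ⟨t', k', C', h, -, hk, hl, -⟩ := key x
    exact (h.calls_le hl hC).trans hk

theorem FP.inP {f : List Bool → Bool} (h : FP f) : InP {x | f x = true} := by
  obtain ⟨M, p, hM, -⟩ := (h.fpq (𝒪 := {∅}) (q := fun _ => 0)).exists_machine
  exact ⟨M, p, hM⟩

/-- The words for which there is a certificate, no longer than the word, accepted by `f`. -/
def certified (f : List Bool → Bool) : Set (List Bool) :=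
  {x | ∃ w, w.length ≤ x.length ∧ f (pairCode x w) = true}

theorem FP.inNP {f : List Bool → Bool} (h : FP f) : InNP (certified f) :=
  ⟨_, h.inP, Polynomial.X, fun x => by simp [certified]⟩

end Machines

/-! ## Decoding -/

namespace BinTree

/-- The tree with the given serialization. -/
def des (l : List Bool) : BinTree :=
  (l.reverse.foldl (fun (s : List BinTree) b =>
    bif b then node (s.headD leaf) (s.tail.headD leaf) :: s.tail.tail else leaf :: s) []).headD leaf

theorem des_ser (t : BinTree) : des t.ser = t := by
  have key : ∀ r, (t.ser ++ r).foldr (fun b (s : List BinTree) =>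
      bif b then node (s.headD leaf) (s.tail.headD leaf) :: s.tail.tail else leaf :: s) [] =
      t :: r.foldr (fun b (s : List BinTree) =>
      bif b then node (s.headD leaf) (s.tail.headD leaf) :: s.tail.tail else leaf :: s) [] := by
    induction t with
    | leaf => intro r; rfl
    | node a b iha ihb =>
      intro r
      rw [ser, List.cons_append, List.append_assoc, List.foldr_cons, iha, ihb]
      rfl
  have := key []
  rw [List.append_nil] at this
  rw [des, List.foldl_reverse, this]
  rfl

/-- The subtrees on the right spine. -/
def children : BinTree → List BinTree
  | leaf => []
  | node a b => a :: b.children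

theorem enc_children (t : BinTree) : enc t.children = t := by
  induction t with
  | leaf => rfl
  | node a b _ ih => rw [children, enc_cons, ih, enc_tree]

theorem children_enc {α : Type} [Enc α] (l : List α) : (enc l).children = l.map enc := by
  induction l with
  | nil => rfl
  | cons a l ih => rw [enc_cons, children, ih, List.map_cons]

theorem length_children_enc (n : ℕ) : (enc n).children.length = n := by
  induction n with
  | zero => rfl
  | succ n ih => rw [enc_succ, children, List.length_cons, ih]

theorem map_isNode_children_enc (l : List Bool) : (enc l).children.map isNode = l := by
  rw [children_enc, List.map_map]
  exact (List.map_congr_left fun b _ => isNode_enc b).trans l.map_id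

attribute [fun_prop] FP.hd FP.tl FP.isNode

@[fun_prop]
theorem _root_.FP.children {α : Type} [Enc α] {t : α → BinTree} (ht : FP t) :
    FP fun x => (t x).children := by
  have h : FP BinTree.children := FP.cast _ enc_children
  exact h.comp ht

@[fun_prop]
theorem _root_.FP.des {α : Type} [Enc α] {l : α → List Bool} (hl : FP l) :
    FP fun x => des (l x) := by
  have h : FP BinTree.des := by
    have h := FP.foldl_of_le_add (l := fun l : List Bool => l.reverse) (g := fun _ => [])
      (h := fun _ (s : List BinTree) b =>
        bif b then node (s.headD leaf) (s.tail.headD leaf) :: s.tail.tail else leaf :: s)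
      (B := fun _ => 4) (by fun_prop) (by fun_prop) (by fun_prop) (.const 4) fun _ s b _ => by
        rcases b with _ | _
        · simp; omega
        · rcases s with _ | ⟨s, _ | ⟨s', s''⟩⟩ <;>
          (simp only [cond_true, List.headD, List.tail, sz_cons, sz_nil, sz_node, sz_leaf]; omega)
    unfold BinTree.des
    fun_prop
  exact h.comp hl

end BinTree

/-! ## The oracle -/

/-- The truth value of a formula from a list. -/
def evalBody : List (StateFormula ℕ) → ℕ → Env × ℕ × ℕ → Bool
  | [], _ => fun _ => false
  | b :: L, j => fun z => bif decide (z.2.2 = j) then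
      b.eval (j - b.numFlowQuantifiers) (z.1, z.2.1) else evalBody L (j + 1) z

theorem evalBody_eq {L : List (StateFormula ℕ)} {i : ℕ} {b : StateFormula ℕ} (h : L[i]? = some b)
    (j : ℕ) (e : Env) (v : ℕ) :
    evalBody L j (e, v, j + i) = b.eval (j + i - b.numFlowQuantifiers) (e, v) := by
  induction L generalizing i j with
  | nil => simp at h
  | cons c L ih =>
    cases i with
    | zero =>
      obtain rfl : c = b := by simpa using h
      simp [evalBody]
    | succ i =>
      have := ih (i := i) (by simpa using h) (j + 1)
      rw [Nat.add_right_comm, Nat.add_assoc] at this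
      simp [evalBody, this]

@[fun_prop]
theorem FP.evalBody (L : List (StateFormula ℕ)) (j : ℕ) : FP (evalBody L j) := by
  induction L generalizing j with
  | nil => unfold _root_.evalBody; fun_prop
  | cons b L ih =>
    have := ih (j + 1)
    unfold _root_.evalBody
    fun_prop

/-- An oracle query: the description of a network, a vertex, the truth values of the flow
quantifiers evaluated so far, and the number of the flow quantifier to be evaluated. -/
abbrev Query : Type := List Bool × ℕ × List (List Bool) × ℕ

/-- The query with the given code. -/
def decodeQuery (q : List Bool) : Query :=
  ((BinTree.des q).hd.children.map BinTree.isNode, (BinTree.des q).tl.hd.children.length,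
    (BinTree.des q).tl.tl.hd.children.map (fun s => s.children.map BinTree.isNode),
    (BinTree.des q).tl.tl.tl.children.length)

theorem decodeQuery_word (z : Query) : decodeQuery (word z) = z := by
  obtain ⟨x, v, t, i⟩ := z
  have : (enc t).children.map (fun s => s.children.map BinTree.isNode) = t := by
    rw [BinTree.children_enc, List.map_map]
    exact (List.map_congr_left fun l _ => BinTree.map_isNode_children_enc l).trans t.map_id
  simp only [decodeQuery, word, BinTree.des_ser, enc_prod, BinTree.hd_node, BinTree.tl_node,
    BinTree.map_isNode_children_enc, BinTree.length_children_enc, this]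

/-- The word is a pair of a query about a formula from the list and a flow that refutes it. -/
def refutes (L : List (StateFormula ℕ)) (w : List Bool) : Bool :=
  let q := decodeQuery (parsePair w).1
  let e : Env := (parse q.1, parse (parsePair w).2, q.2.2.1)
  e.isFlow && !evalBody L 0 (e, q.2.1, q.2.2.2)

theorem FP.refutes (L : List (StateFormula ℕ)) : FP (refutes L) := by
  have h : FP decodeQuery := by unfold decodeQuery; fun_prop
  unfold _root_.refutes
  fun_prop

theorem length_bits_mono {a b : ℕ} (h : a ≤ b) : a.bits.length ≤ b.bits.length := by
  rw [Nat.size_eq_bits_len, Nat.size_eq_bits_len]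
  exact Nat.size_le_size h

theorem length_binaryCode (a : ℕ) : (binaryCode a).length = 2 * a.bits.length + 1 := by
  simp [binaryCode, List.length_flatMap, Nat.mul_comm]

section Oracle

variable {n m : ℕ} {N : FlowNetwork ℕ (Fin n)}

/-- The network with the values of a flow as its capacities. -/
def FlowNetwork.Flow.network (f : N.Flow) : FlowNetwork ℕ (Fin n) := { N with c := f.val }

theorem FlowNetwork.Flow.represents (f : N.Flow) :
    Represents N f.val (parse (f.network.encode m)) := by
  intro u w h
  rw [f.network.parse_encode, f.network.cap_netCode _ _ _ h, bitsVal_bits]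
  rfl

theorem FlowNetwork.Flow.length_encode_le (f : N.Flow) :
    (f.network.encode m).length ≤ (N.encode m).length := by
  simp only [FlowNetwork.encode, List.length_append, List.length_flatMap]
  refine Nat.add_le_add_left (List.sum_le_sum fun v _ => ?_) _
  simp only [List.length_cons, List.length_map]
  refine Nat.add_le_add_left ?_ _
  refine List.sum_le_sum fun w _ => ?_
  change (if h : (v, w) ∈ N.E then true :: binaryCode (f.val ⟨(v, w), h⟩) else [false]).length ≤ _
  split
  · have := length_bits_mono (f.le_capacity ⟨(v, w), ‹_›⟩)
    simp only [List.length_cons, length_binaryCode]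
    omega
  · exact le_rfl

theorem word_mem_oracle {L : List (StateFormula ℕ)} {i : ℕ} {b : StateFormula ℕ}
    (hm : N.AP = Finset.range m) (hb : L[i]? = some b) {t : List (List Bool)}
    (ht : TableFor N t b.bodies (i - b.numFlowQuantifiers)) (v : Fin n) :
    word ((N.encode m, (v : ℕ), t, i) : Query) ∈ certified (refutes L) ↔ ¬ ∀ f, b.Sat N v f := by
  have key : ∀ w, refutes L (pairCode (word ((N.encode m, (v : ℕ), t, i) : Query)) w) = true ↔
      Env.isFlow (N.netCode m, parse w, t) = true ∧
        b.eval (i - b.numFlowQuantifiers) ((N.netCode m, parse w, t), v) = false := by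
    intro w
    have := evalBody_eq hb 0 (N.netCode m, parse w, t) v
    rw [Nat.zero_add] at this
    simp only [refutes, parsePair_code, decodeQuery_word, N.parse_encode, this, Bool.and_eq_true,
      Bool.not_eq_true']
  constructor
  · rintro ⟨w, -, hw⟩ H
    obtain ⟨h₁, h₂⟩ := (key w).1 hw
    obtain ⟨f, hf⟩ := exists_represents h₁
    rw [(b.eval_iff hm hf _ ht v).2 (H f)] at h₂
    cases h₂
  · intro H
    obtain ⟨f, hf⟩ := not_forall.1 H
    refine ⟨f.network.encode m, ?_, (key _).2 ⟨Represents.isFlow f f.represents, ?_⟩⟩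
    · refine f.length_encode_le.trans ((length_le_sz _).trans ?_)
      change _ ≤ sz ((N.encode m, (v : ℕ), t, i) : Query)
      have := sz_prod ((N.encode m, (v : ℕ), t, i) : Query)
      simp only at this
      omega
    · rw [← Bool.not_eq_true, b.eval_iff hm f.represents _ ht v]
      exact hf

end Oracle

/-! ## The decision procedure -/

section Tables

open scoped Classical in
/-- The truth values of the first flow quantifiers, computed with oracle calls. -/
noncomputable def tables (A : Set (List Bool)) (x : List Bool) : ℕ → List (List Bool)
  | 0 => []
  | i + 1 => tables A x i ++ [(List.range (parse x).1).map fun v =>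
      !decide (word ((x, v, tables A x i, i) : Query) ∈ A)]

theorem fpq_tables (A : Set (List Bool)) (i : ℕ) :
    FPQ {A} (fun x => tables A x i) fun x => i * (parse x).1 := by
  classical
  induction i with
  | zero =>
    have : FP fun _ : List Bool => ([] : List (List Bool)) := by fun_prop
    exact this.fpq
  | succ i ih =>
    have h₁ : FPQ {A} (fun z : (List Bool × List (List Bool)) × ℕ =>
        !decide (word ((z.1.1, z.2, z.1.2, i) : Query) ∈ A)) fun _ => 1 := by
      have h : FP fun z : (List Bool × List (List Bool)) × ℕ =>
        ((z.1.1, z.2, z.1.2, i) : Query) := by fun_prop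
      have h' : FP fun b : Bool => !b := by fun_prop
      exact ((h'.fpq (q := fun _ => 0)).comp ((FPQ.ask A).comp (h.fpq (q := fun _ => 0)))).mono
        subset_rfl fun _ => le_rfl
    have h₂ := FPQ.map (f := fun (z : List Bool × List (List Bool)) v =>
      !decide (word ((z.1, v, z.2, i) : Query) ∈ A)) h₁
      (l := fun z : List Bool × List (List Bool) => List.range (parse z.1).1) (by fun_prop)
    have h₃ : FP fun z : (List Bool × List (List Bool)) × List Bool => z.1.2 ++ [z.2] := by fun_prop
    have h₄ := (h₃.fpq (𝒪 := {A}) (q := fun _ => 0)).comp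
      (FPQ.pair ((FP.id (α := List Bool × List (List Bool))).fpq (q := fun _ => 0)) h₂)
    have h₅ := h₄.comp (FPQ.pair ((FP.id (α := List Bool)).fpq (q := fun _ => 0)) ih)
    refine h₅.mono subset_rfl fun x => ?_
    simp [Nat.add_mul]

variable {n m : ℕ} {N : FlowNetwork ℕ (Fin n)}

theorem tableFor_tables {L : List (StateFormula ℕ)} (hL : BodiesClosed L)
    (hm : N.AP = Finset.range m) {i : ℕ} (hi : i ≤ L.length) :
    (tables (certified (refutes L)) (N.encode m) i).length = i ∧
      TableFor N (tables (certified (refutes L)) (N.encode m) i) (L.take i) 0 := by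
  classical
  induction i with
  | zero => exact ⟨rfl, fun i b h => by simp at h⟩
  | succ i ih =>
    obtain ⟨hlen, ht⟩ := ih (Nat.le_of_succ_le hi)
    refine ⟨by rw [tables, List.length_append, hlen]; rfl, fun j b hb v => ?_⟩
    rw [Nat.zero_add, tables]
    have hj : j < i + 1 := by
      have := (List.getElem?_eq_some_iff.1 hb).1
      rw [List.length_take] at this
      omega
    rw [List.getElem?_take_of_lt hj] at hb
    rcases Nat.lt_succ_iff_lt_or_eq.1 hj with hj | rfl
    · rw [List.getD_append _ _ _ _ (by rw [hlen]; exact hj)]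
      have := ht j b (by rw [List.getElem?_take_of_lt hj, hb]) v
      rwa [Nat.zero_add] at this
    · obtain ⟨hj', rfl⟩ := List.getElem?_eq_some_iff.1 hb
      obtain ⟨l₁, hl₁⟩ := hL (L.take j) L[j] (L.drop (j + 1)) (by simp)
      rw [hl₁] at ht
      have ht := ht.right
      have hlen' := congrArg List.length hl₁
      rw [List.length_take, List.length_append, StateFormula.length_bodies] at hlen'
      rw [show 0 + l₁.length = j - L[j].numFlowQuantifiers by omega] at ht
      rw [List.getD_append_right _ _ _ _ hlen.le, hlen, Nat.sub_self, List.getD_cons_zero,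
        N.parse_encode]
      change ((List.range n).map _).getD v false = true ↔ _
      rw [← map_finRange, getD_map_finRange]
      simp only [word_mem_oracle hm hb ht v, not_not, Bool.not_eq_true', decide_eq_false_iff_not]

/-- The decision procedure for the model-checking problem. -/
noncomputable def modelCheck (φ : StateFormula ℕ) (x : List Bool) : Bool :=
  isNetwork x && (List.range (parse x).1).any fun u => (parse x).isSource u &&
    φ.eval 0 ((parse x, (0, 0, []),
      tables (certified (refutes φ.bodies)) x φ.numFlowQuantifiers), u)

theorem fpq_modelCheck (φ : StateFormula ℕ) : FPQ {certified (refutes φ.bodies)} (modelCheck φ)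
    fun x => φ.numFlowQuantifiers * (parse x).1 := by
  have h₁ := FPQ.pair ((FP.id (α := List Bool)).fpq (q := fun _ => 0))
    (fpq_tables (certified (refutes φ.bodies)) φ.numFlowQuantifiers)
  have h₂ : FP fun z : List Bool × List (List Bool) => isNetwork z.1 &&
      (List.range (parse z.1).1).any fun u => (parse z.1).isSource u &&
        φ.eval 0 ((parse z.1, (0, 0, []), z.2), u) := by
    have := φ.fp_eval 0
    fun_prop
  exact ((h₂.fpq (q := fun _ => 0)).comp h₁).mono subset_rfl fun x => by simp

variable (N) in
/-- The zero flow. -/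
def FlowNetwork.zeroFlow : N.Flow where
  val _ := 0
  le_capacity _ := Nat.zero_le _
  conservation v _ _ := by simp [FlowNetwork.inflow, FlowNetwork.outflow]

theorem modelCheck_encode {φ : StateFormula ℕ} (hφ : φ.Closed) (hm : N.AP = Finset.range m) :
    modelCheck φ (N.encode m) = true ↔ N.Models φ := by
  have hr : Represents N N.zeroFlow.val (0, 0, []) := fun u w h => rfl
  have ht := (tableFor_tables φ.bodiesClosed hm φ.length_bodies.ge).2
  rw [List.take_of_length_le φ.length_bodies.le] at ht
  have h := φ.eval_iff hm hr 0 ht N.s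
  have hM : N.Models φ ↔ φ.Sat N N.s N.zeroFlow :=
    ⟨fun H => H _, fun H f => (φ.sat_of_closed N hφ _ _ _).1 H⟩
  rw [hM, ← h, modelCheck, isNetwork_iff.2 ⟨n, m, N, hm, rfl⟩, Bool.true_and, N.parse_encode,
    List.any_eq_true]
  simp only [List.mem_range, Bool.and_eq_true]
  constructor
  · rintro ⟨u, hu, hs, H⟩
    change u < n at hu
    lift u to Fin n using hu
    rw [N.isSource_netCode, decide_eq_true_eq] at hs
    rwa [hs] at H
  · exact fun H => ⟨N.s, N.s.2, by rw [N.isSource_netCode]; simp, H⟩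

theorem setOf_modelCheck {φ : StateFormula ℕ} (hφ : φ.Closed) :
    {x | modelCheck φ x = true} = modelCheckingProblem φ := by
  ext x
  constructor
  · intro hx
    have hx : modelCheck φ x = true := hx
    obtain ⟨n, m, N, hm, rfl⟩ := isNetwork_iff.1 (by
      rw [modelCheck, Bool.and_eq_true] at hx
      exact hx.1)
    exact ⟨n, m, N, hm, rfl, (modelCheck_encode hφ hm).1 hx⟩
  · rintro ⟨n, m, N, hm, rfl, h⟩
    exact (modelCheck_encode hφ hm).2 h

end Tables

theorem mainTheorem5 (φ : StateFormula ℕ) (hφ : φ.Closed) :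
    InDeltaTwoP (modelCheckingProblem φ) ∧
      ∃ A : Set (List Bool), InNP A ∧ ∃ (M : OracleTM) (p : Polynomial ℕ),
        M.DecidesInTime A (modelCheckingProblem φ) p ∧
        ∀ (n m : ℕ) (N : FlowNetwork ℕ (Fin n)), N.AP = Finset.range m →
          M.CallsAtMost A (N.encode m) (φ.numFlowQuantifiers * n) := by
  obtain ⟨M, p, hM, hq⟩ := (fpq_modelCheck φ).exists_machine
  rw [setOf_modelCheck hφ] at hM
  have hA := (FP.refutes φ.bodies).inNP
  refine ⟨⟨_, hA, M, p, hM⟩, _, hA, M, p, hM, fun n m N _ => ?_⟩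
  have := hq (N.encode m)
  rwa [N.parse_encode] at this
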